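/- Let $Z^{+}=(P^{+},Q^{+})$ and $Z^{-}=(P^{-},Q^{-})$ be real-analytic planar vector fields on the closed half-planes $\{y\ge 0\}$ and $\{y\le 0\}$, respectively, and put $\Sigma=\{y=0\}$. Suppose that the origin is an invisible fold-fold singularity of order $(2k^{+},2k^{-})$, $k^{\pm}\ge 1$, that is, $$Q^{\pm}(x,0)=\beta^{\pm}x^{2k^{\pm}-1}+O(x^{2k^{\pm}}),\qquad P^{+}(0,0)\,\beta^{+}<0,\qquad P^{-}(0,0)\,\beta^{-}>0 .$$ Suppose moreover that there are $\bar x>0$ and continuous functions $\tau^{\pm}\colon(0,\bar x)\to\mathbb R$ with $\tau^{+}(x)\tau^{-}(x)<0$ such that, for every $x\in(0,\bar x)$, the solution of $Z^{\pm}$ starting at $(x,0)$ lies in $\{\pm y>0\}$ at all times strictly between $0$ and $\tau^{\pm}(x)$ and is at a point $(\varphi^{\pm}(x),0)$ of $\Sigma$ with $\varphi^{\pm}(x)<0$ at time $\tau^{\pm}(x)$; that the functions $\varphi^{\pm}$, extended by $\varphi^{\pm}(0)=0$, are continuous on $[0,\bar x)$; and that $\varphi^{+}(x)\ne\varphi^{-}(x)$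 for all $x\in(0,\bar x)$. Let $\delta=1$ if $\tau^{+}<0<\tau^{-}$ and $\delta=-1$ if $\tau^{-}<0<\tau^{+}$ on $(0,\bar x)$, let $\sigma\in\{-1,1\}$ be the constant sign of $\delta(\varphi^{+}-\varphi^{-})$ on $(0,\bar x)$, and let $\mu=-\sigma\delta$. For $b\in\mathbb R$ let $Z_b$ be the piecewise vector field that equals $Z^{+}(x-b,y)$ for $y>0$ and $Z^{-}(x,y)$ for $y<0$. A crossing periodic orbit of $Z_b$ is a periodic orbit that meets $\Sigma$, and does so only at points where the second components of $Z^{+}(x-b,y)$ and $Z^{-}(x,y)$ are nonzero and have the same sign; a crossing limit cycle is an isolated crossing periodic orbit. Then there are $b_0>0$ and an open neighbourhood $U$ of the origin such that for every $b$ with $0<\mu b<b_0$ the field $Z_b$ has exactly one crossing periodic orbit contained in $U$. It is a crossing limit cycle and meets $\{(x,0):x>0\}$ in exactly one point $(x(b),0)$. Let $\mathcal T(b)$ denote its minimal period. There are $x_0>0$, $T_0>0$ and an integer $n\ge 1$ such that $$x(b)\sim x_0\,|b|^{\frac1{2n}},\qquad \mathcal T(b)\sim T_0\,|b|^{\frac1{2n}}\qquad\text{as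 } b\to 0,\ \mu b>0,$$ where $f\sim g$ means $f(b)/g(b)\to 1$. -/

import Mathlib

open Set Filter Topology Asymptotics

noncomputable section

namespace PseudoHopf

/-- The closed half-plane `{(x, y) : 0 ≤ s * y}`. For `s = 1` this is the closed upper
half-plane `Σ⁺`, for `s = -1` the closed lower half-plane `Σ⁻`. -/
def halfPlane (s : ℝ) : Set (ℝ × ℝ) := {p | 0 ≤ s * p.2}

/-- The origin is an invisible contact of even multiplicity `2 * k` (`k ≥ 1`) between the vector
field `Z = (P, Q)`, considered on `halfPlane s`, and the line `y = 0`: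
`Q (x, 0) = β * x ^ (2 * k - 1) + O (x ^ (2 * k))` with `s * P (0, 0) * β < 0`. -/
structure IsInvisibleFold (s : ℝ) (Z : ℝ × ℝ → ℝ × ℝ) (k : ℕ) : Prop where
  one_le : 1 ≤ k
  vanish : ∀ i < 2 * k - 1, iteratedDeriv i (fun x : ℝ => (Z (x, 0)).2) 0 = 0
  invisible : s * ((Z (0, 0)).1 * iteratedDeriv (2 * k - 1) (fun x : ℝ => (Z (x, 0)).2) 0) < 0

/-- The solution of `Z` that starts at `(x, 0)` at time `0` is defined up to the (positive or
negative) time `τ`, where it arrives at `(y, 0)`, and at all times strictly between `0` and `τ` it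
lies in the open half-plane `{s * y > 0}`. -/
def IsHalfReturn (s : ℝ) (Z : ℝ × ℝ → ℝ × ℝ) (x τ y : ℝ) : Prop :=
  ∃ ψ : ℝ → ℝ × ℝ,
    (∀ t ∈ uIcc 0 τ, HasDerivWithinAt ψ (Z (ψ t)) (uIcc 0 τ) t) ∧
    ψ 0 = (x, 0) ∧ ψ τ = (y, 0) ∧
    ∀ t ∈ Ioo (min 0 τ) (max 0 τ), 0 < s * (ψ t).2

/-- Half-monodromy on both sides: flight times `τp`, `τm` and half-return maps `φp`, `φm` of
`Zp` (in `y ≥ 0`) and `Zm` (in `y ≤ 0`), defined for `0 < x < x₀`, with the half-return maps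
extended continuously to `x = 0` by the value `0`. -/
structure HasHalfReturns (Zp Zm : ℝ × ℝ → ℝ × ℝ) (x₀ : ℝ) (τp τm φp φm : ℝ → ℝ) : Prop where
  x₀_pos : 0 < x₀
  continuousOn_τp : ContinuousOn τp (Ioo 0 x₀)
  continuousOn_τm : ContinuousOn τm (Ioo 0 x₀)
  halfReturn_p : ∀ x ∈ Ioo 0 x₀, IsHalfReturn 1 Zp x (τp x) (φp x)
  halfReturn_m : ∀ x ∈ Ioo 0 x₀, IsHalfReturn (-1) Zm x (τm x) (φm x)
  τ_opposite : ∀ x ∈ Ioo 0 x₀, τp x * τm x < 0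
  φp_neg : ∀ x ∈ Ioo 0 x₀, φp x < 0
  φm_neg : ∀ x ∈ Ioo 0 x₀, φm x < 0
  φ_ne : ∀ x ∈ Ioo 0 x₀, φp x ≠ φm x
  φp_zero : φp 0 = 0
  φm_zero : φm 0 = 0
  continuousOn_φp : ContinuousOn φp (Ico 0 x₀)
  continuousOn_φm : ContinuousOn φm (Ico 0 x₀)

/-- Orientation `δ`: `1` if `τp x < 0 < τm x`, and `-1` if `τm x < 0 < τp x`, for `0 < x < x₀`.
It does not depend on `x` (see `delta_eq`), so the midpoint is used. -/
def delta (x₀ : ℝ) (τp : ℝ → ℝ) : ℝ := if τp (x₀ / 2) < 0 then 1 else -1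

/-- The displacement function `Δ₀ x = δ * (φ⁺ x - φ⁻ x)`. -/
def displacement (x₀ : ℝ) (τp φp φm : ℝ → ℝ) (x : ℝ) : ℝ :=
  delta x₀ τp * (φp x - φm x)

/-- The sign `σ` of the displacement function on `(0, x₀)`. It does not depend on the point
(see `sigma_eq`), so the midpoint is used. -/
def sigma (x₀ : ℝ) (τp φp φm : ℝ → ℝ) : ℝ :=
  Real.sign (displacement x₀ τp φp φm (x₀ / 2))

/-- The sign `μ = -σ * δ` of the parameters for which the bifurcation takes place. -/
def mu (x₀ : ℝ) (τp φp φm : ℝ → ℝ) : ℝ := -sigma x₀ τp φp φm * delta x₀ τp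

/-- The vector field translated by `b` along the `x`-axis. -/
def translate (b : ℝ) (Z : ℝ × ℝ → ℝ × ℝ) : ℝ × ℝ → ℝ × ℝ := fun p => Z (p.1 - b, p.2)

/-- `γ` is a global crossing solution of the piecewise vector field given by `Zp` for `y > 0` and
by `Zm` for `y < 0`: off `y = 0` it solves the respective equation, and it meets `y = 0` only at
crossing points (where the second components of `Zp` and `Zm` have the same strict sign), where it
passes from an orbit of one field to an orbit of the other one. -/
structure IsCrossingSolution (Zp Zm : ℝ × ℝ → ℝ × ℝ) (γ : ℝ → ℝ × ℝ) : Prop where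
  upper : ∀ t, 0 < (γ t).2 → HasDerivAt γ (Zp (γ t)) t
  lower : ∀ t, (γ t).2 < 0 → HasDerivAt γ (Zm (γ t)) t
  cross : ∀ t, (γ t).2 = 0 →
    (0 < (Zp (γ t)).2 ∧ 0 < (Zm (γ t)).2 ∧
      HasDerivWithinAt γ (Zm (γ t)) (Iic t) t ∧ HasDerivWithinAt γ (Zp (γ t)) (Ici t) t) ∨
    ((Zp (γ t)).2 < 0 ∧ (Zm (γ t)).2 < 0 ∧
      HasDerivWithinAt γ (Zp (γ t)) (Iic t) t ∧ HasDerivWithinAt γ (Zm (γ t)) (Ici t) t)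

/-- `C` is a crossing periodic orbit, of (minimal) period `T`: the trace of a periodic crossing
solution that meets the line `y = 0`. -/
def IsCrossingPeriodicOrbit (Zp Zm : ℝ × ℝ → ℝ × ℝ) (C : Set (ℝ × ℝ)) (T : ℝ) : Prop :=
  ∃ γ : ℝ → ℝ × ℝ, IsCrossingSolution Zp Zm γ ∧ range γ = C ∧ (∃ t, (γ t).2 = 0) ∧
    0 < T ∧ Function.Periodic γ T ∧ ∀ S, 0 < S → Function.Periodic γ S → T ≤ S

/-- A crossing limit cycle of period `T`: an isolated crossing periodic orbit. -/
def IsCrossingLimitCycle (Zp Zm : ℝ × ℝ → ℝ × ℝ) (C : Set (ℝ × ℝ)) (T : ℝ) : Prop :=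
  IsCrossingPeriodicOrbit Zp Zm C T ∧
    ∃ V : Set (ℝ × ℝ), IsOpen V ∧ C ⊆ V ∧
      ∀ C' T', IsCrossingPeriodicOrbit Zp Zm C' T' → C' ⊆ V → C' = C

/-- A nowhere vanishing continuous function on an open interval has constant sign. -/
theorem sign_const {f : ℝ → ℝ} {a b : ℝ} (hf : ContinuousOn f (Ioo a b))
    (h0 : ∀ x ∈ Ioo a b, f x ≠ 0) {x y : ℝ} (hx : x ∈ Ioo a b) (hy : y ∈ Ioo a b)
    (h : f x < 0) : f y < 0 := by
  by_contra hn
  obtain ⟨z, hz, hz0⟩ := isPreconnected_Ioo.intermediate_value hx hy hf ⟨h.le, not_lt.mp hn⟩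
  exact h0 z hz hz0

theorem delta_eq {Zp Zm : ℝ × ℝ → ℝ × ℝ} {x₀ : ℝ} {τp τm φp φm : ℝ → ℝ}
    (h : HasHalfReturns Zp Zm x₀ τp τm φp φm) {x : ℝ} (hx : x ∈ Ioo 0 x₀) :
    delta x₀ τp = if τp x < 0 then 1 else -1 := by
  have h0 : ∀ z ∈ Ioo 0 x₀, τp z ≠ 0 := by
    intro z hz hz0
    have := h.τ_opposite z hz
    simp [hz0] at this
  have hm : x₀ / 2 ∈ Ioo 0 x₀ := ⟨by linarith [h.x₀_pos], by linarith [h.x₀_pos]⟩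
  have hiff : τp (x₀ / 2) < 0 ↔ τp x < 0 :=
    ⟨sign_const h.continuousOn_τp h0 hm hx, sign_const h.continuousOn_τp h0 hx hm⟩
  simp [delta, hiff]

theorem sigma_eq {Zp Zm : ℝ × ℝ → ℝ × ℝ} {x₀ : ℝ} {τp τm φp φm : ℝ → ℝ}
    (h : HasHalfReturns Zp Zm x₀ τp τm φp φm) {x : ℝ} (hx : x ∈ Ioo 0 x₀) :
    sigma x₀ τp φp φm = Real.sign (displacement x₀ τp φp φm x) := by
  have hd : delta x₀ τp ≠ 0 := by unfold delta; split_ifs <;> norm_num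
  have h0 : ∀ z ∈ Ioo 0 x₀, displacement x₀ τp φp φm z ≠ 0 := fun z hz =>
    mul_ne_zero hd (sub_ne_zero.mpr (h.φ_ne z hz))
  have hc : ContinuousOn (displacement x₀ τp φp φm) (Ioo 0 x₀) :=
    continuousOn_const.mul ((h.continuousOn_φp.mono Ioo_subset_Ico_self).sub
      (h.continuousOn_φm.mono Ioo_subset_Ico_self))
  have hm : x₀ / 2 ∈ Ioo 0 x₀ := ⟨by linarith [h.x₀_pos], by linarith [h.x₀_pos]⟩
  unfold sigma
  rcases lt_or_gt_of_ne (h0 _ hx) with hlt | hgt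
  · rw [Real.sign_of_neg hlt, Real.sign_of_neg (sign_const hc h0 hx hm hlt)]
  · have : 0 < displacement x₀ τp φp φm (x₀ / 2) := by
      rcases lt_or_gt_of_ne (h0 _ hm) with h1 | h1
      · exact absurd (sign_const hc h0 hm hx h1) (not_lt.mpr hgt.le)
      · exact h1
    rw [Real.sign_of_pos hgt, Real.sign_of_pos this]

end PseudoHopf

end

/-! Near an invisible fold the orbits on one side of the line are arcs of level curves of an
analytic first integral. Its restriction `h` to the line has a strict minimum at the fold, so `h = w
^ (2 * j)` for an analytic coordinate `w`, and the half-return map is the involution `ρ` that is `w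
↦ -w` in this coordinate. Hence `ρ` is analytic with `ρ' (0) = -1`, and the flight time vanishes at
the fold with positive derivative (`local_half_return`). Reflection in the line combined with time
reversal turns the lower side into an upper one, so both sides give germs `ρ₁`, `ρ₂` of this kind.
After reversing the time of both fields if necessary, `P⁺ (0, 0) > 0`; the opposite signs of the
flight times then force `P⁻ (0, 0) < 0`.

Translating the upper field by `b` conjugates `ρ₁` by the translation, so a cycle of one turn
through `(x, 0)` is a solution of `ρ₁ (x - b) + b = ρ₂ x`. The derivative of this equation in `b` at
the origin is `1 - ρ₁' (0) = 2`, so it is solved for the parameter, not for the point: `b = B x`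
with `B` analytic and `B ~ -(ρ₁ - ρ₂) / 2` (`exists_parameter`). The difference of two distinct
involutions of this kind has even order `2 * n` (`even_order_aux`). Thus `B x = x ^ (2 * n) * m x`
with `m 0 ≠ 0`; for `x > 0` this is strictly monotone, takes values of one sign, which is `μ`, and
its inverse is `X b ~ |b / m 0| ^ (1 / (2 * n))` (`exists_bifurcation`). As `b = o (X b)`, the
period is asymptotic to a multiple of `X b` (`isEquivalent_time`).

A periodic orbit might turn several times before closing. The set of its positive intersections with
the line is compact, and the two decreasing half-return maps have the same image on it. Its greatest
and its least point therefore both solve the equation above, so they coincide (`eq_of_antitoneOn`,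
`range_eq_orbitSet`). -/

open scoped ContDiff

namespace PseudoHopf

/-! ### Analyticity of composition operators on spaces of continuous functions -/

section Nemytskii

variable {X E F : Type*} [TopologicalSpace X] [CompactSpace X]
  [NormedAddCommGroup E] [NormedSpace ℝ E] [NormedAddCommGroup F] [NormedSpace ℝ F]

/-- The pointwise action of a continuous multilinear map on continuous functions. -/
noncomputable def pointwiseMultilinear {n : ℕ}
    (f : ContinuousMultilinearMap ℝ (fun _ : Fin n => E) F) :
    ContinuousMultilinearMap ℝ (fun _ : Fin n => C(X, E)) C(X, F) :=
  MultilinearMap.mkContinuous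
    { toFun := fun u => ⟨fun s => f fun i => u i s, by fun_prop⟩
      map_update_add' := by
        intro _ m i x y
        ext s
        have key : ∀ z : C(X, E), (fun j => Function.update m i z j s) =
            Function.update (fun j => m j s) i (z s) := by
          intro z; ext j; by_cases h : j = i
          · subst h; simp
          · simp [h]
        change f _ = f _ + f _
        rw [key, key, key]
        exact f.map_update_add _ _ _ _
      map_update_smul' := by
        intro _ m i c x
        ext s
        have key : ∀ z : C(X, E), (fun j => Function.update m i z j s) =
            Function.update (fun j => m j s) i (z s) := by
          intro z; ext j; by_cases h : j = i
          · subst h; simp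
          · simp [h]
        change f _ = c • f _
        rw [key, key]
        exact f.map_update_smul _ _ _ _ }
    ‖f‖ (by
      intro m
      refine (ContinuousMap.norm_le _ (by positivity)).2 fun s => ?_
      refine (f.le_opNorm _).trans ?_
      gcongr with i
      exact (m i).norm_coe_le_norm s)

theorem norm_pointwiseMultilinear_le {n : ℕ}
    (f : ContinuousMultilinearMap ℝ (fun _ : Fin n => E) F) :
    ‖(pointwiseMultilinear f : ContinuousMultilinearMap ℝ (fun _ : Fin n => C(X, E)) C(X, F))‖
      ≤ ‖f‖ :=
  MultilinearMap.mkContinuous_norm_le _ (norm_nonneg _) _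

/-- Composition with an analytic map is an analytic operation on continuous functions. -/
theorem exists_analyticAt_comp [CompleteSpace F] {f : E → F} (hf : AnalyticAt ℝ f 0) :
    ∃ N : C(X, E) → C(X, F), AnalyticAt ℝ N 0 ∧ ∀ᶠ u in 𝓝 0, ∀ s, N u s = f (u s) := by
  obtain ⟨p, r, hp⟩ := hf
  -- The power series of `f` acts term by term on continuous functions. The norms of the
  -- coefficients do not grow, so neither does the radius shrink, and evaluation at `s` gives back
  -- the series of `f` at `u s`.
  let q : FormalMultilinearSeries ℝ C(X, E) C(X, F) := fun n => pointwiseMultilinear (p n)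
  have hq : p.radius ≤ q.radius := by
    refine FormalMultilinearSeries.radius_le_of_le (fun {n} => ?_)
    exact norm_pointwiseMultilinear_le (p n)
  have hq0 : 0 < q.radius := lt_of_lt_of_le hp.r_pos (hp.r_le.trans hq)
  have hs := q.hasFPowerSeriesOnBall hq0
  refine ⟨q.sum, ⟨q, hs.hasFPowerSeriesAt⟩, ?_⟩
  filter_upwards [Metric.eball_mem_nhds (0 : C(X, E)) hp.r_pos] with u hu s
  have h1 := hs.hasSum (y := u) (Metric.eball_subset_eball (hp.r_le.trans hq) hu)
  have h2 : HasSum (fun n => q n (fun _ => u) s) (q.sum u s) := by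
    have := h1.map (ContinuousMap.evalCLM ℝ s : C(X, F) →L[ℝ] F)
      (ContinuousMap.evalCLM ℝ s : C(X, F) →L[ℝ] F).continuous
    simpa [Function.comp_def] using this
  have h3 := hp.hasSum (y := u s) (by
    simp only [Metric.mem_eball, edist_zero_right] at hu ⊢
    refine lt_of_le_of_lt ?_ hu
    have := u.norm_coe_le_norm s
    rwa [← ofReal_norm, ← ofReal_norm, ENNReal.ofReal_le_ofReal_iff (norm_nonneg _)])
  rw [zero_add] at h3
  exact h2.unique h3

end Nemytskii

/-! ### Analytic local flows -/

section Flow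

variable {E : Type*} [NormedAddCommGroup E] [NormedSpace ℝ E] [CompleteSpace E]

/-- The extension of a continuous function on the unit interval to the real line. -/
noncomputable def extendUnit (u : C(unitInterval, E)) (s : ℝ) : E :=
  u (projIcc 0 1 zero_le_one s)

omit [NormedSpace ℝ E] [CompleteSpace E] in
theorem continuous_extendUnit (u : C(unitInterval, E)) : Continuous (extendUnit u) :=
  u.continuous.comp continuous_projIcc

/-- Integration from the left end point, as an operator on continuous functions. -/
noncomputable def primitive : C(unitInterval, E) →L[ℝ] C(unitInterval, E) :=
  LinearMap.mkContinuous
    { toFun := fun u => ⟨fun s => ∫ r in (0 : ℝ)..s, extendUnit u r,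
        (intervalIntegral.continuous_primitive
          (fun a b => (continuous_extendUnit u).intervalIntegrable a b) 0).comp
          continuous_subtype_val⟩
      map_add' := by
        intro u v
        ext s
        exact intervalIntegral.integral_add ((continuous_extendUnit u).intervalIntegrable _ _)
          ((continuous_extendUnit v).intervalIntegrable _ _)
      map_smul' := by
        intro c u
        ext s
        exact intervalIntegral.integral_smul c _ } 1 (by
    intro u
    refine (ContinuousMap.norm_le _ (by positivity)).2 fun s => ?_
    have := intervalIntegral.norm_integral_le_of_norm_le_const (a := 0) (b := (s : ℝ))
      (f := extendUnit u) (C := ‖u‖) (fun x _ => u.norm_coe_le_norm _)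
    refine this.trans ?_
    rw [sub_zero, abs_of_nonneg s.2.1, one_mul]
    exact mul_le_of_le_one_right (norm_nonneg _) s.2.2)

omit [CompleteSpace E] in
theorem primitive_apply (u : C(unitInterval, E)) (s : unitInterval) :
    primitive u s = ∫ r in (0 : ℝ)..s, extendUnit u r := rfl

/-- An analytic vector field has an analytic local flow. -/
theorem exists_analytic_flow {Z : E → E} (hZ : AnalyticAt ℝ Z 0) :
    ∃ Φ : ℝ × E → E, AnalyticAt ℝ Φ 0 ∧ (∀ᶠ c in 𝓝 (0 : E), Φ (0, c) = c) ∧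
      ∀ᶠ p in 𝓝 (0 : ℝ × E), HasDerivAt (fun t => Φ (t, p.2)) (Z (Φ p)) p.1 := by
  obtain ⟨N, hN, hNZ⟩ := exists_analyticAt_comp (X := unitInterval) hZ
  let K : E →L[ℝ] C(unitInterval, E) := ContinuousLinearMap.const ℝ unitInterval
  -- Time is rescaled to the unit interval: a small zero `u` of `f` over `(t, c)` satisfies `u s = c
  -- + t ∫₀ˢ Z (u r) dr`. For `(t, c) = 0` the map is the identity in `u`, so the implicit function
  -- theorem applies at the origin and gives analyticity in `(t, c)` at once.
  let f : (ℝ × E) × C(unitInterval, E) → C(unitInterval, E) := fun q =>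
    q.2 - K q.1.2 - q.1.1 • primitive (N q.2)
  have hN2 : AnalyticAt ℝ (fun q : (ℝ × E) × C(unitInterval, E) => N q.2) 0 :=
    AnalyticAt.fun_comp (g := N) hN analyticAt_snd
  have hp1 : AnalyticAt ℝ (fun q : (ℝ × E) × C(unitInterval, E) => primitive (N q.2)) 0 :=

    AnalyticAt.fun_comp (g := (primitive : C(unitInterval, E) →L[ℝ] C(unitInterval, E)))
      (ContinuousLinearMap.analyticAt _ _) hN2
  have hf : AnalyticAt ℝ f 0 := by
    have h1 : AnalyticAt ℝ (fun q : (ℝ × E) × C(unitInterval, E) => q.1.1) 0 :=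
      ((ContinuousLinearMap.fst ℝ ℝ E).comp
        (ContinuousLinearMap.fst ℝ (ℝ × E) C(unitInterval, E))).analyticAt 0
    have h2 : AnalyticAt ℝ (fun q : (ℝ × E) × C(unitInterval, E) => K q.1.2) 0 :=
      (K.comp ((ContinuousLinearMap.snd ℝ ℝ E).comp
        (ContinuousLinearMap.fst ℝ (ℝ × E) C(unitInterval, E)))).analyticAt 0
    exact (analyticAt_snd.sub h2).sub (h1.smul hp1)
  have hf0 : f 0 = 0 := by simp [f]
  have hfr : (fderiv ℝ f 0 ∘L .inr ℝ (ℝ × E) C(unitInterval, E)) =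
      ContinuousLinearMap.id ℝ _ := by
    have h1 : HasFDerivAt (fun u : C(unitInterval, E) => f (0, u))
        (fderiv ℝ f 0 ∘L .inr ℝ (ℝ × E) C(unitInterval, E)) 0 :=
      HasFDerivAt.comp (f := fun u : C(unitInterval, E) => ((0 : ℝ × E), u)) (g := f)
        (g' := fderiv ℝ f 0) 0 hf.differentiableAt.hasFDerivAt (hasFDerivAt_prodMk_right _ _)
    have h2 : (fun u : C(unitInterval, E) => f (0, u)) = id := by
      ext1 u; simp [f]
    rw [h2] at h1
    exact h1.unique (hasFDerivAt_id _)
  have hcd : ContDiffAt ℝ ω f 0 := hf.contDiffAt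
  have hinv : (fderiv ℝ f 0 ∘L .inr ℝ (ℝ × E) C(unitInterval, E)).IsInvertible := by
    rw [hfr]; exact ⟨ContinuousLinearEquiv.refl ℝ _, rfl⟩
  have hω : (ω : WithTop ℕ∞) ≠ 0 := by simp
  let ψ := hcd.implicitFunction hω hinv
  have hψa : AnalyticAt ℝ ψ 0 := (hcd.contDiffAt_implicitFunction hω hinv).analyticAt
  have hψ0 : ψ 0 = 0 := hcd.implicitFunction_apply_self hω hinv
  have hψf : ∀ᶠ p in 𝓝 (0 : ℝ × E), f (p, ψ p) = 0 := by
    have := hcd.eventually_apply_implicitFunction hω hinv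
    rwa [hf0] at this
  have hψu : ∀ᶠ q in 𝓝 (0 : (ℝ × E) × C(unitInterval, E)), f q = 0 → ψ q.1 = q.2 := by
    have := hcd.eventually_apply_eq_iff_implicitFunction hω hinv
    rw [hf0] at this
    exact this.mono fun q hq => hq.1
  obtain ⟨δ, hδ, hu⟩ := Metric.eventually_nhds_iff_ball.1 (hψu.and
    ((continuous_snd.tendsto (0 : (ℝ × E) × C(unitInterval, E))).eventually (hNZ.and hN.eventually_analyticAt)))
  have hψd : ∀ᶠ p in 𝓝 (0 : ℝ × E), ‖ψ p‖ < δ := by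
    have := hψa.continuousAt.norm.tendsto
    rw [hψ0, norm_zero] at this
    exact this.eventually_lt_const hδ
  have hgA : ∀ᶠ p in 𝓝 (0 : ℝ × E), AnalyticAt ℝ ψ p := hψa.eventually_analyticAt
  obtain ⟨ε, hε, hall⟩ := Metric.eventually_nhds_iff_ball.1 (hψf.and (hψd.and hgA))
  have mem : ∀ {t : ℝ} {c : E}, (t, c) ∈ Metric.ball (0 : ℝ × E) ε ↔ |t| < ε ∧ ‖c‖ < ε := by
    intro t c; simp [Prod.norm_def]
  set η := min ε δ with hη
  have hη0 : 0 < η := lt_min hε hδ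
  have key : ∀ t c, |t| < η → ‖c‖ < η → ∀ s ∈ Icc (0 : ℝ) 1,
      extendUnit (ψ (t, c)) s = c + t • ∫ r in (0 : ℝ)..s, extendUnit (N (ψ (t, c))) r := by
    intro t c ht hc s hs
    have h := (hall (t, c) (mem.2 ⟨ht.trans_le (min_le_left _ _), hc.trans_le (min_le_left _ _)⟩)).1
    have h' := DFunLike.congr_fun h (⟨s, hs⟩ : unitInterval)
    simp only [f, ContinuousMap.sub_apply, ContinuousMap.smul_apply, primitive_apply,
      ContinuousMap.zero_apply] at h'
    rw [extendUnit, projIcc_of_mem _ hs, eq_comm, ← sub_eq_zero, ← neg_eq_zero]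
    rw [← h']
    simp [K]
    abel
  have hψn : ∀ {t c}, |t| < η → ‖c‖ < η → ‖ψ (t, c)‖ < δ := fun {t c} ht hc =>
    (hall (t, c) (mem.2 ⟨ht.trans_le (min_le_left _ _), hc.trans_le (min_le_left _ _)⟩)).2.1
  have hNe : ∀ u : C(unitInterval, E), ‖u‖ < δ → ∀ s, N u s = Z (u s) := fun u hu' =>
    (hu (0, u) (by
      rw [mem_ball_zero_iff]; exact max_lt (by simpa using hδ) hu')).2.1
  -- The curve `s ↦ u (σ * s)` solves the equation for time `σ * t`; local uniqueness of the
  -- implicit function identifies it with `ψ (σ * t, c)`.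
  have scale : ∀ t c, |t| < η → ‖c‖ < η → ∀ σ ∈ Icc (0 : ℝ) 1,
      ψ (σ * t, c) 1 = extendUnit (ψ (t, c)) σ := by
    intro t c ht hc σ hσ
    set u := ψ (t, c) with hudef
    have hmul : ∀ s : unitInterval, σ * (s : ℝ) ∈ Icc (0 : ℝ) 1 := fun s =>
      ⟨mul_nonneg hσ.1 s.2.1, mul_le_one₀ hσ.2 s.2.1 s.2.2⟩
    let v : C(unitInterval, E) := ⟨fun s => u ⟨σ * s, hmul s⟩, by fun_prop⟩
    have hvn : ‖v‖ < δ := by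
      refine lt_of_le_of_lt ((ContinuousMap.norm_le _ (norm_nonneg u)).2 fun s => ?_) (hψn ht hc)
      exact u.norm_coe_le_norm _
    have hσt : |σ * t| < η := by
      rw [abs_mul, abs_of_nonneg hσ.1]
      exact lt_of_le_of_lt (mul_le_of_le_one_left (abs_nonneg _) hσ.2) ht
    have hball : ((σ * t, c), v) ∈ Metric.ball (0 : (ℝ × E) × C(unitInterval, E)) δ := by
      simp only [Metric.mem_ball, dist_zero_right, Prod.norm_def, Real.norm_eq_abs]
      exact max_lt (max_lt (hσt.trans_le (min_le_right _ _)) (hc.trans_le (min_le_right _ _))) hvn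
    have hNv : ∀ r ∈ Icc (0 : ℝ) 1, extendUnit (N v) r = extendUnit (N u) (σ * r) := by
      intro r hr
      have hr' : σ * r ∈ Icc (0 : ℝ) 1 := hmul ⟨r, hr⟩
      simp only [extendUnit, projIcc_of_mem _ hr, projIcc_of_mem _ hr', hNe v hvn,
        hNe u (hψn ht hc)]
      rfl
    have hfv : f ((σ * t, c), v) = 0 := by
      ext s
      have h1 := key t c ht hc (σ * s) (hmul s)
      have h2 : ∫ r in (0 : ℝ)..s, extendUnit (N v) r =
          ∫ r in (0 : ℝ)..s, extendUnit (N u) (σ * r) := by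
        refine intervalIntegral.integral_congr fun r hr => hNv r ?_
        rw [uIcc_of_le s.2.1] at hr
        exact ⟨hr.1, hr.2.trans s.2.2⟩
      have h3 : σ • ∫ r in (0 : ℝ)..s, extendUnit (N u) (σ * r) =
          ∫ r in (0 : ℝ)..(σ * s), extendUnit (N u) r := by
        rw [intervalIntegral.smul_integral_comp_mul_left, mul_zero]
      have h4 : v s = extendUnit u (σ * s) := by
        simp only [extendUnit, projIcc_of_mem _ (hmul s)]; rfl
      simp only [f, ContinuousMap.sub_apply, ContinuousMap.smul_apply, primitive_apply,
        ContinuousMap.zero_apply]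
      rw [h4, h2, mul_comm σ t, mul_smul, h3, h1]
      simp [K, hudef]
    have := (hu _ hball).1 hfv
    have h5 := DFunLike.congr_fun this (1 : unitInterval)
    rw [h5]
    have h6 : v 1 = extendUnit u σ := by
      simp only [extendUnit, projIcc_of_mem _ hσ]
      change u _ = u _
      congr 2
      simp
    exact h6
  have hΦ0 : ∀ c, ‖c‖ < η → ψ (0, c) = K c := by
    intro c hc
    have h := (hall (0, c) (mem.2 ⟨by simpa using hε, hc.trans_le (min_le_left _ _)⟩)).1
    simpa [f, sub_eq_zero] using h
  let ev : C(unitInterval, E) →L[ℝ] E := ContinuousMap.evalCLM ℝ 1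
  refine ⟨fun p => ψ p 1, AnalyticAt.fun_comp (g := ev) (ev.analyticAt _) hψa, ?_, ?_⟩
  · filter_upwards [Metric.ball_mem_nhds (0 : E) hη0] with c hc
    rw [mem_ball_zero_iff] at hc
    rw [hΦ0 c hc]; rfl
  · filter_upwards [Metric.ball_mem_nhds (0 : ℝ × E) (half_pos hη0)] with p hp
    obtain ⟨t, c⟩ := p
    have hp' : |t| < η / 2 ∧ ‖c‖ < η / 2 := by simpa [Prod.norm_def] using hp
    obtain ⟨ht, hc⟩ := hp'
    have hc' : ‖c‖ < η := by linarith
    rcases eq_or_ne t 0 with rfl | ht0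
    · have h1 : (fun t => ψ (t, c) 1) =ᶠ[𝓝 0]
          fun t => c + t • primitive (N (ψ (t, c))) 1 := by
        filter_upwards [Metric.ball_mem_nhds (0 : ℝ) hη0] with t ht
        rw [mem_ball_zero_iff, Real.norm_eq_abs] at ht
        have := key t c ht hc' 1 (by simp)
        rw [← Icc.coe_one, ← primitive_apply] at this
        rw [← this]
        simp [extendUnit]
      have hN0 : AnalyticAt ℝ N (ψ (0, c)) := by
        refine (hu (0, ψ (0, c)) ?_).2.2
        rw [mem_ball_zero_iff]
        exact max_lt (by simpa using hδ) (hψn (by simpa using hη0) hc')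
      have hψc : DifferentiableAt ℝ (fun t : ℝ => ψ (t, c)) 0 := by
        have h2 := (hall (0, c) (mem.2 ⟨by simpa using hε, hc'.trans_le (min_le_left _ _)⟩)).2.2
        exact DifferentiableAt.comp (f := fun t : ℝ => (t, c)) (g := ψ) 0
          h2.differentiableAt (by fun_prop)
      let L : C(unitInterval, E) →L[ℝ] E := ev ∘L primitive
      have hg : DifferentiableAt ℝ (fun t : ℝ => L (N (ψ (t, c)))) 0 :=
        L.differentiableAt.comp 0
          (DifferentiableAt.comp (f := fun t : ℝ => ψ (t, c)) (g := N) 0 hN0.differentiableAt hψc)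
      have h2 := ((hasDerivAt_id (0 : ℝ)).smul hg.hasDerivAt).const_add c
      refine HasDerivAt.congr_of_eventuallyEq ?_ h1
      have h3 : ∀ s ∈ uIcc (0 : ℝ) 1, extendUnit (N (ψ (0, c))) s = Z c := by
        intro s _
        rw [extendUnit, hNe _ (hψn (by simpa using hη0) hc'), hΦ0 c hc']; rfl
      have h4 : L (N (ψ (0, c))) = Z c := by
        change primitive (N (ψ (0, c))) 1 = Z c
        rw [primitive_apply, Icc.coe_one, intervalIntegral.integral_congr h3]
        simp
      have h5 : Z (ψ ((0 : ℝ), c) 1) =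
          id (0 : ℝ) • deriv (fun t : ℝ => L (N (ψ (t, c)))) 0 + (1 : ℝ) • Z c := by
        simp [hΦ0 c hc', K]
      rw [h4, ← h5] at h2
      exact h2
    -- For times near `t` all end points lie on the single curve for time `2 * t`, and `t / (2 * t)
    -- = 1 / 2` is interior to the unit interval, so the fundamental theorem of calculus gives a
    -- two-sided derivative. The division by `2 * t` is the reason for treating `t = 0` apart.
    · have h2t : |2 * t| < η := by rw [abs_mul, abs_two]; linarith
      have h1 : (fun t' => ψ (t', c) 1) =ᶠ[𝓝 t] fun t' =>
          c + (2 * t) • ∫ r in (0 : ℝ)..(t' / (2 * t)), extendUnit (N (ψ (2 * t, c))) r := by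
        have h2 : Tendsto (fun t' => t' / (2 * t)) (𝓝 t) (𝓝 (1 / 2)) := by
          have : ContinuousAt (fun t' => t' / (2 * t)) t := by fun_prop
          convert this.tendsto using 2
          field_simp
        filter_upwards [h2.eventually (Icc_mem_nhds (a := (0 : ℝ)) (b := 1)
          (by norm_num) (by norm_num))] with t' ht'
        rw [← key _ c h2t hc' _ ht', ← scale _ c h2t hc' _ ht']
        congr 3
        field_simp
      refine HasDerivAt.congr_of_eventuallyEq ?_ h1
      have h3 : HasDerivAt (fun s => ∫ r in (0 : ℝ)..s, extendUnit (N (ψ (2 * t, c))) r)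
          (extendUnit (N (ψ (2 * t, c))) (t / (2 * t))) (t / (2 * t)) :=
        (continuous_extendUnit _).integral_hasStrictDerivAt _ _ |>.hasDerivAt
      have h4 : HasDerivAt (fun t' : ℝ => t' / (2 * t)) (1 / (2 * t)) t :=
        (hasDerivAt_id t).div_const _
      have h5 := ((h3.scomp t h4).const_smul (2 * t)).const_add c
      have hmem : t / (2 * t) ∈ Icc (0 : ℝ) 1 := by
        rw [show t / (2 * t) = 1 / 2 by field_simp]; constructor <;> norm_num
      have h6 : extendUnit (N (ψ (2 * t, c))) (t / (2 * t)) = Z (ψ (t, c) 1) := by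
        have := scale _ c h2t hc' _ hmem
        rw [show t / (2 * t) * (2 * t) = t by field_simp] at this
        rw [this]
        simp only [extendUnit, hNe _ (hψn h2t hc')]
      rw [h6, smul_smul, show 2 * t * (1 / (2 * t)) = 1 by field_simp, one_smul] at h5
      exact h5

end Flow

/-! ### Flow box -/

/-- Straightening coordinates for an analytic planar vector field that is transverse to the
vertical axis at the origin. -/
theorem exists_flowBox {Z : ℝ × ℝ → ℝ × ℝ} (hZ : AnalyticAt ℝ Z 0) (hP : (Z 0).1 ≠ 0) :
    ∃ W G : ℝ × ℝ → ℝ × ℝ, AnalyticAt ℝ W 0 ∧ AnalyticAt ℝ G 0 ∧ W 0 = 0 ∧ G 0 = 0 ∧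
      (∀ᶠ p in 𝓝 0, W (G p) = p) ∧ (∀ᶠ q in 𝓝 0, G (W q) = q) ∧
      (∀ᶠ q in 𝓝 (0 : ℝ × ℝ), HasDerivAt (fun t => W (t, q.2)) (Z (W q)) q.1) ∧
      (∀ᶠ p in 𝓝 0, fderiv ℝ G p (Z p) = (1, 0)) ∧ ∀ᶠ c in 𝓝 (0 : ℝ), G (0, c) = (0, c) := by
  obtain ⟨Φ, hΦ, hΦ0, hΦd⟩ := exists_analytic_flow hZ
  let j : ℝ × ℝ →L[ℝ] ℝ × (ℝ × ℝ) :=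
    (ContinuousLinearMap.fst ℝ ℝ ℝ).prod ((0 : ℝ × ℝ →L[ℝ] ℝ).prod (ContinuousLinearMap.snd ℝ ℝ ℝ))
  have hj : ∀ t c, j (t, c) = (t, (0, c)) := fun t c => rfl
  let W : ℝ × ℝ → ℝ × ℝ := fun q => Φ (j q)
  have hWa : AnalyticAt ℝ W 0 :=
    AnalyticAt.fun_comp (g := Φ) (f := j) (by rw [map_zero]; exact hΦ) (j.analyticAt 0)
  have hjt : Tendsto j (𝓝 0) (𝓝 0) := by simpa using j.continuous.tendsto 0
  have hWd : ∀ᶠ q in 𝓝 (0 : ℝ × ℝ), HasDerivAt (fun t => W (t, q.2)) (Z (W q)) q.1 :=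
    (hjt.eventually hΦd).mono fun q hq => hq
  have hW0 : ∀ᶠ c in 𝓝 (0 : ℝ), W (0, c) = (0, c) := by
    have : Tendsto (fun c : ℝ => ((0 : ℝ), c)) (𝓝 0) (𝓝 0) := by
      have : Continuous (fun c : ℝ => ((0 : ℝ), c)) := by fun_prop
      exact this.tendsto 0
    exact (this.eventually hΦ0).mono fun c hc => hc
  have hWz : W 0 = 0 := hW0.self_of_nhds
  have hWf : HasFDerivAt W (fderiv ℝ W 0) 0 := hWa.differentiableAt.hasFDerivAt
  set L := fderiv ℝ W 0 with hL
  have hL1 : L (1, 0) = Z 0 := by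
    have h1 : HasDerivAt (fun t : ℝ => W (t, 0)) (Z (W 0)) 0 := hWd.self_of_nhds
    have h2 : HasDerivAt (fun t : ℝ => (t, (0 : ℝ))) (1, 0) 0 :=
      (hasDerivAt_id (0 : ℝ)).prodMk (hasDerivAt_const 0 (0 : ℝ))
    have h3 := HasFDerivAt.comp_hasDerivAt (f := fun t : ℝ => (t, (0 : ℝ))) 0 hWf h2
    rw [← hWz]
    exact (h1.unique h3).symm
  have hL2 : L (0, 1) = (0, 1) := by
    have h1 : HasDerivAt (fun c : ℝ => W (0, c)) (0, 1) 0 :=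
      ((hasDerivAt_const 0 (0 : ℝ)).prodMk (hasDerivAt_id (0 : ℝ))).congr_of_eventuallyEq hW0
    have h2 : HasDerivAt (fun t : ℝ => ((0 : ℝ), t)) (0, 1) 0 :=
      (hasDerivAt_const 0 (0 : ℝ)).prodMk (hasDerivAt_id (0 : ℝ))
    have h3 := HasFDerivAt.comp_hasDerivAt (f := fun t : ℝ => ((0 : ℝ), t)) 0 hWf h2
    exact (h1.unique h3).symm
  have hLa : ∀ t c, L (t, c) = (t * (Z 0).1, t * (Z 0).2 + c) := by
    intro t c
    have : ((t, c) : ℝ × ℝ) = t • (1, 0) + c • (0, 1) := by simp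
    rw [this, map_add, map_smul, map_smul, hL1, hL2]
    ext <;> simp
  -- The inverse of `L`, whose columns are `Z 0` and `(0, 1)`; transversality `(Z 0).1 ≠ 0` enters
  -- here.
  let M : ℝ × ℝ →L[ℝ] ℝ × ℝ :=
    ((Z 0).1⁻¹ • ContinuousLinearMap.fst ℝ ℝ ℝ).prod
      (ContinuousLinearMap.snd ℝ ℝ ℝ - ((Z 0).1⁻¹ * (Z 0).2) • ContinuousLinearMap.fst ℝ ℝ ℝ)
  have hM : ∀ x y, M (x, y) = ((Z 0).1⁻¹ * x, y - (Z 0).1⁻¹ * (Z 0).2 * x) := fun x y => rfl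
  let e : (ℝ × ℝ) ≃L[ℝ] (ℝ × ℝ) := ContinuousLinearEquiv.equivOfInverse L M
    (by rintro ⟨t, c⟩; rw [hLa, hM]; ext <;> simp <;> field_simp <;> ring)
    (by rintro ⟨x, y⟩; rw [hM, hLa]; ext <;> simp <;> field_simp <;> ring)
  have hWe : HasFDerivAt W (e : (ℝ × ℝ) →L[ℝ] (ℝ × ℝ)) 0 := hWf
  have hcd : ContDiffAt ℝ ω W 0 := hWa.contDiffAt
  have hω : (ω : WithTop ℕ∞) ≠ 0 := by simp
  let G := hcd.localInverse hWe hω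
  have hst : HasStrictFDerivAt W (e : (ℝ × ℝ) →L[ℝ] (ℝ × ℝ)) 0 := hcd.hasStrictFDerivAt' hWe hω
  have hGa : AnalyticAt ℝ G 0 := by
    have := (hcd.to_localInverse hWe hω).analyticAt
    rwa [hWz] at this
  have hG0 : G 0 = 0 := by
    have := hcd.localInverse_apply_image hWe hω
    rwa [hWz] at this
  have hWG : ∀ᶠ p in 𝓝 0, W (G p) = p := by
    have := hst.eventually_right_inverse
    rwa [hWz] at this
  have hGW : ∀ᶠ q in 𝓝 0, G (W q) = q := hst.eventually_left_inverse
  have hGt : Tendsto G (𝓝 0) (𝓝 0) := by simpa [hG0] using hGa.continuousAt.tendsto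
  refine ⟨W, G, hWa, hGa, hWz, hG0, hWG, hGW, hWd, ?_, ?_⟩
  · have hWt : Tendsto W (𝓝 0) (𝓝 0) := by simpa [hWz] using hWa.continuousAt.tendsto
    -- Differentiate `G (W (t, c)) = (t, c)` with respect to `t`.
    have h1 : ∀ᶠ q in 𝓝 (0 : ℝ × ℝ), fderiv ℝ G (W q) (Z (W q)) = (1, 0) := by
      filter_upwards [hWd, hGW.eventually_nhds, hWt.eventually hGa.eventually_analyticAt]
        with q hq1 hq2 hq3
      have h2 := HasFDerivAt.comp_hasDerivAt (f := fun t => W (t, q.2)) q.1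
        hq3.differentiableAt.hasFDerivAt hq1
      have h3 : Tendsto (fun t : ℝ => (t, q.2)) (𝓝 q.1) (𝓝 q) := by
        have : Continuous (fun t : ℝ => (t, q.2)) := by fun_prop
        exact this.tendsto q.1
      have h4 : HasDerivAt (fun t : ℝ => (t, q.2)) (1, 0) q.1 :=
        (hasDerivAt_id q.1).prodMk (hasDerivAt_const q.1 q.2)
      exact (h2.congr_of_eventuallyEq (f₁ := fun t : ℝ => (t, q.2))
        ((h3.eventually hq2).mono fun t ht => ht.symm)).unique h4
    filter_upwards [hGt.eventually h1, hWG] with p hp hp'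
    rwa [hp'] at hp
  · have h1 : Tendsto (fun c : ℝ => ((0 : ℝ), c)) (𝓝 0) (𝓝 0) := by
      have : Continuous (fun c : ℝ => ((0 : ℝ), c)) := by fun_prop
      exact this.tendsto 0
    filter_upwards [hW0, h1.eventually hGW] with c hc hc'
    rwa [hc] at hc'

/-! ### One-variable germs: signs and the involution of a minimum -/

/-- Induction through the derivative: `deriv f` satisfies the hypotheses one order lower, hence `f`
increases to the right of `0` from the value `0`. -/
theorem eventually_pos_right_of_iteratedDeriv {n : ℕ} {f : ℝ → ℝ} (hf : AnalyticAt ℝ f 0)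
    (h0 : ∀ i < n, iteratedDeriv i f 0 = 0) (hn : 0 < iteratedDeriv n f 0) :
    ∀ᶠ x in 𝓝[>] (0 : ℝ), 0 < f x := by
  induction n generalizing f with
  | zero =>
    rw [iteratedDeriv_zero] at hn
    exact (hf.continuousAt.eventually_const_lt hn).filter_mono nhdsWithin_le_nhds
  | succ n ih =>
    have h1 := ih hf.deriv (fun i hi => by
      rw [← iteratedDeriv_succ']; exact h0 (i + 1) (by omega)) (by rwa [← iteratedDeriv_succ'])
    obtain ⟨ε, hε, h2⟩ := Metric.eventually_nhds_iff_ball.1 hf.eventually_analyticAt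
    obtain ⟨u, hu, h3⟩ := (mem_nhdsGT_iff_exists_Ioo_subset).1 h1
    filter_upwards [Ioo_mem_nhdsGT (lt_min hε hu)] with x hx
    have hsub : ∀ y ∈ Icc 0 x, AnalyticAt ℝ f y := fun y hy => h2 y (by
      rw [mem_ball_zero_iff, Real.norm_eq_abs, abs_of_nonneg hy.1]
      exact hy.2.trans_lt (hx.2.trans_le (min_le_left _ _)))
    have hmono : StrictMonoOn f (Icc 0 x) := by
      refine strictMonoOn_of_deriv_pos (convex_Icc _ _)
        (fun y hy => (hsub y hy).continuousAt.continuousWithinAt) fun y hy => ?_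
      rw [interior_Icc] at hy
      exact h3 ⟨hy.1, hy.2.trans (hx.2.trans_le (min_le_right _ _))⟩
    have := hmono (left_mem_Icc.2 hx.1.le) (right_mem_Icc.2 hx.1.le) hx.1
    have h00 : f 0 = 0 := by simpa using h0 0 (by omega)
    rwa [h00] at this

/-- The one-sided statement is applied to `-f` and to `x ↦ f (-x)`; the oddness of the order makes
the leading derivative positive in both cases. -/
theorem eventually_sign_of_iteratedDeriv_odd {k : ℕ} (hk : 1 ≤ k) {f : ℝ → ℝ}
    (hf : AnalyticAt ℝ f 0) (h0 : ∀ i < 2 * k - 1, iteratedDeriv i f 0 = 0)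
    (hn : iteratedDeriv (2 * k - 1) f 0 < 0) :
    ∀ᶠ x in 𝓝 (0 : ℝ), (0 < x → f x < 0) ∧ (x < 0 → 0 < f x) := by
  have h1 : ∀ᶠ x in 𝓝[>] (0 : ℝ), 0 < (-f) x := by
    refine eventually_pos_right_of_iteratedDeriv (n := 2 * k - 1) hf.neg (fun i hi => ?_) ?_
    · rw [iteratedDeriv_neg, h0 i hi, neg_zero]
    · rw [iteratedDeriv_neg]; linarith
  have h2 : ∀ᶠ x in 𝓝[>] (0 : ℝ), 0 < f (-x) := by
    refine eventually_pos_right_of_iteratedDeriv (n := 2 * k - 1) (f := fun x => f (-x))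
      ?_ (fun i hi => ?_) ?_
    · exact AnalyticAt.fun_comp (g := f) (by simpa using hf) analyticAt_id.neg
    · rw [iteratedDeriv_comp_neg, neg_zero, h0 i hi, smul_zero]
    · rw [iteratedDeriv_comp_neg, neg_zero, Odd.neg_one_pow ⟨k - 1, by omega⟩]
      simpa using hn
  obtain ⟨u, hu, hu'⟩ := (mem_nhdsGT_iff_exists_Ioo_subset).1 (h1.and h2)
  filter_upwards [Ioo_mem_nhds (neg_lt_zero.2 hu) hu] with x hx
  refine ⟨fun h => ?_, fun h => ?_⟩
  · have := (hu' ⟨h, hx.2⟩).1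
    simpa using this
  · have := (hu' (show -x ∈ Ioo 0 u from ⟨by linarith, by linarith [hx.1]⟩)).2
    simpa using this

/-- The involution that exchanges the two branches of the level sets of a positive analytic
function at its minimum. -/
theorem exists_involution {h : ℝ → ℝ} (hh : AnalyticAt ℝ h 0) (h0 : h 0 = 0)
    (hpos : ∀ᶠ x in 𝓝[≠] (0 : ℝ), 0 < h x) :
    ∃ ρ : ℝ → ℝ, AnalyticAt ℝ ρ 0 ∧ ρ 0 = 0 ∧ deriv ρ 0 = -1 ∧
      (∀ᶠ x in 𝓝 0, ρ (ρ x) = x) ∧ ∀ᶠ x in 𝓝 0, h (ρ x) = h x := by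
  have hne : ¬ ∀ᶠ z in 𝓝 0, h z = 0 := by
    intro hz
    obtain ⟨x, hx1, hx2⟩ := (hpos.and (hz.filter_mono nhdsWithin_le_nhds)).exists
    exact hx1.ne' hx2
  -- Write `h = x ^ j * q`. Positivity on both sides of `0` forces `q 0 > 0` and `j` even, so `w = x
  -- * q ^ (1 / j)` is an analytic coordinate with `h = w ^ j`, and the involution is `w ↦ -w`.
  obtain ⟨j, q, hq, hq0, hhq⟩ := hh.exists_eventuallyEq_pow_smul_nonzero_iff.2 hne
  simp only [sub_zero, smul_eq_mul] at hhq
  have hpos' : ∀ᶠ x in 𝓝 (0 : ℝ), x ≠ 0 → 0 < x ^ j * q x := by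
    filter_upwards [eventually_nhdsWithin_iff.1 hpos, hhq] with x h1 h2 h3
    rw [← h2]; exact h1 h3
  obtain ⟨ε, hε, hball⟩ := Metric.eventually_nhds_iff_ball.1 hpos'
  have hqpos : 0 < q 0 := by
    have hge : ∀ᶠ x in 𝓝[>] (0 : ℝ), 0 ≤ q x := by
      filter_upwards [hpos'.filter_mono nhdsWithin_le_nhds, self_mem_nhdsWithin] with x hx hx0
      have hx0 : 0 < x := hx0
      exact (pos_of_mul_pos_right (hx hx0.ne') (pow_pos hx0 _).le).le
    have := ge_of_tendsto (hq.continuousAt.tendsto.mono_left nhdsWithin_le_nhds) hge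
    exact lt_of_le_of_ne this (Ne.symm hq0)
  have hqp : ∀ᶠ x in 𝓝 (0 : ℝ), 0 < q x := hq.continuousAt.eventually_const_lt hqpos
  have hje : Even j := by
    by_contra hodd
    rw [Nat.not_even_iff_odd] at hodd
    obtain ⟨x, ⟨hx1, hx2⟩, hx3⟩ := (((hpos'.and hqp).filter_mono
      (nhdsWithin_le_nhds (s := Iio (0 : ℝ)))).and self_mem_nhdsWithin).exists
    have hx3 : x < 0 := hx3
    have h1 := hx1 hx3.ne
    have h2 : x ^ j < 0 := hodd.pow_neg hx3
    nlinarith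
  obtain ⟨n, rfl⟩ := hje
  have hn : n ≠ 0 := by
    rintro rfl
    have := hhq.self_of_nhds
    simp [h0] at this
    exact hq0 this.symm
  let r : ℝ → ℝ := fun x => Real.exp (Real.log (q x) / (n + n : ℕ))
  have hr : AnalyticAt ℝ r 0 :=
    ((hq.log hqpos).div_const (c := ((n + n : ℕ) : ℝ))).rexp'
  have hrp : ∀ x, 0 < q x → r x ^ (n + n) = q x := by
    intro x hx
    have : ((n + n : ℕ) : ℝ) ≠ 0 := by exact_mod_cast (by omega : n + n ≠ 0)
    rw [← Real.exp_nat_mul, mul_div_cancel₀ _ this, Real.exp_log hx]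
  let w : ℝ → ℝ := fun x => x * r x
  have hw : AnalyticAt ℝ w 0 := analyticAt_id.mul hr
  have hw0 : w 0 = 0 := by simp [w]
  have hwh : ∀ᶠ x in 𝓝 0, h x = w x ^ (n + n) := by
    filter_upwards [hhq, hqp] with x hx hx'
    rw [hx, mul_pow, hrp x hx']
  have hwd : deriv w 0 = r 0 := by
    have : HasDerivAt w _ 0 := (hasDerivAt_id (0 : ℝ)).mul hr.differentiableAt.hasDerivAt
    simpa using this.deriv
  have hwd0 : deriv w 0 ≠ 0 := by rw [hwd]; exact (Real.exp_pos _).ne'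
  let v := hw.hasStrictDerivAt.localInverse _ _ _ hwd0
  have hv : AnalyticAt ℝ v 0 := by
    have := hw.analyticAt_localInverse hwd0
    rwa [hw0] at this
  have hvw : ∀ᶠ x in 𝓝 0, v (w x) = x := HasStrictDerivAt.eventually_left_inverse ..
  have hwv : ∀ᶠ x in 𝓝 0, w (v x) = x := by
    have : ∀ᶠ x in 𝓝 (w 0), w (v x) = x := HasStrictDerivAt.eventually_right_inverse ..
    rwa [hw0] at this
  have hv0 : v 0 = 0 := by
    have := hvw.self_of_nhds
    rwa [hw0] at this
  let ρ : ℝ → ℝ := fun x => v (-w x)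
  have hnw : Tendsto (fun x => -w x) (𝓝 0) (𝓝 0) := by
    have : Tendsto (fun x => -w x) (𝓝 0) (𝓝 (-w 0)) := hw.continuousAt.neg.tendsto
    rwa [hw0, neg_zero] at this
  have hρ : AnalyticAt ℝ ρ 0 :=
    AnalyticAt.fun_comp (g := v) (f := fun x => -w x) (by simpa [hw0] using hv) hw.neg
  have hρ0 : ρ 0 = 0 := by simp [ρ, hw0, hv0]
  have hwρ : ∀ᶠ x in 𝓝 0, w (ρ x) = -w x := hnw.eventually hwv
  refine ⟨ρ, hρ, hρ0, ?_, ?_, ?_⟩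
  · have h1 : deriv (fun x => w (ρ x)) 0 = deriv (fun x => -w x) 0 :=
      Filter.EventuallyEq.deriv_eq hwρ
    have h2 : HasDerivAt (fun x => w (ρ x)) (deriv w 0 * deriv ρ 0) 0 :=
      HasDerivAt.comp (h₂ := w) (h := ρ) 0 (by
        rw [hρ0]; exact hw.differentiableAt.hasDerivAt) hρ.differentiableAt.hasDerivAt
    rw [h2.deriv, deriv.fun_neg] at h1
    have : deriv w 0 * (deriv ρ 0 + 1) = 0 := by linarith
    rcases mul_eq_zero.1 this with h3 | h3
    · exact absurd h3 hwd0
    · linarith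
  · filter_upwards [hwρ, hvw] with x hx hx'
    change v (-w (ρ x)) = x
    rw [hx, neg_neg, hx']
  · have hρt : Tendsto ρ (𝓝 0) (𝓝 0) := by simpa [hρ0] using hρ.continuousAt.tendsto
    filter_upwards [hwρ, hwh, hρt.eventually hwh] with x h1 h2 h3
    rw [h3, h1, h2, Even.neg_pow ⟨n, rfl⟩]

/-! ### The half-return at an invisible fold -/

/-- Half-return data of the vector field `A` in the upper half-plane near the contact point
`(c, 0)`: the orbit that reaches `(x, 0)`, `c < x < c + r`, at time `0` started from `(ρ x, 0)` at
time `-θ x`, and is parametrized by `w x`. -/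
structure HalfReturn (A : ℝ × ℝ → ℝ × ℝ) (c r : ℝ) (ρ θ : ℝ → ℝ) (w : ℝ → ℝ → ℝ × ℝ) :
    Prop where
  center : (A (c, 0)).2 = 0
  neg : ∀ x ∈ Ioo c (c + r), (A (x, 0)).2 < 0
  pos : ∀ x ∈ Ioo (c - r) c, 0 < (A (x, 0)).2
  ρ_lt : ∀ x ∈ Ioo c (c + r), ρ x < c
  θ_pos : ∀ x ∈ Ioo c (c + r), 0 < θ x
  w_zero : ∀ x ∈ Ioo c (c + r), w x 0 = (x, 0)
  w_end : ∀ x ∈ Ioo c (c + r), w x (-θ x) = (ρ x, 0)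
  w_deriv : ∀ x ∈ Ioo c (c + r), ∀ t ∈ Icc (-θ x) 0,
    HasDerivWithinAt (w x) (A (w x t)) (Icc (-θ x) 0) t
  w_pos : ∀ x ∈ Ioo c (c + r), ∀ t ∈ Ioo (-θ x) 0, 0 < (w x t).2
  unique : ∀ x ∈ Ioo c (c + r), ∀ (γ : ℝ → ℝ × ℝ) (a : ℝ), a ≤ 0 →
    (∀ t ∈ Icc a 0, HasDerivWithinAt γ (A (γ t)) (Icc a 0) t) → γ 0 = (x, 0) →
    (∀ t ∈ Icc a 0, 0 ≤ (γ t).2) → ∀ t ∈ Icc (max a (-θ x)) 0, γ t = w x t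

theorem mem_ball_zero_prod {p : ℝ × ℝ} {ε : ℝ} :
    p ∈ Metric.ball (0 : ℝ × ℝ) ε ↔ |p.1| < ε ∧ |p.2| < ε := by
  simp [Prod.norm_def]

theorem eventually_box {ε : ℝ} (hε : 0 < ε) :
    ∀ᶠ p in 𝓝 (0 : ℝ × ℝ), |p.1| < ε ∧ |p.2| < ε := by
  filter_upwards [Metric.ball_mem_nhds (0 : ℝ × ℝ) hε] with p hp
  exact mem_ball_zero_prod.1 hp

theorem eventually_sign_of_hasDerivAt_neg {f : ℝ → ℝ} {d : ℝ} (hf : HasDerivAt f d 0)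
    (h0 : f 0 = 0) (hd : d < 0) :
    ∀ᶠ x in 𝓝 (0 : ℝ), (0 < x → f x < 0) ∧ (x < 0 → 0 < f x) := by
  have h1 := (hasDerivAt_iff_tendsto_slope.1 hf).eventually_lt_const hd
  rw [eventually_nhdsWithin_iff] at h1
  filter_upwards [h1] with x hx
  refine ⟨fun h => ?_, fun h => ?_⟩
  · have := hx h.ne'
    rw [slope_def_field, h0, sub_zero, sub_zero, div_neg_iff] at this
    rcases this with h2 | h2
    · linarith [h2.2]
    · exact h2.1
  · have := hx h.ne
    rw [slope_def_field, h0, sub_zero, sub_zero, div_neg_iff] at this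
    rcases this with h2 | h2
    · exact h2.1
    · linarith [h2.2]

/-- The second component of the inverse flow box `G` is a first integral, the first component is
time. The involution attached to the first integral on the line is the half-return map, and the
difference of times at the two ends of an arc is the flight time. The last clause says that arcs of
small `x` are small as a whole. -/
theorem local_half_return {Z : ℝ × ℝ → ℝ × ℝ} {k : ℕ} (hZ : AnalyticOn ℝ Z (halfPlane 1))
    (hfold : IsInvisibleFold 1 Z k) (hP : 0 < (Z (0, 0)).1) :
    ∃ (r : ℝ) (ρ θ : ℝ → ℝ) (w : ℝ → ℝ → ℝ × ℝ), 0 < r ∧ HalfReturn Z 0 r ρ θ w ∧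
      AnalyticAt ℝ ρ 0 ∧ ρ 0 = 0 ∧ deriv ρ 0 = -1 ∧ (∀ᶠ x in 𝓝 0, ρ (ρ x) = x) ∧
      θ 0 = 0 ∧ (∃ d, 0 < d ∧ HasDerivAt θ d 0) ∧
      ∀ U ∈ 𝓝 (0 : ℝ × ℝ), ∀ᶠ x in 𝓝 (0 : ℝ), ∀ t ∈ Icc (-θ x) 0, w x t ∈ U := by
  -- The field is analytic only on the closed half-plane; `Y` is an analytic extension across the
  -- line near the origin. Only curves in `y ≥ 0` may be compared with its orbits.
  obtain ⟨Y, -, hZY, hY⟩ := analyticWithinAt_iff_exists_analyticAt'.1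
    (hZ 0 (by simp [halfPlane]))
  have hZY' : ∀ p : ℝ × ℝ, 0 ≤ p.2 → Z p = Y p := fun p hp =>
    hZY (mem_insert_of_mem _ (by simpa [halfPlane] using hp))
  have hQeq : (fun x : ℝ => (Z (x, 0)).2) = fun x : ℝ => (Y (x, 0)).2 := by
    ext x; rw [hZY' (x, 0) le_rfl]
  have hline : AnalyticAt ℝ (fun x : ℝ => (x, (0 : ℝ))) 0 := analyticAt_id.prod analyticAt_const
  have hQa : AnalyticAt ℝ (fun x : ℝ => (Y (x, 0)).2) 0 :=
    AnalyticAt.fun_comp (g := Prod.snd) analyticAt_snd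
      (AnalyticAt.fun_comp (g := Y) (f := fun x : ℝ => (x, (0 : ℝ))) hY hline)
  have hQsign := eventually_sign_of_iteratedDeriv_odd hfold.one_le hQa
    (fun i hi => by rw [← hQeq]; exact hfold.vanish i hi) (by
      rw [← hQeq]
      have := hfold.invisible
      rw [one_mul] at this
      exact (pos_iff_neg_of_mul_neg this).1 hP)
  have hQ0 : (Z (0, 0)).2 = 0 := by
    have := hfold.vanish 0 (by have := hfold.one_le; omega)
    simpa using this
  have hP' : 0 < (Y 0).1 := by rw [← hZY' 0 le_rfl]; exact hP
  have hQ0' : (Y 0).2 = 0 := by rw [← hZY' 0 le_rfl]; exact hQ0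
  obtain ⟨W, G, hW, hG, hW0, hG0, hWG, hGW, hWd, hGY, hGc⟩ := exists_flowBox hY hP'.ne'
  -- partial derivatives of the first integral
  have hGd : HasFDerivAt G (fderiv ℝ G 0) 0 := hG.differentiableAt.hasFDerivAt
  have hHy0 : (fderiv ℝ G 0 (0, 1)).2 = 1 := by
    have h1 : HasDerivAt (fun c : ℝ => G (0, c)) (0, 1) 0 :=
      ((hasDerivAt_const 0 (0 : ℝ)).prodMk (hasDerivAt_id (0 : ℝ))).congr_of_eventuallyEq hGc
    have h2 : HasDerivAt (fun t : ℝ => ((0 : ℝ), t)) (0, 1) 0 :=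
      (hasDerivAt_const 0 (0 : ℝ)).prodMk (hasDerivAt_id (0 : ℝ))
    have h3 := HasFDerivAt.comp_hasDerivAt (f := fun t : ℝ => ((0 : ℝ), t)) 0 hGd h2
    rw [← h1.unique h3]
  have hGx0 : (Y 0).1 • fderiv ℝ G 0 (1, 0) = (1, 0) := by
    have h1 : (Y 0).1 • ((1 : ℝ), (0 : ℝ)) = Y 0 := by ext <;> simp [hQ0']
    rw [← map_smul, h1]
    exact hGY.self_of_nhds
  have hHy : ∀ᶠ p in 𝓝 (0 : ℝ × ℝ), 0 < (fderiv ℝ G p (0, 1)).2 := by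
    have h1 : ContinuousAt (fun p => (fderiv ℝ G p (0, 1)).2) 0 :=
      ((ContinuousLinearMap.apply ℝ (ℝ × ℝ) ((0 : ℝ), (1 : ℝ))).continuous.continuousAt.comp
        hG.fderiv.continuousAt).snd
    exact h1.eventually_const_lt (lt_of_lt_of_eq one_pos hHy0.symm)
  have hPY : ∀ᶠ p in 𝓝 (0 : ℝ × ℝ), 0 < (Y p).1 :=
    hY.continuousAt.fst.eventually_const_lt hP'
  obtain ⟨ε, hε, hbox⟩ := Metric.eventually_nhds_iff_ball.1
    (hHy.and (hPY.and (hG.eventually_analyticAt.and (hGY.and hWG))))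
  simp only [mem_ball_zero_prod] at hbox
  have hWt : Tendsto W (𝓝 0) (𝓝 0) := by simpa [hW0] using hW.continuousAt.tendsto
  have hGt : Tendsto G (𝓝 0) (𝓝 0) := by simpa [hG0] using hG.continuousAt.tendsto
  obtain ⟨η, hη, hbox2⟩ := Metric.eventually_nhds_iff_ball.1
    (hWd.and (hGW.and (hWt.eventually (eventually_box hε))))
  simp only [mem_ball_zero_prod] at hbox2
  let h : ℝ → ℝ := fun x => (G (x, 0)).2
  have hGla : AnalyticAt ℝ (fun x : ℝ => G (x, 0)) 0 :=
    AnalyticAt.fun_comp (g := G) (f := fun x : ℝ => (x, (0 : ℝ))) hG hline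
  have hha : AnalyticAt ℝ h 0 := AnalyticAt.fun_comp (g := Prod.snd) analyticAt_snd hGla
  have hh0 : h 0 = 0 := by
    change (G 0).2 = 0
    rw [hG0]; rfl
  obtain ⟨ε₁, hε₁, hQs⟩ := Metric.eventually_nhds_iff_ball.1 hQsign
  simp only [mem_ball_zero_iff, Real.norm_eq_abs] at hQs
  set e := min ε ε₁ with he
  have he0 : 0 < e := lt_min hε hε₁
  have hGxd : ∀ x : ℝ, |x| < ε → HasDerivAt (fun x : ℝ => G (x, 0)) (fderiv ℝ G (x, 0) (1, 0)) x := by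
    intro x hx
    exact HasFDerivAt.comp_hasDerivAt (f := fun t : ℝ => (t, (0 : ℝ))) x
      (hbox (x, 0) ⟨hx, by simpa using hε⟩).2.2.1.differentiableAt.hasFDerivAt
      ((hasDerivAt_id x).prodMk (hasDerivAt_const x (0 : ℝ)))
  have hhd : ∀ x, |x| < ε → HasDerivAt h (fderiv ℝ G (x, 0) (1, 0)).2 x := fun x hx =>
    (hGxd x hx).snd
  -- The first integral `H` is constant along the field, `P * H_x + Q * H_y = 0`. As `P` and `H_y`
  -- are positive, `h'` has the sign opposite to that of `Q (x, 0)`, which is the sign of `x`; so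
  -- `h` has a strict minimum at `0`.
  have hrel : ∀ x, |x| < ε → (Y (x, 0)).1 * (fderiv ℝ G (x, 0) (1, 0)).2 +
      (Y (x, 0)).2 * (fderiv ℝ G (x, 0) (0, 1)).2 = 0 := by
    intro x hx
    have h1 := (hbox (x, 0) ⟨hx, by simpa using hε⟩).2.2.2.1
    have h2 : Y (x, 0) = (Y (x, 0)).1 • ((1 : ℝ), (0 : ℝ)) + (Y (x, 0)).2 • ((0 : ℝ), (1 : ℝ)) := by
      ext <;> simp
    rw [h2, map_add, map_smul, map_smul] at h1
    have := congrArg Prod.snd h1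
    simpa using this
  have hhpos : ∀ x, 0 < x → x < e → 0 < (fderiv ℝ G (x, 0) (1, 0)).2 := by
    intro x hx hxe
    have hxa : |x| < e := by rwa [abs_of_pos hx]
    have h1 := hrel x (hxa.trans_le (min_le_left _ _))
    have h2 := (hQs x (hxa.trans_le (min_le_right _ _))).1 hx
    have h3 := hbox (x, 0) ⟨hxa.trans_le (min_le_left _ _), by simpa using hε⟩
    have h4 := mul_neg_of_neg_of_pos h2 h3.1
    exact pos_of_mul_pos_right (show 0 < (Y (x, 0)).1 * _ by linarith) h3.2.1.le
  have hhneg : ∀ x, x < 0 → -e < x → (fderiv ℝ G (x, 0) (1, 0)).2 < 0 := by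
    intro x hx hxe
    have hxa : |x| < e := by rw [abs_of_neg hx]; linarith
    have h1 := hrel x (hxa.trans_le (min_le_left _ _))
    have h2 := (hQs x (hxa.trans_le (min_le_right _ _))).2 hx
    have h3 := hbox (x, 0) ⟨hxa.trans_le (min_le_left _ _), by simpa using hε⟩
    have h4 := mul_pos h2 h3.1
    by_contra hc
    have := mul_nonneg h3.2.1.le (not_lt.1 hc)
    linarith
  have abs_lt_of : ∀ x, x ∈ Ioo (-e) e → |x| < ε := fun x hx =>
    (abs_lt.2 hx).trans_le (min_le_left _ _)
  have hmono : StrictMonoOn h (Ico 0 e) := by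
    refine strictMonoOn_of_deriv_pos (convex_Ico _ _) (fun x hx =>
      (hhd x (abs_lt_of x ⟨by linarith [hx.1], hx.2⟩)).continuousAt.continuousWithinAt)
      fun x hx => ?_
    rw [interior_Ico] at hx
    rw [(hhd x (abs_lt_of x ⟨by linarith [hx.1], hx.2⟩)).deriv]
    exact hhpos x hx.1 hx.2
  have hanti : StrictAntiOn h (Ioc (-e) 0) := by
    refine strictAntiOn_of_deriv_neg (convex_Ioc _ _) (fun x hx =>
      (hhd x (abs_lt_of x ⟨hx.1, by linarith [hx.2]⟩)).continuousAt.continuousWithinAt)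
      fun x hx => ?_
    rw [interior_Ioc] at hx
    rw [(hhd x (abs_lt_of x ⟨hx.1, by linarith [hx.2]⟩)).deriv]
    exact hhneg x hx.2 hx.1
  have hhp : ∀ᶠ x in 𝓝[≠] (0 : ℝ), 0 < h x := by
    filter_upwards [(Ioo_mem_nhds (neg_lt_zero.2 he0) he0 : Ioo (-e) e ∈ 𝓝 0) |>
      mem_nhdsWithin_of_mem_nhds, self_mem_nhdsWithin] with x hx hx0
    rw [← hh0]
    rcases lt_or_gt_of_ne (show x ≠ 0 from hx0) with h1 | h1
    · exact hanti ⟨hx.1, h1.le⟩ ⟨by linarith, le_rfl⟩ h1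
    · exact hmono ⟨le_rfl, he0⟩ ⟨h1.le, hx.2⟩ h1
  obtain ⟨ρ, hρa, hρ0, hρ1, hρρ, hhρ⟩ := exists_involution hha hh0 hhp
  have hρt : Tendsto ρ (𝓝 0) (𝓝 0) := by simpa [hρ0] using hρa.continuousAt.tendsto
  have hρsign := eventually_sign_of_hasDerivAt_neg (d := -1)
    (by rw [← hρ1]; exact hρa.differentiableAt.hasDerivAt) hρ0 (by norm_num)
  have hGlt : Tendsto (fun x : ℝ => G (x, 0)) (𝓝 0) (𝓝 0) := by
    have : Tendsto (fun x : ℝ => G (x, 0)) (𝓝 0) (𝓝 (G 0)) := hGla.continuousAt.tendsto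
    rwa [hG0] at this
  have hGρt : Tendsto (fun x : ℝ => G (ρ x, 0)) (𝓝 0) (𝓝 0) := hGlt.comp hρt
  -- In flow-box coordinates an orbit is a horizontal line run through with unit speed. The points
  -- `(x, 0)` and `(ρ x, 0)` lie on the same level, and `θ x` is the distance of their time
  -- coordinates.
  let θ : ℝ → ℝ := fun x => (G (x, 0)).1 - (G (ρ x, 0)).1
  let w : ℝ → ℝ → ℝ × ℝ := fun x t => W ((G (x, 0)).1 + t, h x)
  have hIoo : Ioo (-e) e ∈ 𝓝 (0 : ℝ) := Ioo_mem_nhds (neg_lt_zero.2 he0) he0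
  obtain ⟨r, hr, hR⟩ := Metric.eventually_nhds_iff_ball.1
    ((eventually_mem_set.2 hIoo).and ((hρt.eventually (eventually_mem_set.2 hIoo)).and
      ((hGlt.eventually (eventually_box hη)).and
        ((hGρt.eventually (eventually_box hη)).and (hρsign.and hhρ)))))
  simp only [mem_ball_zero_iff, Real.norm_eq_abs] at hR
  -- The time coordinate has slope `1 / P` along the line at the fold, and `ρ' (0) = -1` doubles it.
  have hθd : HasDerivAt θ (2 * (Y 0).1⁻¹) 0 := by
    have h1 : HasDerivAt (fun x : ℝ => G (x, 0)) (fderiv ℝ G 0 (1, 0)) 0 :=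
      hGxd 0 (by simpa using hε)
    have h2 : HasDerivAt (fun x : ℝ => G (ρ x, 0)) ((-1 : ℝ) • fderiv ℝ G 0 (1, 0)) 0 := by
      have h3 : HasDerivAt ρ (-1) 0 := by rw [← hρ1]; exact hρa.differentiableAt.hasDerivAt
      exact HasDerivAt.scomp (g₁ := fun x : ℝ => G (x, 0)) (h := ρ) 0 (by rw [hρ0]; exact h1) h3
    have h1' : HasDerivAt (fun x : ℝ => (G (x, 0)).1) (fderiv ℝ G 0 (1, 0)).1 0 := h1.fst
    have h2' : HasDerivAt (fun x : ℝ => (G (ρ x, 0)).1)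
      ((-1 : ℝ) • fderiv ℝ G 0 (1, 0)).1 0 := h2.fst
    have h4 : (fderiv ℝ G 0 (1, 0)).1 = (Y 0).1⁻¹ := by
      have := congrArg Prod.fst hGx0
      simp only [Prod.smul_fst, smul_eq_mul] at this
      exact eq_inv_of_mul_eq_one_right this
    have h5 := h1'.sub h2'
    rw [Prod.smul_fst, h4, smul_eq_mul,
      show (Y 0).1⁻¹ - -1 * (Y 0).1⁻¹ = 2 * (Y 0).1⁻¹ by ring] at h5
    exact h5
  have strip : ∀ x ∈ Ioo (0 : ℝ) (0 + r), ∀ t ∈ Icc (-θ x) 0,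
      |(G (x, 0)).1 + t| < η ∧ |h x| < η := by
    intro x hx t ht
    rw [zero_add] at hx
    obtain ⟨-, -, h1, h2, -, -⟩ := hR x (by rw [abs_of_pos hx.1]; exact hx.2)
    refine ⟨abs_lt.2 ⟨?_, ?_⟩, h1.2⟩
    · have := (abs_lt.1 h2.1).1
      have := ht.1
      simp only [θ] at this
      linarith
    · have := (abs_lt.1 h1.1).2
      linarith [ht.2]
  have hwY : ∀ x ∈ Ioo (0 : ℝ) (0 + r), ∀ t ∈ Icc (-θ x) 0,
      HasDerivAt (w x) (Y (w x t)) t := by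
    intro x hx t ht
    have h1 := (hbox2 ((G (x, 0)).1 + t, h x) (strip x hx t ht)).1
    exact HasDerivAt.comp_const_add (f := fun s => W (s, h x)) _ _ h1
  have hw0 : ∀ x ∈ Ioo (0 : ℝ) (0 + r), w x 0 = (x, 0) := by
    intro x hx
    rw [zero_add] at hx
    obtain ⟨h1, -⟩ := hR x (by rw [abs_of_pos hx.1]; exact hx.2)
    have h2 := (hbox (x, 0) ⟨abs_lt_of x h1, by simpa using hε⟩).2.2.2.2
    simpa [w, h] using h2
  have hwe : ∀ x ∈ Ioo (0 : ℝ) (0 + r), w x (-θ x) = (ρ x, 0) := by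
    intro x hx
    rw [zero_add] at hx
    obtain ⟨-, h1, -, -, -, h3⟩ := hR x (by rw [abs_of_pos hx.1]; exact hx.2)
    have h2 := (hbox (ρ x, 0) ⟨abs_lt_of _ h1, by simpa using hε⟩).2.2.2.2
    rw [← h2]
    simp only [w, θ, ← h3, h]
    congr 1
    ext <;> simp
  have hρneg : ∀ x ∈ Ioo (0 : ℝ) (0 + r), ρ x < 0 := by
    intro x hx
    rw [zero_add] at hx
    exact (hR x (by rw [abs_of_pos hx.1]; exact hx.2)).2.2.2.2.1.1 hx.1
  have hfst : ∀ c, |c| < η → StrictMonoOn (fun s => (W (s, c)).1) (Ioo (-η) η) := by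
    intro c hc
    have hd : ∀ s ∈ Ioo (-η) η, HasDerivAt (fun s => (W (s, c)).1) (Y (W (s, c))).1 s :=
      fun s hs => (hbox2 (s, c) ⟨abs_lt.2 hs, hc⟩).1.fst
    refine strictMonoOn_of_deriv_pos (convex_Ioo _ _)
      (fun s hs => (hd s hs).continuousAt.continuousWithinAt) fun s hs => ?_
    rw [interior_Ioo] at hs
    rw [(hd s hs).deriv]
    exact (hbox _ ((hbox2 (s, c) ⟨abs_lt.2 hs, hc⟩).2.2)).2.1
  have hθpos : ∀ x ∈ Ioo (0 : ℝ) (0 + r), 0 < θ x := by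
    intro x hx
    have h1 := hw0 x hx
    have h2 := hwe x hx
    have h3 := hρneg x hx
    rw [zero_add] at hx
    obtain ⟨-, -, h4, h5, -, -⟩ := hR x (by rw [abs_of_pos hx.1]; exact hx.2)
    have h6 := (hfst (h x) h4.2).lt_iff_lt (abs_lt.1 h5.1) (abs_lt.1 h4.1)
    have h7 : (W ((G (ρ x, 0)).1, h x)).1 = ρ x := by
      have : (G (ρ x, 0)).1 = (G (x, 0)).1 + (-θ x) := by simp only [θ]; ring
      rw [this]
      exact congrArg Prod.fst h2
    have h8 : (W ((G (x, 0)).1, h x)).1 = x := by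
      have := congrArg Prod.fst h1
      simpa [w] using this
    simp only [h7, h8] at h6
    have := h6.1 (h3.trans hx.1)
    simp only [θ]; linarith
  have hHmono : ∀ X, |X| < ε → StrictMonoOn (fun y => (G (X, y)).2) (Ioo (-ε) ε) := by
    intro X hX
    have hd : ∀ y ∈ Ioo (-ε) ε, HasDerivAt (fun y => (G (X, y)).2) (fderiv ℝ G (X, y) (0, 1)).2 y :=
      fun y hy => (HasFDerivAt.comp_hasDerivAt (f := fun t : ℝ => (X, t)) y
        (hbox (X, y) ⟨hX, abs_lt.2 hy⟩).2.2.1.differentiableAt.hasFDerivAt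
        ((hasDerivAt_const y X).prodMk (hasDerivAt_id y))).snd
    refine strictMonoOn_of_deriv_pos (convex_Ioo _ _)
      (fun s hs => (hd s hs).continuousAt.continuousWithinAt) fun s hs => ?_
    rw [interior_Ioo] at hs
    rw [(hd s hs).deriv]
    exact (hbox (X, s) ⟨hX, abs_lt.2 hs⟩).1
  -- Inside the arc the abscissa lies strictly between `ρ x` and `x`, where `h` is smaller than `h
  -- x`. The point itself has level `h x` and the level increases with `y`, so it lies above the
  -- line.
  have hwpos : ∀ x ∈ Ioo (0 : ℝ) (0 + r), ∀ t ∈ Ioo (-θ x) 0, 0 < (w x t).2 := by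
    intro x hx t ht
    have hs := strip x hx t (Ioo_subset_Icc_self ht)
    have hs0 := strip x hx 0 ⟨by linarith [hθpos x hx], le_rfl⟩
    have hs1 := strip x hx (-θ x) ⟨le_rfl, by linarith [hθpos x hx]⟩
    have m1 := hfst (h x) hs.2 (abs_lt.1 hs1.1) (abs_lt.1 hs.1) (by linarith [ht.1])
    have m2 := hfst (h x) hs.2 (abs_lt.1 hs.1) (abs_lt.1 hs0.1) (by linarith [ht.2])
    have e1 : (W ((G (x, 0)).1 + -θ x, h x)).1 = ρ x := congrArg Prod.fst (hwe x hx)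
    have e2 : (W ((G (x, 0)).1 + 0, h x)).1 = x := congrArg Prod.fst (hw0 x hx)
    simp only [e1, e2] at m1 m2
    obtain ⟨-, g1, g2⟩ := hbox2 ((G (x, 0)).1 + t, h x) hs
    rw [zero_add] at hx
    obtain ⟨k1, k2, -, -, -, k3⟩ := hR x (by rw [abs_of_pos hx.1]; exact hx.2)
    change 0 < (W ((G (x, 0)).1 + t, h x)).2
    set p := W ((G (x, 0)).1 + t, h x) with hp
    have hlt : h p.1 < h x := by
      rcases le_or_gt 0 p.1 with h0 | h0
      · exact hmono ⟨h0, m2.trans k1.2⟩ ⟨hx.1.le, k1.2⟩ m2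
      · rw [← k3]
        exact hanti ⟨k2.1, by linarith⟩ ⟨k2.1.trans m1, h0.le⟩ m1
    by_contra hneg
    have h5 := (hHmono p.1 g2.1).monotoneOn (abs_lt.1 g2.2) ⟨by linarith, hε⟩ (not_lt.1 hneg)
    simp only [Prod.mk.eta, g1] at h5
    exact absurd h5 (not_le.2 hlt)
  have hwZ : ∀ x ∈ Ioo (0 : ℝ) (0 + r), ∀ t ∈ Icc (-θ x) 0, Z (w x t) = Y (w x t) := by
    intro x hx t ht
    apply hZY'
    rcases eq_or_lt_of_le ht.1 with h1 | h1
    · rw [← h1, hwe x hx]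
    · rcases eq_or_lt_of_le ht.2 with h2 | h2
      · rw [h2, hw0 x hx]
      · exact (hwpos x hx t ⟨h1, h2⟩).le
  refine ⟨r, ρ, θ, w, hr, ⟨hQ0, ?_, ?_, hρneg, hθpos, hw0, hwe, ?_, hwpos, ?_⟩, hρa, hρ0, hρ1, hρρ,
    by simp [θ, hρ0], ⟨_, mul_pos two_pos (inv_pos.2 hP'), hθd⟩, ?_⟩
  · intro x hx
    rw [zero_add] at hx
    obtain ⟨k1, -⟩ := hR x (by rw [abs_of_pos hx.1]; exact hx.2)
    rw [hZY' (x, 0) le_rfl]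
    exact (hQs x ((abs_lt.2 k1).trans_le (min_le_right _ _))).1 hx.1
  · intro x hx
    obtain ⟨k1, -⟩ := hR x (by rw [abs_of_neg hx.2]; linarith [hx.1])
    rw [hZY' (x, 0) le_rfl]
    exact (hQs x ((abs_lt.2 k1).trans_le (min_le_right _ _))).2 hx.2
  · exact fun x hx t ht => by
      rw [hwZ x hx t ht]; exact (hwY x hx t ht).hasDerivWithinAt
  -- A solution in `y ≥ 0` is a solution for `Y`, so `G (γ t) - (t, 0)` is constant as long as `γ`
  -- stays in the box. Agreement with the arc is propagated backwards in time by continuous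
  -- induction on `s = -t`: the arc lies in the box, hence so does `γ` for a short further time.
  · intro x hx γ a ha hγ hγ0 hγpos
    set m := max a (-θ x) with hm
    have hm0 : m ≤ 0 := max_le ha (by linarith [hθpos x hx])
    have hγc : ContinuousOn γ (Icc a 0) := fun t ht => (hγ t ht).continuousWithinAt
    have hwc : ContinuousOn (w x) (Icc (-θ x) 0) := fun t ht =>
      (hwY x hx t ht).continuousAt.continuousWithinAt
    have hna : MapsTo (fun s : ℝ => -s) (Icc 0 (-m)) (Icc a 0) := fun s hs =>
      ⟨by linarith [hs.2, le_max_left a (-θ x)], by linarith [hs.1]⟩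
    have hnθ : MapsTo (fun s : ℝ => -s) (Icc 0 (-m)) (Icc (-θ x) 0) := fun s hs =>
      ⟨by linarith [hs.2, le_max_right a (-θ x)], by linarith [hs.1]⟩
    have hγn : ContinuousOn (fun s => γ (-s)) (Icc 0 (-m)) :=
      hγc.comp continuous_neg.continuousOn hna
    have hwn : ContinuousOn (fun s => w x (-s)) (Icc 0 (-m)) :=
      hwc.comp continuous_neg.continuousOn hnθ
    have hsub : Icc 0 (-m) ⊆ {s | γ (-s) = w x (-s)} := by
      refine IsClosed.Icc_subset_of_forall_exists_gt ?_ ?_ ?_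
      · have := (hγn.sub hwn).preimage_isClosed_of_isClosed isClosed_Icc
          (isClosed_singleton (x := (0 : ℝ × ℝ)))
        convert this using 1
        ext s
        simp only [mem_inter_iff, mem_ofPred_eq, mem_preimage, mem_singleton_iff, sub_eq_zero,
          Pi.sub_apply]
        exact and_comm
      · simp [hγ0, hw0 x hx]
      · intro s hs y hy
        have hy : s < y := hy
        have hγs : γ (-s) = w x (-s) := hs.1
        have hsI : s ∈ Icc 0 (-m) := ⟨hs.2.1, hs.2.2.le⟩
        have hst := strip x hx (-s) (hnθ hsI)
        have hwb := (hbox2 ((G (x, 0)).1 + -s, h x) hst).2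
        -- stay in the box for a short time
        have hev : ∀ᶠ z in 𝓝[Icc 0 (-m)] s, |(γ (-z)).1| < ε ∧ |(γ (-z)).2| < ε := by
          have h1 : Tendsto (fun z => γ (-z)) (𝓝[Icc 0 (-m)] s) (𝓝 (γ (-s))) := hγn s hsI
          refine h1.eventually (p := fun p : ℝ × ℝ => |p.1| < ε ∧ |p.2| < ε) ?_
          rw [hγs]
          filter_upwards [Metric.isOpen_ball.mem_nhds (mem_ball_zero_prod.2 hwb.2)] with p hp
          exact mem_ball_zero_prod.1 hp
        have hev' : ∀ᶠ z in 𝓝[>] s, z ∈ Icc 0 (-m) ∧ |(γ (-z)).1| < ε ∧ |(γ (-z)).2| < ε := by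
          have h1 : Icc 0 (-m) ∈ 𝓝[>] s :=
            mem_of_superset (Ioo_mem_nhdsGT hs.2.2) fun z hz =>
              ⟨hs.2.1.trans hz.1.le, hz.2.le⟩
          exact (eventually_mem_set.2 h1).and ((eventually_nhdsWithin_iff.1 hev).filter_mono nhdsWithin_le_nhds |>.mp
            ((eventually_mem_set.2 h1).mono fun z hz h => h hz))
        obtain ⟨u, hu, hu'⟩ := (mem_nhdsGT_iff_exists_Ioo_subset).1 hev'
        have hu : s < u := hu
        obtain ⟨z, hz1, hz2⟩ := exists_between (lt_min hu hy)
        refine ⟨z, ?_, hz1, (hz2.trans_le (min_le_right _ _)).le⟩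
        have hin : ∀ t ∈ Icc (-z) (-s), t ∈ Icc a 0 ∧ |(γ t).1| < ε ∧ |(γ t).2| < ε := by
          intro t ht
          rcases eq_or_lt_of_le ht.2 with h1 | h1
          · rw [h1]; exact ⟨hna hsI, by rw [hγs]; exact hwb.2⟩
          · have h2 : -t ∈ Ioo s u :=
              ⟨by linarith, by linarith [ht.1, hz2.trans_le (min_le_left u y)]⟩
            have h3 := hu' h2
            simp only [mem_ofPred_eq, neg_neg] at h3
            have h4 := hna h3.1
            simp only [neg_neg] at h4
            exact ⟨h4, h3.2⟩
        have hder : ∀ t ∈ Icc (-z) (-s),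
            HasDerivWithinAt (fun t => G (γ t) - (t, 0)) 0 (Icc (-z) (-s)) t := by
          intro t ht
          obtain ⟨i1, i2⟩ := hin t ht
          have d1 := (hγ t i1).mono (s := Icc (-z) (-s)) fun t' ht' => (hin t' ht').1
          have b1 := hbox (γ t) i2
          have d2 := b1.2.2.1.differentiableAt.hasFDerivAt.comp_hasDerivWithinAt t d1
          rw [hZY' _ (hγpos t i1), b1.2.2.2.1] at d2
          have d3 : HasDerivWithinAt (fun t : ℝ => (t, (0 : ℝ))) (1, 0) (Icc (-z) (-s)) t :=
            (hasDerivWithinAt_id t _).prodMk (hasDerivWithinAt_const t _ _)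
          have d4 := d2.sub d3
          rw [sub_self] at d4
          exact d4
        have hconst := constant_of_has_deriv_right_zero
          (fun t ht => (hder t ht).continuousWithinAt) (fun t ht =>
            (hder t (Ico_subset_Icc_self ht)).mono_of_mem_nhdsWithin
              (mem_of_superset (Icc_mem_nhdsGE ht.2) (Icc_subset_Icc_left ht.1)))
          (-s) ⟨by linarith, le_rfl⟩
        have hGs : G (γ (-s)) = ((G (x, 0)).1 + -s, h x) := by rw [hγs]; exact hwb.1
        have hGz : G (γ (-z)) = ((G (x, 0)).1 + -z, h x) := by
          have h1 := eq_add_of_sub_eq hconst.symm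
          rw [h1, hGs]
          ext <;> simp
        have h2 := (hbox (γ (-z)) (hin (-z) ⟨le_rfl, by linarith⟩).2).2.2.2.2
        change γ (-z) = w x (-z)
        rw [← h2, hGz]
    intro t ht
    have := hsub (show -t ∈ Icc 0 (-m) from ⟨by linarith [ht.2], by linarith [ht.1]⟩)
    simpa using this
  · intro U hU
    obtain ⟨κ, hκ, hκU⟩ := Metric.eventually_nhds_iff_ball.1 (hWt.eventually hU)
    simp only [mem_ball_zero_prod] at hκU
    filter_upwards [hGlt.eventually (eventually_box hκ), hGρt.eventually (eventually_box hκ)]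
      with x h1 h2 t ht
    refine hκU _ ⟨abs_lt.2 ⟨?_, ?_⟩, h1.2⟩
    · have h3 := (abs_lt.1 h2.1).1
      have := ht.1
      simp only [θ] at this
      simp only
      linarith
    · have h3 := (abs_lt.1 h1.1).2
      simp only
      linarith [ht.2]

/-! ### Reversals and the bifurcation equation -/

theorem exists_strictAntiOn {ρ : ℝ → ℝ} (hρ : AnalyticAt ℝ ρ 0) (hd : deriv ρ 0 < 0) :
    ∃ ε > 0, StrictAntiOn ρ (Ioo (-ε) ε) := by
  obtain ⟨ε, hε, h⟩ := Metric.eventually_nhds_iff_ball.1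
    (hρ.eventually_analyticAt.and (hρ.deriv.continuousAt.eventually_lt_const hd))
  simp only [mem_ball_zero_iff, Real.norm_eq_abs, abs_lt] at h
  refine ⟨ε, hε, strictAntiOn_of_deriv_neg (convex_Ioo _ _)
    (fun x hx => (h x hx).1.continuousAt.continuousWithinAt) fun x hx => ?_⟩
  rw [interior_Ioo] at hx
  exact (h x hx).2

/-- An analytic germ at `0`, together with the properties shared by the half-return maps. -/
structure IsReversal (ρ : ℝ → ℝ) : Prop where
  analyticAt : AnalyticAt ℝ ρ 0
  map_zero : ρ 0 = 0
  deriv_zero : deriv ρ 0 = -1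
  involutive : ∀ᶠ x in 𝓝 0, ρ (ρ x) = x

theorem IsReversal.tendsto {ρ : ℝ → ℝ} (h : IsReversal ρ) : Tendsto ρ (𝓝 0) (𝓝 0) := by
  have := h.analyticAt.continuousAt.tendsto
  rwa [h.map_zero] at this

theorem IsReversal.hasDerivAt {ρ : ℝ → ℝ} (h : IsReversal ρ) : HasDerivAt ρ (-1) 0 := by
  rw [← h.deriv_zero]; exact h.analyticAt.differentiableAt.hasDerivAt

theorem IsReversal.sign {ρ : ℝ → ℝ} (h : IsReversal ρ) :
    ∀ᶠ x in 𝓝 (0 : ℝ), (0 < x → ρ x < 0) ∧ (x < 0 → 0 < ρ x) :=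
  eventually_sign_of_hasDerivAt_neg h.hasDerivAt h.map_zero (by norm_num)

/-- If `ρ₂ x < ρ₁ x` for some small `x > 0`, applying the decreasing map `ρ₁` gives `x < ρ₁ (ρ₂ x)`,
while `x = ρ₂ (ρ₂ x)`. So the difference is also positive at the negative point `ρ₂ x`, which
excludes an odd order. -/
theorem even_order_aux {ρ₁ ρ₂ g : ℝ → ℝ} {m : ℕ} (h₁ : IsReversal ρ₁) (h₂ : IsReversal ρ₂)
    (hg : ContinuousAt g 0) (hg0 : 0 < g 0)
    (hd : ∀ᶠ x in 𝓝 0, ρ₁ x - ρ₂ x = x ^ m * g x) : Even m := by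
  by_contra hodd
  rw [Nat.not_even_iff_odd] at hodd
  obtain ⟨ε, hε, hanti⟩ := exists_strictAntiOn h₁.analyticAt (by rw [h₁.deriv_zero]; norm_num)
  have hI : ∀ᶠ x in 𝓝 (0 : ℝ), x ∈ Ioo (-ε) ε := Ioo_mem_nhds (neg_lt_zero.2 hε) hε
  have hgp : ∀ᶠ x in 𝓝 (0 : ℝ), 0 < g x := hg.eventually_const_lt hg0
  have hall := (hd.and (hgp.and (h₁.involutive.and (h₂.involutive.and (h₂.sign.and
    ((h₁.tendsto.eventually hI).and ((h₂.tendsto.eventually hI).and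
      (h₂.tendsto.eventually (hd.and hgp)))))))))
  obtain ⟨x, ⟨k1, k2, k3, k4, k5, k6, k7, k8, k9⟩, hx⟩ :=
    ((hall.filter_mono (nhdsWithin_le_nhds (s := Ioi (0 : ℝ)))).and self_mem_nhdsWithin).exists
  have hx : 0 < x := hx
  have a1 : ρ₂ x < ρ₁ x := by
    have := mul_pos (pow_pos hx m) k2
    linarith
  have a2 := hanti k7 k6 a1
  rw [k3] at a2
  rw [k4] at k8
  have a3 : ρ₂ x ^ m < 0 := hodd.pow_neg (k5.1 hx)
  nlinarith

/-- The displacement of two distinct reversals has even order. -/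
theorem exists_even_order {ρ₁ ρ₂ : ℝ → ℝ} (h₁ : IsReversal ρ₁) (h₂ : IsReversal ρ₂)
    (hne : ∀ᶠ x in 𝓝[>] (0 : ℝ), ρ₁ x ≠ ρ₂ x) :
    ∃ (n : ℕ) (g : ℝ → ℝ), 1 ≤ n ∧ AnalyticAt ℝ g 0 ∧ g 0 ≠ 0 ∧
      ∀ᶠ x in 𝓝 0, ρ₁ x - ρ₂ x = x ^ (2 * n) * g x := by
  have hd : AnalyticAt ℝ (fun x => ρ₁ x - ρ₂ x) 0 := h₁.analyticAt.sub h₂.analyticAt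
  have hnz : ¬ ∀ᶠ z in 𝓝 0, ρ₁ z - ρ₂ z = 0 := by
    intro hz
    obtain ⟨x, hx1, hx2⟩ := (hne.and (hz.filter_mono nhdsWithin_le_nhds)).exists
    exact hx1 (sub_eq_zero.1 hx2)
  obtain ⟨m, g, hg, hg0, hdg⟩ := hd.exists_eventuallyEq_pow_smul_nonzero_iff.2 hnz
  simp only [sub_zero, smul_eq_mul] at hdg
  have hm : Even m := by
    -- A negative leading coefficient is made positive by exchanging the two maps.
    rcases lt_or_gt_of_ne hg0 with h | h
    · refine even_order_aux (g := fun x => -g x) h₂ h₁ hg.continuousAt.neg (by linarith)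
        (hdg.mono fun x hx => ?_)
      linarith
    · exact even_order_aux h₁ h₂ hg.continuousAt h hdg
  obtain ⟨n, rfl⟩ := hm
  refine ⟨n, g, ?_, hg, hg0, by simpa [two_mul] using hdg⟩
  by_contra hn
  have hn : n = 0 := by omega
  subst hn
  have := hdg.self_of_nhds
  simp [h₁.map_zero, h₂.map_zero] at this
  exact hg0 this.symm

/-- The parameter for which a given point is fixed by the perturbed displacement. -/
theorem exists_parameter {ρ₁ ρ₂ g : ℝ → ℝ} {n : ℕ} (h₁ : IsReversal ρ₁) (h₂ : IsReversal ρ₂)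
    (hg : AnalyticAt ℝ g 0) (hg0 : g 0 ≠ 0)
    (hd : ∀ᶠ x in 𝓝 0, ρ₁ x - ρ₂ x = x ^ (2 * n) * g x) :
    ∃ (B m : ℝ → ℝ), AnalyticAt ℝ m 0 ∧ m 0 = -g 0 / 2 ∧
      (∀ᶠ x in 𝓝 0, B x = x ^ (2 * n) * m x) ∧
      ∀ᶠ p in 𝓝 (0 : ℝ × ℝ), ρ₁ (p.1 - p.2) + p.2 - ρ₂ p.1 = 0 ↔ B p.1 = p.2 := by
  -- The derivative in `x` of this equation vanishes at the origin, the derivative in `b` is `2`. It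
  -- is therefore solved for `b`.
  let E : ℝ × ℝ → ℝ := fun p => ρ₁ (p.1 - p.2) + p.2 - ρ₂ p.1
  have hEa : AnalyticAt ℝ E 0 := by
    have a1 : AnalyticAt ℝ (fun p : ℝ × ℝ => ρ₁ (p.1 - p.2)) 0 :=
      AnalyticAt.fun_comp (g := ρ₁) (f := fun p : ℝ × ℝ => p.1 - p.2)
        (by simpa using h₁.analyticAt) (analyticAt_fst.sub analyticAt_snd)
    have a2 : AnalyticAt ℝ (fun p : ℝ × ℝ => ρ₂ p.1) 0 :=
      AnalyticAt.fun_comp (g := ρ₂) (f := fun p : ℝ × ℝ => p.1) h₂.analyticAt analyticAt_fst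
    exact (a1.add analyticAt_snd).sub a2
  have hE0 : E 0 = 0 := by simp [E, h₁.map_zero, h₂.map_zero]
  have hcd : ContDiffAt ℝ ω E 0 := hEa.contDiffAt
  have hω : (ω : WithTop ℕ∞) ≠ 0 := by simp
  have hEr : (fderiv ℝ E 0 ∘L .inr ℝ ℝ ℝ) 1 = 2 := by
    have b1 : HasDerivAt (fun b : ℝ => E (0, b)) ((fderiv ℝ E 0 ∘L .inr ℝ ℝ ℝ) 1) 0 := by
      have := (HasFDerivAt.comp (f := fun u : ℝ => ((0 : ℝ), u)) (g := E)
        (g' := fderiv ℝ E 0) 0 hEa.differentiableAt.hasFDerivAt (hasFDerivAt_prodMk_right _ _))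
      exact this.hasDerivAt
    have b2 : HasDerivAt (fun b : ℝ => E (0, b)) 2 0 := by
      have c1 : HasDerivAt (fun b : ℝ => ρ₁ (0 - b)) (-1 * -1) 0 :=
        HasDerivAt.comp (h₂ := ρ₁) (h := fun b : ℝ => 0 - b) 0
          (by simpa using h₁.hasDerivAt) ((hasDerivAt_id (0 : ℝ)).const_sub 0)
      have c2 := (c1.add (hasDerivAt_id (0 : ℝ))).sub_const (ρ₂ 0)
      rw [show (-1 * -1 + 1 : ℝ) = 2 by norm_num] at c2
      exact c2
    exact b1.unique b2
  have hinv : (fderiv ℝ E 0 ∘L .inr ℝ ℝ ℝ).IsInvertible := by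
    refine ⟨ContinuousLinearEquiv.unitsEquivAut ℝ (Units.mk0 2 two_ne_zero), ?_⟩
    ext
    rw [hEr]
    simp
  let B : ℝ → ℝ := hcd.implicitFunction hω hinv
  have hBa : AnalyticAt ℝ B 0 := (hcd.contDiffAt_implicitFunction hω hinv).analyticAt
  have hB0 : B 0 = 0 := hcd.implicitFunction_apply_self hω hinv
  have hBE : ∀ᶠ x in 𝓝 (0 : ℝ), E (x, B x) = 0 := by
    have := hcd.eventually_apply_implicitFunction hω hinv
    rwa [hE0] at this
  have hBiff : ∀ᶠ p in 𝓝 (0 : ℝ × ℝ), E p = 0 ↔ B p.1 = p.2 := by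
    have := hcd.eventually_apply_eq_iff_implicitFunction hω hinv
    rwa [hE0] at this
  have hBt : Tendsto B (𝓝 0) (𝓝 0) := by
    have := hBa.continuousAt.tendsto
    rwa [hB0] at this
  -- `2 * B` is equivalent to the unperturbed displacement, up to sign
  have hlo : (fun x => (-(x ^ (2 * n) * g x)) - 2 * B x) =o[𝓝 0] fun x => 2 * B x := by
    have s1 : HasStrictDerivAt ρ₁ (-1) 0 := by
      rw [← h₁.deriv_zero]; exact h₁.analyticAt.hasStrictDerivAt
    have s2 := s1.isLittleO
    have s3 : Tendsto (fun x => (x - B x, x)) (𝓝 0) (𝓝 ((0 : ℝ), (0 : ℝ))) := by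
      have : Tendsto (fun x => (x - B x, x)) (𝓝 0) (𝓝 ((0 : ℝ) - 0, (0 : ℝ))) :=
        (tendsto_id.sub hBt).prodMk_nhds tendsto_id
      simpa using this
    have s4 := s2.comp_tendsto s3
    have s5 : (fun x => (-(x ^ (2 * n) * g x)) - 2 * B x) =ᶠ[𝓝 0]
        ((fun p : ℝ × ℝ => ρ₁ p.1 - ρ₁ p.2 - (p.1 - p.2) • (-1 : ℝ)) ∘ fun x => (x - B x, x)) := by
      filter_upwards [hd, hBE] with x hx hx'
      simp only [E] at hx'
      simp only [Function.comp_apply, smul_eq_mul]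
      linarith
    refine (s5.trans_isLittleO s4).trans_isBigO ?_
    refine IsBigO.of_bound 1 (Eventually.of_forall fun x => ?_)
    simp only [Function.comp_apply, Real.norm_eq_abs, abs_mul, abs_two, one_mul]
    rw [show x - B x - x = -B x by ring, abs_neg]
    linarith [abs_nonneg (B x)]
  have hequiv : (fun x => -(x ^ (2 * n) * g x)) ~[𝓝 0] fun x => 2 * B x := hlo
  have hlim : Tendsto (fun x => B x / x ^ (2 * n)) (𝓝[≠] 0) (𝓝 (-g 0 / 2)) := by
    have t1 : (fun x => 2 * B x) ~[𝓝[≠] 0] fun x => -(x ^ (2 * n) * g x) :=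
      (hequiv.mono nhdsWithin_le_nhds).symm
    have t2 : (fun x => B x / x ^ (2 * n)) ~[𝓝[≠] 0] fun x => -g x / 2 := by
      have t3 := t1.mul (IsEquivalent.refl (u := fun x : ℝ => 1 / (2 * x ^ (2 * n))))
      refine (t3.congr_left ?_).congr_right ?_
      · filter_upwards [self_mem_nhdsWithin] with x hx
        have hx : x ≠ 0 := hx
        simp only [Pi.mul_apply]
        field_simp
      · filter_upwards [self_mem_nhdsWithin] with x hx
        have hx : x ≠ 0 := hx
        simp only [Pi.mul_apply]
        field_simp
    refine t2.symm.tendsto_nhds ?_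
    exact ((hg.continuousAt.tendsto.neg).div_const 2).mono_left nhdsWithin_le_nhds
  have hg2 : -g 0 / 2 ≠ 0 := div_ne_zero (neg_ne_zero.2 hg0) two_ne_zero
  have hBnz : ¬ ∀ᶠ z in 𝓝 0, B z = 0 := by
    intro hz
    have : Tendsto (fun x => B x / x ^ (2 * n)) (𝓝[≠] 0) (𝓝 0) := by
      refine tendsto_const_nhds.congr' ?_
      filter_upwards [hz.filter_mono nhdsWithin_le_nhds] with x hx
      rw [hx, zero_div]
    exact hg2 (tendsto_nhds_unique hlim this)
  obtain ⟨j, m, hm, hm0, hBm⟩ := hBa.exists_eventuallyEq_pow_smul_nonzero_iff.2 hBnz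
  simp only [sub_zero, smul_eq_mul] at hBm
  have hmt : Tendsto m (𝓝[≠] 0) (𝓝 (m 0)) := hm.continuousAt.tendsto.mono_left nhdsWithin_le_nhds
  have hpow : ∀ i : ℕ, 0 < i → Tendsto (fun x : ℝ => x ^ i) (𝓝[≠] 0) (𝓝 0) := by
    intro i hi
    have : Continuous (fun x : ℝ => x ^ i) := by fun_prop
    have := this.tendsto 0
    rw [zero_pow hi.ne'] at this
    exact this.mono_left nhdsWithin_le_nhds
  have hBm' : ∀ᶠ x in 𝓝[≠] (0 : ℝ), B x = x ^ j * m x := hBm.filter_mono nhdsWithin_le_nhds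
  -- The quotient `B x / x ^ (2 * n)` has a finite nonzero limit, which fixes the order of vanishing
  -- of `B`.
  have hj : j = 2 * n := by
    rcases lt_trichotomy j (2 * n) with h | h | h
    · exfalso
      obtain ⟨i, hi⟩ := Nat.exists_eq_add_of_lt h
      have h1 : Tendsto (fun x => x ^ (i + 1) * (B x / x ^ (2 * n))) (𝓝[≠] 0) (𝓝 0) := by
        simpa using (hpow (i + 1) (by omega)).mul hlim
      refine hm0 (tendsto_nhds_unique hmt (h1.congr' ?_))
      filter_upwards [hBm', self_mem_nhdsWithin] with x hx hx0
      have hx0 : x ≠ 0 := hx0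
      rw [hx, hi, show j + i + 1 = j + (i + 1) by ring, pow_add]
      field_simp
      ring
    · exact h
    · exfalso
      obtain ⟨i, hi⟩ := Nat.exists_eq_add_of_lt h
      have h1 : Tendsto (fun x => x ^ (i + 1) * m x) (𝓝[≠] 0) (𝓝 0) := by
        simpa using (hpow (i + 1) (by omega)).mul hmt
      refine hg2 (tendsto_nhds_unique hlim (h1.congr' ?_))
      filter_upwards [hBm', self_mem_nhdsWithin] with x hx hx0
      have hx0 : x ≠ 0 := hx0
      rw [hx, hi, show 2 * n + i + 1 = 2 * n + (i + 1) by ring, pow_add]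
      field_simp
      ring
  subst hj
  refine ⟨B, m, hm, ?_, hBm, hBiff⟩
  refine tendsto_nhds_unique hmt (hlim.congr' ?_)
  filter_upwards [hBm', self_mem_nhdsWithin] with x hx hx0
  have hx0 : x ≠ 0 := hx0
  rw [hx]
  field_simp

/-- Inverts `b = x ^ (2 * n) * m x` on an interval to the right of `0`. The sign `s` is that of `m 0
= -g 0 / 2`, hence opposite to the sign of `ρ₁ - ρ₂`. The radius `R` lets the interval be chosen
within the domain of the half-return maps. -/
theorem exists_bifurcation {ρ₁ ρ₂ : ℝ → ℝ} (h₁ : IsReversal ρ₁) (h₂ : IsReversal ρ₂)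
    (hne : ∀ᶠ x in 𝓝[>] (0 : ℝ), ρ₁ x ≠ ρ₂ x) {R : ℝ} (hR : 0 < R) :
    ∃ (n : ℕ) (x₀ s : ℝ), 1 ≤ n ∧ 0 < x₀ ∧ (s = 1 ∨ s = -1) ∧
      (∀ᶠ x in 𝓝[>] (0 : ℝ), 0 < -s * (ρ₁ x - ρ₂ x)) ∧
      ∃ (η β : ℝ) (X : ℝ → ℝ), 0 < η ∧ η ≤ R ∧ 0 < β ∧
        (∀ b, 0 < s * b → s * b < β → X b ∈ Ioo 0 η ∧ |b| < X b ∧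
          ρ₁ (X b - b) + b = ρ₂ (X b) ∧
          ∀ x ∈ Ioo 0 η, ρ₁ (x - b) + b = ρ₂ x → x = X b) ∧
        Tendsto X (𝓝[{b : ℝ | 0 < s * b}] 0) (𝓝 0) ∧
        Tendsto (fun b => b / X b) (𝓝[{b : ℝ | 0 < s * b}] 0) (𝓝 0) ∧
        X ~[𝓝[{b : ℝ | 0 < s * b}] 0] fun b => x₀ * |b| ^ (1 / (2 * (n : ℝ))) := by
  obtain ⟨n, g, hn, hg, hg0, hd⟩ := exists_even_order h₁ h₂ hne
  obtain ⟨B, m, hm, hm0, hBm, hiff⟩ := exists_parameter h₁ h₂ hg hg0 hd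
  have hm0' : m 0 ≠ 0 := by rw [hm0]; exact div_ne_zero (neg_ne_zero.2 hg0) two_ne_zero
  obtain ⟨s, hs, hsm⟩ : ∃ s : ℝ, (s = 1 ∨ s = -1) ∧ 0 < s * m 0 := by
    rcases lt_or_gt_of_ne hm0' with h | h
    · exact ⟨-1, Or.inr rfl, by linarith⟩
    · exact ⟨1, Or.inl rfl, by linarith⟩
  have hss : s * s = 1 := by rcases hs with rfl | rfl <;> norm_num
  have habs : ∀ b, 0 < s * b → |b| = s * b := by
    intro b hb
    rcases hs with rfl | rfl
    · rw [one_mul] at hb ⊢; exact abs_of_pos hb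
    · rw [abs_of_neg (by linarith)]; ring
  obtain ⟨i, hi⟩ : ∃ i, 2 * n = i + 1 := ⟨2 * n - 1, by omega⟩
  have hi0 : i ≠ 0 := by omega
  rw [hi] at hd hBm
  have e1 : ∀ᶠ x in 𝓝 (0 : ℝ), 0 < s * ((i + 1 : ℕ) * m x + x * deriv m x) := by
    have : ContinuousAt (fun x => s * ((i + 1 : ℕ) * m x + x * deriv m x)) 0 :=
      continuousAt_const.mul ((continuousAt_const.mul hm.continuousAt).add
        (continuousAt_id.mul hm.deriv.continuousAt))
    refine this.eventually_const_lt ?_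
    have h2 : (0 : ℝ) < (i + 1 : ℕ) := by positivity
    have := mul_pos h2 hsm
    simp only [zero_mul, add_zero]
    linarith
  -- As `b = (x ^ i * m x) * x`, this bound becomes `|b| < X b`, which puts `X b` to the right of
  -- both contact points `0` and `b`.
  have e2 : ∀ᶠ x in 𝓝 (0 : ℝ), |x ^ i * m x| < 1 := by
    have h3 : ContinuousAt (fun x => |x ^ i * m x|) 0 :=
      ((continuousAt_id.pow i).mul hm.continuousAt).abs
    refine h3.eventually_lt_const ?_
    simp [hi0]
  obtain ⟨ε₁, hε₁, hb1⟩ := Metric.eventually_nhds_iff_ball.1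
    (hBm.and (hm.eventually_analyticAt.and (e1.and e2)))
  simp only [mem_ball_zero_iff, Real.norm_eq_abs] at hb1
  obtain ⟨ε₂, hε₂, hb2⟩ := Metric.eventually_nhds_iff_ball.1 hiff
  simp only [mem_ball_zero_prod] at hb2
  -- The half keeps the closed interval `[0, η]` inside the open neighbourhoods found so far.
  set η := min R (min ε₁ ε₂) / 2 with hη
  have hη0 : 0 < η := half_pos (lt_min hR (lt_min hε₁ hε₂))
  have hηR : η ≤ R := by have := min_le_left R (min ε₁ ε₂); linarith
  have hη1 : η < ε₁ := by
    have := (min_le_right R (min ε₁ ε₂)).trans (min_le_left _ _); linarith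
  have hη2 : η < ε₂ := by
    have := (min_le_right R (min ε₁ ε₂)).trans (min_le_right _ _); linarith
  let f : ℝ → ℝ := fun x => s * (x ^ (i + 1) * m x)
  have hfd : ∀ x ∈ Icc 0 η, HasDerivAt f
      (x ^ i * (s * ((i + 1 : ℕ) * m x + x * deriv m x))) x := by
    intro x hx
    have h1 := (hb1 x (by rw [abs_of_nonneg hx.1]; linarith [hx.2])).2.1
    have := ((hasDerivAt_pow (i + 1) x).mul h1.differentiableAt.hasDerivAt).const_mul s
    exact this.congr_deriv (by simp only [add_tsub_cancel_right]; ring)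
  have hfc : ContinuousOn f (Icc 0 η) := fun x hx => (hfd x hx).continuousAt.continuousWithinAt
  have hfm : StrictMonoOn f (Icc 0 η) := by
    refine strictMonoOn_of_deriv_pos (convex_Icc _ _) hfc fun x hx => ?_
    rw [interior_Icc] at hx
    rw [(hfd x (Ioo_subset_Icc_self hx)).deriv]
    exact mul_pos (pow_pos hx.1 _)
      (hb1 x (by rw [abs_of_pos hx.1]; linarith [hx.2])).2.2.1
  have hf0 : f 0 = 0 := by simp [f]
  have hfB : ∀ x ∈ Ioo 0 η, f x = s * B x := fun x hx => by
    rw [(hb1 x (by rw [abs_of_pos hx.1]; linarith [hx.2])).1]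
  have hfη : 0 < f η := by
    rw [← hf0]; exact hfm ⟨le_rfl, hη0.le⟩ ⟨hη0.le, le_rfl⟩ hη0
  have hcancel : ∀ a b : ℝ, s * a = s * b → a = b := fun a b hab => by
    have := congrArg (s * ·) hab
    simpa [← mul_assoc, hss] using this
  have hex : ∀ b, ∃ x, 0 < s * b → s * b < min (f η) ε₂ → x ∈ Ioo 0 η ∧ B x = b := by
    intro b
    by_cases hb : 0 < s * b ∧ s * b < min (f η) ε₂
    · obtain ⟨x, hx, hxb⟩ := intermediate_value_Ioo hη0.le hfc
        (show s * b ∈ Ioo (f 0) (f η) from ⟨by rw [hf0]; exact hb.1, hb.2.trans_le (min_le_left _ _)⟩)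
      rw [hfB x hx] at hxb
      exact ⟨x, fun _ _ => ⟨hx, hcancel _ _ hxb⟩⟩
    · exact ⟨0, fun h1 h2 => absurd ⟨h1, h2⟩ hb⟩
  choose X hX using hex
  set β := min (f η) ε₂ with hβ
  have hβ0 : 0 < β := lt_min hfη hε₂
  have hiff' : ∀ b, 0 < s * b → s * b < β → ∀ x ∈ Ioo 0 η,
      (ρ₁ (x - b) + b - ρ₂ x = 0 ↔ B x = b) := by
    intro b hb hb' x hx
    refine hb2 (x, b) ⟨?_, ?_⟩
    · rw [abs_of_pos hx.1]; exact hx.2.trans hη2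
    · rw [habs b hb]; exact hb'.trans_le (min_le_right _ _)
  have hBform : ∀ b, 0 < s * b → s * b < β → b = X b ^ (i + 1) * m (X b) := by
    intro b hb hb'
    obtain ⟨h1, h2⟩ := hX b hb hb'
    rw [← (hb1 _ (by rw [abs_of_pos h1.1]; linarith [h1.2])).1, h2]
  have hFβ : ∀ {δ : ℝ}, 0 < δ → ∀ᶠ b in 𝓝[{b : ℝ | 0 < s * b}] 0, 0 < s * b ∧ s * b < δ := by
    intro δ hδ
    have h1 : Tendsto (fun b => s * b) (𝓝 0) (𝓝 0) := by
      have : Continuous (fun b => s * b) := by fun_prop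
      simpa using this.tendsto 0
    have h2 : ∀ᶠ b in 𝓝[{b : ℝ | 0 < s * b}] 0, s * b < δ :=
      (h1.eventually_lt_const hδ).filter_mono nhdsWithin_le_nhds
    exact (eventually_mem_nhdsWithin).and h2
  have hXt : Tendsto X (𝓝[{b : ℝ | 0 < s * b}] 0) (𝓝 0) := by
    rw [Metric.tendsto_nhds]
    intro δ hδ
    set δ' := min δ η / 2 with hδ'
    have p0 : 0 < δ' := half_pos (lt_min hδ hη0)
    have p1 : δ' < δ := by have := min_le_left δ η; linarith
    have p2 : δ' < η := by have := min_le_right δ η; linarith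
    have p3 : 0 < f δ' := by
      rw [← hf0]; exact hfm ⟨le_rfl, hη0.le⟩ ⟨p0.le, p2.le⟩ p0
    filter_upwards [hFβ (lt_min hβ0 p3)] with b hb
    obtain ⟨h1, h2⟩ := hX b hb.1 (hb.2.trans_le (min_le_left _ _))
    have h3 : f (X b) < f δ' := by
      rw [hfB _ h1, h2]; exact hb.2.trans_le (min_le_right _ _)
    have h4 := (hfm.lt_iff_lt (Ioo_subset_Icc_self h1) ⟨p0.le, p2.le⟩).1 h3
    rw [dist_zero_right, Real.norm_eq_abs, abs_of_pos h1.1]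
    exact h4.trans p1
  have hmX : Tendsto (fun b => m (X b)) (𝓝[{b : ℝ | 0 < s * b}] 0) (𝓝 (m 0)) :=
    hm.continuousAt.tendsto.comp hXt
  have hn2 : (2 * (n : ℝ)) ≠ 0 := by positivity
  refine ⟨n, (|m 0| ^ (1 / (2 * (n : ℝ))))⁻¹, s, hn,
    inv_pos.2 (Real.rpow_pos_of_pos (abs_pos.2 hm0') _), hs, ?_, η, β, X, hη0, hηR, hβ0, ?_, hXt,
    ?_, ?_⟩
  · have hgs : 0 < -s * g 0 := by rw [hm0] at hsm; linarith
    have : ∀ᶠ x in 𝓝 (0 : ℝ), 0 < -s * g x :=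
      (continuousAt_const.mul hg.continuousAt).eventually_const_lt hgs
    filter_upwards [(this.and hd).filter_mono nhdsWithin_le_nhds, self_mem_nhdsWithin]
      with x hx hx0
    have hx0 : 0 < x := hx0
    rw [hx.2, show -s * (x ^ (i + 1) * g x) = x ^ (i + 1) * (-s * g x) by ring]
    exact mul_pos (pow_pos hx0 _) hx.1
  · intro b hb hb'
    obtain ⟨h1, h2⟩ := hX b hb hb'
    refine ⟨h1, ?_, ?_, ?_⟩
    · have h3 := (hb1 (X b) (by rw [abs_of_pos h1.1]; linarith [h1.2])).2.2.2
      have h4 : |b| = |X b ^ i * m (X b)| * X b := by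
        conv_lhs => rw [hBform b hb hb']
        rw [pow_succ, mul_right_comm, abs_mul (X b ^ i * m (X b)), abs_of_pos h1.1]
      rw [h4]
      exact mul_lt_of_lt_one_left h1.1 h3
    · have := (hiff' b hb hb' _ h1).2 h2
      linarith
    · intro x hx hxe
      have h3 := (hiff' b hb hb' x hx).1 (by linarith)
      refine hfm.injOn (Ioo_subset_Icc_self hx) (Ioo_subset_Icc_self h1) ?_
      rw [hfB x hx, hfB _ h1, h3, h2]
  · have h1 : Tendsto (fun b => X b ^ i * m (X b)) (𝓝[{b : ℝ | 0 < s * b}] 0) (𝓝 0) := by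
      have := (hXt.pow i).mul hmX
      rwa [zero_pow hi0, zero_mul] at this
    refine h1.congr' ?_
    filter_upwards [hFβ hβ0] with b hb
    obtain ⟨h2, -⟩ := hX b hb.1 hb.2
    have h3 := h2.1.ne'
    have h4 := hBform b hb.1 hb.2
    rw [pow_succ] at h4
    rw [eq_div_iff h3]
    linarith
  -- From `|b| = X b ^ (2 * n) * |m (X b)|` the root of `|b|` is `X b * |m (X b)| ^ (1 / (2 * n))`,
  -- and the second factor converges.
  · refine IsEquivalent.symm (isEquivalent_iff_exists_eq_mul.2
      ⟨fun b => (|m 0| ^ (1 / (2 * (n : ℝ))))⁻¹ * |m (X b)| ^ (1 / (2 * (n : ℝ))), ?_, ?_⟩)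
    · have h1 : Tendsto (fun b => |m (X b)| ^ (1 / (2 * (n : ℝ))))
          (𝓝[{b : ℝ | 0 < s * b}] 0) (𝓝 (|m 0| ^ (1 / (2 * (n : ℝ))))) :=
        hmX.abs.rpow_const (Or.inl (abs_ne_zero.2 hm0'))
      have h2 := h1.const_mul (|m 0| ^ (1 / (2 * (n : ℝ))))⁻¹
      rwa [inv_mul_cancel₀ (Real.rpow_pos_of_pos (abs_pos.2 hm0') _).ne'] at h2
    · filter_upwards [hFβ hβ0] with b hb
      obtain ⟨h2, -⟩ := hX b hb.1 hb.2
      simp only [Pi.mul_apply]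
      have h3 : |b| = X b ^ (2 * n) * |m (X b)| := by
        conv_lhs => rw [hBform b hb.1 hb.2]
        rw [abs_mul, abs_of_pos (pow_pos h2.1 _), hi]
      rw [h3, Real.mul_rpow (pow_nonneg h2.1.le _) (abs_nonneg _), ← Real.rpow_natCast (X b),
        ← Real.rpow_mul h2.1.le]
      push_cast
      rw [mul_one_div_cancel hn2, Real.rpow_one]
      ring

/-! ### Reduction of the lower half-plane to the upper one, and translation -/

/-- The reflection in the horizontal axis. -/
def flip (p : ℝ × ℝ) : ℝ × ℝ := (p.1, -p.2)

/-- The image of a vector field under the reflection in the horizontal axis and time reversal. -/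
def dual (Z : ℝ × ℝ → ℝ × ℝ) : ℝ × ℝ → ℝ × ℝ := fun p => (-(Z (flip p)).1, (Z (flip p)).2)

/-- The image of a curve under the reflection in the horizontal axis and time reversal. -/
def reflect (γ : ℝ → ℝ × ℝ) : ℝ → ℝ × ℝ := fun t => flip (γ (-t))

theorem flip_flip (p : ℝ × ℝ) : flip (flip p) = p := by simp [flip]

theorem flip_line (x : ℝ) : flip (x, 0) = (x, 0) := by simp [flip]

theorem dual_dual (Z : ℝ × ℝ → ℝ × ℝ) : dual (dual Z) = Z := by
  ext p <;> simp [dual, flip_flip]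

theorem dual_line (Z : ℝ × ℝ → ℝ × ℝ) (x : ℝ) : (dual Z (x, 0)).2 = (Z (x, 0)).2 := by
  simp [dual, flip_line]

theorem dual_reflect (Z : ℝ × ℝ → ℝ × ℝ) (γ : ℝ → ℝ × ℝ) (t : ℝ) :
    dual Z (reflect γ t) = (-(Z (γ (-t))).1, (Z (γ (-t))).2) := by
  simp [dual, reflect, flip_flip]

theorem hasDerivWithinAt_reflect {Z : ℝ × ℝ → ℝ × ℝ} {γ : ℝ → ℝ × ℝ} {S : Set ℝ} {t : ℝ}
    (h : HasDerivWithinAt γ (Z (γ (-t))) S (-t)) :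
    HasDerivWithinAt (reflect γ) (dual Z (reflect γ t)) (Neg.neg ⁻¹' S) t := by
  have h1 : HasDerivWithinAt (fun t : ℝ => -t) (-1) (Neg.neg ⁻¹' S) t :=
    (hasDerivAt_neg t).hasDerivWithinAt
  have h2 : HasDerivWithinAt (fun t => γ (-t)) ((-1 : ℝ) • Z (γ (-t))) (Neg.neg ⁻¹' S) t :=
    HasDerivWithinAt.scomp t h h1 (fun s hs => hs)
  rw [dual_reflect]
  have h3 : HasDerivWithinAt (fun t => (γ (-t)).1) ((-1 : ℝ) • Z (γ (-t))).1
    (Neg.neg ⁻¹' S) t := h2.fst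
  have h4 : HasDerivWithinAt (fun t => (γ (-t)).2) ((-1 : ℝ) • Z (γ (-t))).2
    (Neg.neg ⁻¹' S) t := h2.snd
  exact (h3.prodMk h4.neg).congr_deriv (by simp)

theorem hasDerivAt_reflect {Z : ℝ × ℝ → ℝ × ℝ} {γ : ℝ → ℝ × ℝ} {t : ℝ}
    (h : HasDerivAt γ (Z (γ (-t))) (-t)) :
    HasDerivAt (reflect γ) (dual Z (reflect γ t)) t := by
  have := hasDerivWithinAt_reflect (S := univ) h.hasDerivWithinAt
  rw [preimage_univ, hasDerivWithinAt_univ] at this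
  exact this

/-- Reflection reverses vertical crossings and time reversal restores their direction, so upward
crossings stay upward while the two fields exchange their roles. -/
theorem IsCrossingSolution.reflect {A B : ℝ × ℝ → ℝ × ℝ} {γ : ℝ → ℝ × ℝ}
    (h : IsCrossingSolution A B γ) : IsCrossingSolution (dual B) (dual A) (reflect γ) := by
  have hsnd : ∀ Z : ℝ × ℝ → ℝ × ℝ, ∀ t, (dual Z (PseudoHopf.reflect γ t)).2 = (Z (γ (-t))).2 := by
    intro Z t; rw [dual_reflect]
  have hIic : ∀ t : ℝ, (Neg.neg ⁻¹' Iic (-t) : Set ℝ) = Ici t := by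
    intro t; ext s; simp
  have hIci : ∀ t : ℝ, (Neg.neg ⁻¹' Ici (-t) : Set ℝ) = Iic t := by
    intro t; ext s; simp
  refine ⟨fun t ht => ?_, fun t ht => ?_, fun t ht => ?_⟩
  · exact hasDerivAt_reflect (h.lower (-t) (by simpa [PseudoHopf.reflect, flip] using ht))
  · exact hasDerivAt_reflect (h.upper (-t) (by simpa [PseudoHopf.reflect, flip] using ht))
  · have h0 : (γ (-t)).2 = 0 := by simpa [PseudoHopf.reflect, flip] using ht
    rw [hsnd, hsnd]
    rcases h.cross (-t) h0 with ⟨h1, h2, h3, h4⟩ | ⟨h1, h2, h3, h4⟩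
    · refine Or.inl ⟨h2, h1, ?_, ?_⟩
      · rw [← hIci]; exact hasDerivWithinAt_reflect h4
      · rw [← hIic]; exact hasDerivWithinAt_reflect h3
    · refine Or.inr ⟨h2, h1, ?_, ?_⟩
      · rw [← hIci]; exact hasDerivWithinAt_reflect h4
      · rw [← hIic]; exact hasDerivWithinAt_reflect h3

theorem analyticOn_dual {Z : ℝ × ℝ → ℝ × ℝ} (hZ : AnalyticOn ℝ Z (halfPlane (-1))) :
    AnalyticOn ℝ (dual Z) (halfPlane 1) := by
  have hflip : AnalyticOn ℝ flip (halfPlane 1) := by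
    have : AnalyticOnNhd ℝ flip univ := analyticOnNhd_fst.prod analyticOnNhd_snd.neg
    exact this.analyticOn.mono (subset_univ _)
  have hmaps : MapsTo flip (halfPlane 1) (halfPlane (-1)) := by
    intro p hp
    simpa [halfPlane, flip] using hp
  have h1 : AnalyticOn ℝ (Z ∘ flip) (halfPlane 1) := hZ.comp hflip hmaps
  have h2 : AnalyticOn ℝ (fun p => (Z (flip p)).1) (halfPlane 1) :=
    (ContinuousLinearMap.fst ℝ ℝ ℝ).comp_analyticOn h1
  have h3 : AnalyticOn ℝ (fun p => (Z (flip p)).2) (halfPlane 1) :=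
    (ContinuousLinearMap.snd ℝ ℝ ℝ).comp_analyticOn h1
  exact h2.neg.prod h3

theorem IsInvisibleFold.dual {Z : ℝ × ℝ → ℝ × ℝ} {k : ℕ} (h : IsInvisibleFold (-1) Z k) :
    IsInvisibleFold 1 (dual Z) k := by
  have hl : (fun x : ℝ => (PseudoHopf.dual Z (x, 0)).2) = fun x : ℝ => (Z (x, 0)).2 := by
    ext x; exact dual_line Z x
  refine ⟨h.one_le, fun i hi => by rw [hl]; exact h.vanish i hi, ?_⟩
  rw [hl]
  have := h.invisible
  simp only [PseudoHopf.dual, flip_line]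
  linarith

theorem IsHalfReturn.dual {Z : ℝ × ℝ → ℝ × ℝ} {x τ y : ℝ} (h : IsHalfReturn (-1) Z x τ y) :
    IsHalfReturn 1 (dual Z) x (-τ) y := by
  obtain ⟨ψ, h1, h2, h3, h4⟩ := h
  have hI : (Neg.neg ⁻¹' uIcc 0 τ : Set ℝ) = uIcc 0 (-τ) := by
    ext s
    simp only [mem_preimage, mem_uIcc]
    constructor <;> rintro (h | h)
    · right; constructor <;> linarith [h.1, h.2]
    · left; constructor <;> linarith [h.1, h.2]
    · right; constructor <;> linarith [h.1, h.2]
    · left; constructor <;> linarith [h.1, h.2]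
  refine ⟨reflect ψ, fun t ht => ?_, ?_, ?_, fun t ht => ?_⟩
  · rw [← hI] at ht ⊢
    exact hasDerivWithinAt_reflect (h1 (-t) ht)
  · simp [reflect, h2, flip_line]
  · simp [reflect, h3, flip_line]
  · have := h4 (-t) (by
      rcases le_total 0 τ with h | h
      · rw [min_eq_right (by linarith), max_eq_left (by linarith)] at ht
        rw [min_eq_left h, max_eq_right h]
        exact ⟨by linarith [ht.2], by linarith [ht.1]⟩
      · rw [min_eq_left (by linarith), max_eq_right (by linarith)] at ht
        rw [min_eq_right h, max_eq_left h]
        exact ⟨by linarith [ht.2], by linarith [ht.1]⟩)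
    simp only [reflect, flip]
    linarith

/-- Transfers the data at the origin to the contact point `b` with the same radius, so all bounds
are uniform in `b`. -/
theorem HalfReturn.translate {A : ℝ × ℝ → ℝ × ℝ} {r : ℝ} {ρ θ : ℝ → ℝ} {w : ℝ → ℝ → ℝ × ℝ}
    (h : HalfReturn A 0 r ρ θ w) (b : ℝ) :
    HalfReturn (translate b A) b r (fun x => ρ (x - b) + b) (fun x => θ (x - b))
      (fun x t => w (x - b) t + (b, 0)) := by
  have hmem : ∀ x ∈ Ioo b (b + r), x - b ∈ Ioo 0 (0 + r) := fun x hx =>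
    ⟨by linarith [hx.1], by linarith [hx.2]⟩
  have htr : ∀ p : ℝ × ℝ, PseudoHopf.translate b A (p + (b, 0)) = A p := by
    intro p
    simp [PseudoHopf.translate]
  have htr' : ∀ x : ℝ, PseudoHopf.translate b A (x, 0) = A (x - b, 0) := fun x => rfl
  refine ⟨?_, fun x hx => ?_, fun x hx => ?_, fun x hx => ?_, fun x hx => ?_, fun x hx => ?_,
    fun x hx => ?_, fun x hx t ht => ?_, fun x hx t ht => ?_, ?_⟩
  · rw [htr', sub_self]; exact h.center
  · rw [htr']; exact h.neg _ (hmem x hx)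
  · rw [htr']; exact h.pos _ ⟨by linarith [hx.1], by linarith [hx.2]⟩
  · have := h.ρ_lt _ (hmem x hx); linarith
  · exact h.θ_pos _ (hmem x hx)
  · simp [h.w_zero _ (hmem x hx)]
  · simp [h.w_end _ (hmem x hx)]
  · rw [htr]
    exact (h.w_deriv _ (hmem x hx) t ht).add_const _
  · have := h.w_pos _ (hmem x hx) t ht
    simpa using this
  · intro x hx γ a ha hγ hγ0 hγp t ht
    have h1 := h.unique _ (hmem x hx) (fun t => γ t - (b, 0)) a ha (fun t ht => ?_) ?_ ?_ t ht
    · rw [← h1]; simp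
    · have h2 := hγ t ht
      have h3 := htr (γ t - (b, 0))
      rw [sub_add_cancel] at h3
      rw [h3] at h2
      exact h2.sub_const _
    · simp [hγ0]
    · intro t ht
      simpa using hγp t ht

/-! ### Crossing solutions near the line -/

theorem eventually_neg_right {f : ℝ → ℝ} {a v : ℝ} (hf : HasDerivWithinAt f v (Ici a) a)
    (h0 : f a = 0) (hv : v < 0) : ∀ᶠ t in 𝓝[>] a, f t < 0 := by
  have h1 := (hasDerivWithinAt_iff_tendsto_slope' self_notMem_Ioi).1
    (hf.mono Ioi_subset_Ici_self)
  filter_upwards [h1.eventually_lt_const hv, self_mem_nhdsWithin] with t ht hta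
  have hta : a < t := hta
  rw [slope_def_field, h0, sub_zero, div_neg_iff] at ht
  rcases ht with h2 | h2
  · linarith [h2.2]
  · exact h2.1

theorem eventually_pos_right {f : ℝ → ℝ} {a v : ℝ} (hf : HasDerivWithinAt f v (Ici a) a)
    (h0 : f a = 0) (hv : 0 < v) : ∀ᶠ t in 𝓝[>] a, 0 < f t := by
  have := eventually_neg_right (f := fun t => -f t) hf.neg (by simp [h0]) (neg_lt_zero.2 hv)
  exact this.mono fun t ht => by linarith

theorem eventually_pos_left {f : ℝ → ℝ} {a v : ℝ} (hf : HasDerivWithinAt f v (Iic a) a)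
    (h0 : f a = 0) (hv : v < 0) : ∀ᶠ t in 𝓝[<] a, 0 < f t := by
  have h1 := (hasDerivWithinAt_iff_tendsto_slope' self_notMem_Iio).1
    (hf.mono Iio_subset_Iic_self)
  filter_upwards [h1.eventually_lt_const hv, self_mem_nhdsWithin] with t ht hta
  have hta : t < a := hta
  rw [slope_def_field, h0, sub_zero, div_neg_iff] at ht
  rcases ht with h2 | h2
  · exact h2.1
  · linarith [h2.2]

theorem eventually_neg_left {f : ℝ → ℝ} {a v : ℝ} (hf : HasDerivWithinAt f v (Iic a) a)
    (h0 : f a = 0) (hv : 0 < v) : ∀ᶠ t in 𝓝[<] a, f t < 0 := by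
  have := eventually_pos_left (f := fun t => -f t) hf.neg (by simp [h0]) (neg_lt_zero.2 hv)
  exact this.mono fun t ht => by linarith

/-- The point is the least zero in a compact interval that begins where `f` is already positive. -/
theorem exists_next_zero {f : ℝ → ℝ} (hf : Continuous f) {t z : ℝ} (htz : t < z) (hz : f z = 0)
    (hpos : ∀ᶠ s in 𝓝[>] t, 0 < f s) : ∃ u, t < u ∧ f u = 0 ∧ ∀ s ∈ Ioo t u, 0 < f s := by
  obtain ⟨v, hv, hv'⟩ := (mem_nhdsGT_iff_exists_Ioo_subset).1 hpos
  have hv : t < v := hv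
  obtain ⟨t', h1, h2⟩ := exists_between (lt_min hv htz)
  have hS : IsCompact (Icc t' z ∩ f ⁻¹' {0}) :=
    isCompact_Icc.inter_right (isClosed_singleton.preimage hf)
  obtain ⟨u, hu, hmin⟩ := hS.exists_isLeast
    ⟨z, ⟨(h2.trans_le (min_le_right _ _)).le, le_rfl⟩, hz⟩
  refine ⟨u, h1.trans_le hu.1.1, hu.2, fun s hs => ?_⟩
  rcases lt_or_ge s v with hsv | hsv
  · exact hv' ⟨hs.1, hsv⟩
  · have ht's : t' < s := (h2.trans_le (min_le_left _ _)).trans_le hsv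
    by_contra hneg
    have ht'pos : 0 < f t' := hv' ⟨h1, h2.trans_le (min_le_left _ _)⟩
    obtain ⟨y, hy, hy0⟩ := intermediate_value_Icc' ht's.le hf.continuousOn
      ⟨not_lt.1 hneg, ht'pos.le⟩
    have := hmin ⟨⟨hy.1, (hy.2.trans hs.2.le).trans hu.1.2⟩, hy0⟩
    linarith [hy.2, hs.2]

theorem exists_previous_zero {f : ℝ → ℝ} (hf : Continuous f) {t z : ℝ} (htz : z < t)
    (hz : f z = 0) (hpos : ∀ᶠ s in 𝓝[<] t, 0 < f s) :
    ∃ u, u < t ∧ f u = 0 ∧ ∀ s ∈ Ioo u t, 0 < f s := by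
  have h1 : ∀ᶠ s in 𝓝[>] (-t), 0 < f (-s) := by
    have h2 : Tendsto (fun s : ℝ => -s) (𝓝[>] (-t)) (𝓝[<] t) := by
      have := tendsto_neg_nhdsGT_neg (a := t)
      exact this
    exact h2.eventually hpos
  obtain ⟨u, h2, h3, h4⟩ := exists_next_zero (f := fun s => f (-s)) (by fun_prop)
    (neg_lt_neg htz) (by simpa using hz) h1
  refine ⟨-u, by linarith, h3, fun s hs => ?_⟩
  simpa using h4 (-s) ⟨by linarith [hs.2], by linarith [hs.1]⟩

theorem IsCrossingSolution.continuous {A B : ℝ × ℝ → ℝ × ℝ} {γ : ℝ → ℝ × ℝ}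
    (h : IsCrossingSolution A B γ) : Continuous γ := by
  rw [continuous_iff_continuousAt]
  intro t
  rcases lt_trichotomy (γ t).2 0 with h0 | h0 | h0
  · exact (h.lower t h0).continuousAt
  · rcases h.cross t h0 with ⟨-, -, h1, h2⟩ | ⟨-, -, h1, h2⟩ <;>
    exact continuousAt_iff_continuous_left_right.2 ⟨h1.continuousWithinAt, h2.continuousWithinAt⟩
  · exact (h.upper t h0).continuousAt

/-- Both curves agree while both are defined. Whichever of the two times is shorter, the other curve
would touch the line strictly inside its arc, where it is positive. -/
theorem HalfReturn.arc_eq {A : ℝ × ℝ → ℝ × ℝ} {c r : ℝ} {ρ θ : ℝ → ℝ} {w : ℝ → ℝ → ℝ × ℝ}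
    (h : HalfReturn A c r ρ θ w) {x τ : ℝ} (hx : x ∈ Ioo c (c + r)) (hτ : τ < 0)
    {ψ : ℝ → ℝ × ℝ} (hψ : ∀ t ∈ Icc τ 0, HasDerivWithinAt ψ (A (ψ t)) (Icc τ 0) t)
    (h0 : ψ 0 = (x, 0)) (h1 : (ψ τ).2 = 0) (hpos : ∀ t ∈ Ioo τ 0, 0 < (ψ t).2) :
    τ = -θ x ∧ ∀ t ∈ Icc (-θ x) 0, ψ t = w x t := by
  have hθ := h.θ_pos x hx
  have hnn : ∀ t ∈ Icc τ 0, 0 ≤ (ψ t).2 := by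
    intro t ht
    rcases eq_or_lt_of_le ht.1 with h2 | h2
    · rw [← h2, h1]
    · rcases eq_or_lt_of_le ht.2 with h3 | h3
      · rw [h3, h0]
      · exact (hpos t ⟨h2, h3⟩).le
  have hu := h.unique x hx ψ τ hτ.le hψ h0 hnn
  have key : τ = -θ x := by
    rcases lt_trichotomy τ (-θ x) with h2 | h2 | h2
    · have h3 := hu (-θ x) ⟨max_le h2.le le_rfl, by linarith⟩
      have h4 := hpos (-θ x) ⟨h2, by linarith⟩
      rw [h3, h.w_end x hx] at h4
      exact absurd h4 (lt_irrefl _)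
    · exact h2
    · have h3 := hu τ ⟨max_le le_rfl h2.le, hτ.le⟩
      have h4 := h.w_pos x hx τ ⟨h2, hτ⟩
      rw [← h3, h1] at h4
      exact absurd h4 (lt_irrefl _)
  refine ⟨key, fun t ht => hu t ?_⟩
  rw [key, max_self]
  exact ht

/-- Identifies the half-return maps given in the hypotheses with the analytic germ `ρ`. Forward time
is impossible, since the field points downwards at `(x, 0)` with `x > 0`. -/
theorem HalfReturn.eq_of_isHalfReturn {A : ℝ × ℝ → ℝ × ℝ} {r : ℝ} {ρ θ : ℝ → ℝ}
    {w : ℝ → ℝ → ℝ × ℝ} (h : HalfReturn A 0 r ρ θ w) {x τ y : ℝ} (hx : x ∈ Ioo 0 r) (hy : y < 0)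
    (hr : IsHalfReturn 1 A x τ y) : τ < 0 ∧ y = ρ x := by
  obtain ⟨ψ, h1, h2, h3, h4⟩ := hr
  have hx' : x ∈ Ioo 0 (0 + r) := by rwa [zero_add]
  have hτ : τ < 0 := by
    rcases lt_trichotomy τ 0 with h5 | h5 | h5
    · exact h5
    · rw [h5, h2] at h3
      have := congrArg Prod.fst h3
      simp only at this
      linarith [hx.1]
    · exfalso
      rw [uIcc_of_le h5.le] at h1
      rw [min_eq_left h5.le, max_eq_right h5.le] at h4
      have h6 := (h1 0 ⟨le_rfl, h5.le⟩).mono_of_mem_nhdsWithin (Icc_mem_nhdsGE h5)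
      rw [h2] at h6
      have h7 : HasDerivWithinAt (fun t => (ψ t).2) (A (x, 0)).2 (Ici 0) 0 := h6.snd
      have h8 := eventually_neg_right h7 (by rw [h2]) (h.neg x hx')
      obtain ⟨t, ht1, ht2⟩ := (h8.and (Ioo_mem_nhdsGT h5)).exists
      have := h4 t ht2
      linarith
  rw [uIcc_of_ge hτ.le] at h1
  rw [min_eq_right hτ.le, max_eq_left hτ.le] at h4
  obtain ⟨h5, h6⟩ := h.arc_eq hx' hτ h1 h2 (by rw [h3]) (fun t ht => by simpa using h4 t ht)
  refine ⟨hτ, ?_⟩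
  have h7 := h6 τ ⟨h5.ge, hτ.le⟩
  rw [h3, h5, h.w_end x hx'] at h7
  exact congrArg Prod.fst h7

section Orbits

variable {A B : ℝ × ℝ → ℝ × ℝ} {γ : ℝ → ℝ × ℝ}

theorem hasDerivWithinAt_snd {S : Set ℝ} {t : ℝ} {v : ℝ × ℝ} (h : HasDerivWithinAt γ v S t) :
    HasDerivWithinAt (fun s => (γ s).2) v.2 S t := h.snd

/-- A crossing solution that arrives at the line from above does so with negative speed. -/
theorem IsCrossingSolution.down (h : IsCrossingSolution A B γ) {t : ℝ} (h0 : (γ t).2 = 0)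
    (hpos : ∀ᶠ s in 𝓝[<] t, 0 < (γ s).2) :
    (A (γ t)).2 < 0 ∧ HasDerivWithinAt γ (A (γ t)) (Iic t) t := by
  rcases h.cross t h0 with ⟨-, h2, h3, -⟩ | ⟨h1, -, h3, -⟩
  · obtain ⟨s, hs1, hs2⟩ := (hpos.and (eventually_neg_left (hasDerivWithinAt_snd h3) h0 h2)).exists
    linarith
  · exact ⟨h1, h3⟩

/-- A crossing solution that leaves the line upwards does so with positive speed. -/
theorem IsCrossingSolution.up (h : IsCrossingSolution A B γ) {t : ℝ} (h0 : (γ t).2 = 0)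
    (hpos : ∀ᶠ s in 𝓝[>] t, 0 < (γ s).2) :
    0 < (A (γ t)).2 ∧ HasDerivWithinAt γ (A (γ t)) (Ici t) t := by
  rcases h.cross t h0 with ⟨h1, -, -, h4⟩ | ⟨-, h2, -, h4⟩
  · exact ⟨h1, h4⟩
  · obtain ⟨s, hs1, hs2⟩ :=
      (hpos.and (eventually_neg_right (hasDerivWithinAt_snd h4) h0 h2)).exists
    linarith

theorem IsCrossingSolution.solves_upper (h : IsCrossingSolution A B γ) {a c : ℝ} (hac : a < c)
    (ha : (γ a).2 = 0) (hc : (γ c).2 = 0) (hpos : ∀ t ∈ Ioo a c, 0 < (γ t).2) :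
    ∀ t ∈ Icc a c, HasDerivWithinAt γ (A (γ t)) (Icc a c) t := by
  intro t ht
  rcases eq_or_lt_of_le ht.1 with h1 | h1
  · subst h1
    exact (h.up ha (mem_of_superset (Ioo_mem_nhdsGT hac) hpos)).2.mono Icc_subset_Ici_self
  · rcases eq_or_lt_of_le ht.2 with h2 | h2
    · subst h2
      exact (h.down hc (mem_of_superset (Ioo_mem_nhdsLT hac) hpos)).2.mono Icc_subset_Iic_self
    · exact (h.upper t (hpos t ⟨h1, h2⟩)).hasDerivWithinAt

variable {c r : ℝ} {ρ θ : ℝ → ℝ} {w : ℝ → ℝ → ℝ × ℝ} {T : ℝ}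

/-- The field points downwards at `(x, 0)`, so the solution comes from above. Periodicity provides
an earlier zero of the height; back to the last one before `t` the curve solves the upper equation
and is the local arc. -/
theorem HalfReturn.upper_arc (H : HalfReturn A c r ρ θ w) (h : IsCrossingSolution A B γ)
    (hT : 0 < T) (hper : Function.Periodic γ T) {t x : ℝ} (h0 : γ t = (x, 0))
    (hx : x ∈ Ioo c (c + r)) : ∀ s ∈ Icc (-θ x) 0, γ (t + s) = w x s := by
  have h02 : (γ t).2 = 0 := by rw [h0]
  have hneg : (A (γ t)).2 < 0 := by rw [h0]; exact H.neg x hx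
  have hleft : HasDerivWithinAt γ (A (γ t)) (Iic t) t := by
    rcases h.cross t h02 with ⟨h1, -, -, -⟩ | ⟨-, -, h3, -⟩
    · linarith
    · exact h3
  obtain ⟨a, hat, ha, hpos⟩ := exists_previous_zero (f := fun s => (γ s).2)
    (continuous_snd.comp h.continuous) (t := t) (z := t - T) (by linarith)
    (by rw [hper.sub_eq]; exact h02) (eventually_pos_left (hasDerivWithinAt_snd hleft) h02 hneg)
  have hsol := h.solves_upper hat ha h02 hpos
  have hmaps : ∀ s ∈ Icc (a - t) 0, t + s ∈ Icc a t := fun s hs =>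
    ⟨by linarith [hs.1], by linarith [hs.2]⟩
  refine (H.arc_eq hx (τ := a - t) (ψ := fun s => γ (t + s)) (by linarith) (fun s hs => ?_)
    (by simp [h0]) (by simpa using ha) (fun s hs => ?_)).2
  · have h1 : HasDerivWithinAt (fun s : ℝ => t + s) 1 (Icc (a - t) 0) s :=
      ((hasDerivAt_id s).const_add t).hasDerivWithinAt
    have h2 := HasDerivWithinAt.scomp s (hsol _ (hmaps s hs)) h1 hmaps
    rw [one_smul] at h2
    exact h2
  · exact hpos _ ⟨by linarith [hs.1], by linarith [hs.2]⟩

/-- The contact point itself is never a crossing point, because the second component vanishes there.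
-/
theorem HalfReturn.zero_classification (H : HalfReturn A c r ρ θ w)
    (h : IsCrossingSolution A B γ) {t : ℝ} (h0 : (γ t).2 = 0)
    (hx : (γ t).1 ∈ Ioo (c - r) (c + r)) :
    ((A (γ t)).2 < 0 ∧ c < (γ t).1) ∨ (0 < (A (γ t)).2 ∧ (γ t).1 < c) := by
  have he : γ t = ((γ t).1, 0) := by rw [← h0]
  have hne : (A (γ t)).2 ≠ 0 := by
    rcases h.cross t h0 with ⟨h1, -⟩ | ⟨h1, -⟩
    · exact h1.ne'
    · exact h1.ne
  rcases lt_trichotomy (γ t).1 c with h1 | h1 | h1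
  · right
    refine ⟨?_, h1⟩
    rw [he]; exact H.pos _ ⟨hx.1, h1⟩
  · rw [he, h1] at hne
    exact absurd H.center hne
  · left
    refine ⟨?_, h1⟩
    rw [he]; exact H.neg _ ⟨h1, hx.2⟩

/-- Every point of a periodic crossing solution in the upper half-plane lies on one of the local
arcs. -/
theorem HalfReturn.exists_arc (H : HalfReturn A c r ρ θ w) (h : IsCrossingSolution A B γ)
    (hT : 0 < T) (hper : Function.Periodic γ T)
    (hzero : ∀ t, (γ t).2 = 0 → (γ t).1 ∈ Ioo (c - r) (c + r)) (hex : ∃ t, (γ t).2 = 0)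
    {t : ℝ} (ht : 0 ≤ (γ t).2) :
    ∃ t' x, γ t' = (x, 0) ∧ x ∈ Ioo c (c + r) ∧ ∃ s ∈ Icc (-θ x) 0, γ t = w x s := by
  have hcont : Continuous fun s => (γ s).2 := continuous_snd.comp h.continuous
  -- If the height is positive just after `t`, the arc sought ends at the next zero. Otherwise `γ t`
  -- is on the line and crosses downwards, so it is itself the right end of an arc.
  by_cases hcase : ∀ᶠ s in 𝓝[>] t, 0 < (γ s).2
  · obtain ⟨z, hz, hz0⟩ : ∃ z, t < z ∧ (γ z).2 = 0 := by
      obtain ⟨z, hz⟩ := hex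
      obtain ⟨n, hn⟩ := Archimedean.arch (t - z + T) hT
      refine ⟨z + n * T, ?_, ?_⟩
      · rw [nsmul_eq_mul] at hn; linarith
      · rw [hper.nat_mul n]; exact hz
    obtain ⟨u, htu, hu0, hpos⟩ := exists_next_zero hcont hz hz0 hcase
    have hd := h.down hu0 (mem_of_superset (Ioo_mem_nhdsLT htu) hpos)
    have hxu : c < (γ u).1 := by
      rcases H.zero_classification h hu0 (hzero u hu0) with h1 | h1
      · exact h1.2
      · linarith [h1.1, hd.1]
    have hxm : (γ u).1 ∈ Ioo c (c + r) := ⟨hxu, (hzero u hu0).2⟩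
    have he : γ u = ((γ u).1, 0) := by rw [← hu0]
    have harc := H.upper_arc h hT hper he hxm
    have hge : -θ (γ u).1 ≤ t - u := by
      by_contra hlt
      rw [not_le] at hlt
      have h1 := harc (-θ (γ u).1) ⟨le_rfl, by linarith [H.θ_pos _ hxm]⟩
      have h2 := hpos (u + -θ (γ u).1) ⟨by linarith, by linarith [H.θ_pos _ hxm]⟩
      rw [h1, H.w_end _ hxm] at h2
      exact lt_irrefl _ h2
    refine ⟨u, (γ u).1, he, hxm, t - u, ⟨hge, by linarith⟩, ?_⟩
    rw [← harc (t - u) ⟨hge, by linarith⟩]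
    congr 1; ring
  · have h0 : (γ t).2 = 0 := by
      by_contra hne
      have hp : 0 < (γ t).2 := lt_of_le_of_ne ht (Ne.symm hne)
      exact hcase ((hcont.continuousAt.eventually_const_lt hp).filter_mono nhdsWithin_le_nhds)
    have hneg : (A (γ t)).2 < 0 := by
      rcases h.cross t h0 with ⟨h1, -, -, h4⟩ | ⟨h1, -⟩
      · exact absurd (eventually_pos_right (hasDerivWithinAt_snd h4) h0 h1) hcase
      · exact h1
    have hx : c < (γ t).1 := by
      rcases H.zero_classification h h0 (hzero t h0) with h1 | h1
      · exact h1.2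
      · linarith [h1.1]
    have hxm : (γ t).1 ∈ Ioo c (c + r) := ⟨hx, (hzero t h0).2⟩
    have he : γ t = ((γ t).1, 0) := by rw [← h0]
    exact ⟨t, (γ t).1, he, hxm, 0, ⟨by linarith [H.θ_pos _ hxm], le_rfl⟩,
      by rw [H.w_zero _ hxm]; exact he⟩

/-- A point on the line to the left of the contact point is the start of a local arc. -/
theorem HalfReturn.exists_preimage (H : HalfReturn A c r ρ θ w) (h : IsCrossingSolution A B γ)
    (hT : 0 < T) (hper : Function.Periodic γ T)
    (hzero : ∀ t, (γ t).2 = 0 → (γ t).1 ∈ Ioo (c - r) (c + r))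
    {t z : ℝ} (ht : γ t = (z, 0)) (hz : z < c) :
    ∃ t' x, γ t' = (x, 0) ∧ x ∈ Ioo c (c + r) ∧ ρ x = z := by
  have h0 : (γ t).2 = 0 := by rw [ht]
  obtain ⟨t', x, h1, h2, s, hs, h3⟩ := H.exists_arc h hT hper hzero ⟨t, h0⟩ h0.ge
  refine ⟨t', x, h1, h2, ?_⟩
  rw [ht] at h3
  rcases eq_or_lt_of_le hs.1 with h4 | h4
  · rw [← h4, H.w_end x h2] at h3
    exact (congrArg Prod.fst h3).symm
  · rcases eq_or_lt_of_le hs.2 with h5 | h5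
    · rw [h5, H.w_zero x h2] at h3
      have := congrArg Prod.fst h3
      simp only at this
      linarith [h2.1]
    · have := H.w_pos x h2 s ⟨h4, h5⟩
      rw [← h3] at this
      exact absurd this (lt_irrefl _)

end Orbits

/-! ### Uniqueness of the periodic orbit -/

/-- A compact set on which two antitone maps have the same image up to reordering consists of
coincidence points as soon as those are unique. -/
theorem eq_of_antitoneOn {S : Set ℝ} (hS : IsCompact S) {f g : ℝ → ℝ}
    (hf : AntitoneOn f S) (hg : AntitoneOn g S) (hfg : ∀ x ∈ S, ∃ y ∈ S, f x = g y)
    (hgf : ∀ x ∈ S, ∃ y ∈ S, g x = f y) {X : ℝ} (hX : ∀ x ∈ S, f x = g x → x = X) :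
    ∀ x ∈ S, x = X := by
  intro x hx
  obtain ⟨M, hM⟩ := hS.exists_isGreatest ⟨x, hx⟩
  obtain ⟨m, hm⟩ := hS.exists_isLeast ⟨x, hx⟩
  -- The greatest point minimises both maps on `S`, and their images have the same minimum; the
  -- least point maximises both.
  have e1 : f M = g M := by
    obtain ⟨y, hy, hy'⟩ := hfg M hM.1
    obtain ⟨z, hz, hz'⟩ := hgf M hM.1
    have := hg hy hM.1 (hM.2 hy)
    have := hf hz hM.1 (hM.2 hz)
    linarith
  have e2 : f m = g m := by
    obtain ⟨y, hy, hy'⟩ := hfg m hm.1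
    obtain ⟨z, hz, hz'⟩ := hgf m hm.1
    have := hg hm.1 hy (hm.2 hy)
    have := hf hm.1 hz (hm.2 hz)
    linarith
  have h1 := hX M hM.1 e1
  have h2 := hX m hm.1 e2
  exact le_antisymm (h1 ▸ hM.2 hx) (h2 ▸ hm.2 hx)

/-- The periodic orbit formed by one upper and one lower local arc. -/
def orbitSet (θ₁ θ₂ : ℝ → ℝ) (w₁ w₂ : ℝ → ℝ → ℝ × ℝ) (x : ℝ) : Set (ℝ × ℝ) :=
  w₁ x '' Icc (-θ₁ x) 0 ∪ (fun s => flip (w₂ x s)) '' Icc (-θ₂ x) 0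

/-- Uniqueness of the crossing periodic orbit near two contact points. -/
theorem range_eq_orbitSet {A B : ℝ × ℝ → ℝ × ℝ} {b r₁ r₂ X T : ℝ} {ρ₁ θ₁ ρ₂ θ₂ : ℝ → ℝ}
    {w₁ w₂ : ℝ → ℝ → ℝ × ℝ} (H₁ : HalfReturn A b r₁ ρ₁ θ₁ w₁)
    (H₂ : HalfReturn (dual B) 0 r₂ ρ₂ θ₂ w₂) {γ : ℝ → ℝ × ℝ} (h : IsCrossingSolution A B γ)
    (hT : 0 < T) (hper : Function.Periodic γ T) (hex : ∃ t, (γ t).2 = 0)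
    (hzero₁ : ∀ t, (γ t).2 = 0 → (γ t).1 ∈ Ioo (b - r₁) (b + r₁))
    (hzero₂ : ∀ t, (γ t).2 = 0 → (γ t).1 ∈ Ioo (0 - r₂) (0 + r₂))
    (hanti₁ : AntitoneOn ρ₁ (Ioo b (b + r₁))) (hanti₂ : AntitoneOn ρ₂ (Ioo 0 (0 + r₂)))
    (hX : ∀ x ∈ Ioo b (b + r₁) ∩ Ioo 0 (0 + r₂), ρ₁ x = ρ₂ x → x = X) :
    range γ = orbitSet θ₁ θ₂ w₁ w₂ X := by
  have h' := h.reflect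
  have hper' : Function.Periodic (reflect γ) T := by
    intro t
    simp only [reflect]
    rw [neg_add', hper.sub_eq]
  have hz' : ∀ t, (reflect γ t).2 = 0 ↔ (γ (-t)).2 = 0 := by
    intro t; simp [reflect, flip]
  have hz0' : ∀ t x, reflect γ t = (x, 0) ↔ γ (-t) = (x, 0) := by
    intro t x
    simp [reflect, flip, Prod.ext_iff]
  have hzero₂' : ∀ t, (reflect γ t).2 = 0 → (reflect γ t).1 ∈ Ioo (0 - r₂) (0 + r₂) :=
    fun t ht => hzero₂ (-t) ((hz' t).1 ht)
  have hex' : ∃ t, (reflect γ t).2 = 0 := by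
    obtain ⟨t, ht⟩ := hex
    exact ⟨-t, by rw [hz', neg_neg]; exact ht⟩
  -- both contact points give the same classification of the intersections with the line
  have hsame : ∀ t, (γ t).2 = 0 → (b < (γ t).1 ↔ 0 < (γ t).1) := by
    intro t ht
    have ht' : (reflect γ (-t)).2 = 0 := by rw [hz', neg_neg]; exact ht
    have k1 := H₁.zero_classification h ht (hzero₁ t ht)
    have k2 := H₂.zero_classification h' ht' (hzero₂' _ ht')
    have k3 : (dual B (reflect γ (-t))).2 = (B (γ t)).2 := by rw [dual_reflect, neg_neg]
    have k4 : (reflect γ (-t)).1 = (γ t).1 := by simp [reflect, flip]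
    rw [k3, k4] at k2
    rcases h.cross t ht with ⟨h1, h2, -⟩ | ⟨h1, h2, -⟩
    · rcases k1 with k1 | k1
      · linarith [k1.1]
      · rcases k2 with k2 | k2
        · linarith [k2.1]
        · exact ⟨fun hh => by linarith [k1.2], fun hh => by linarith [k2.2]⟩
    · rcases k1 with k1 | k1
      · rcases k2 with k2 | k2
        · exact ⟨fun _ => k2.2, fun _ => k1.2⟩
        · linarith [k2.1]
      · linarith [k1.1]
  -- The right-hand crossings of the orbit. There may a priori be many of them.
  let S : Set ℝ := {x | 0 < x ∧ ∃ t, γ t = (x, 0)}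
  have hSmem₁ : ∀ x ∈ S, x ∈ Ioo b (b + r₁) := by
    rintro x ⟨hx, t, ht⟩
    have ht2 : (γ t).2 = 0 := by rw [ht]
    have h1 := hzero₁ t ht2
    have h2 := (hsame t ht2).2 (by rw [ht]; exact hx)
    rw [ht] at h1 h2
    exact ⟨h2, h1.2⟩
  have hSmem₂ : ∀ x ∈ S, x ∈ Ioo 0 (0 + r₂) := by
    rintro x ⟨hx, t, ht⟩
    have h1 := hzero₂ t (by rw [ht])
    rw [ht] at h1
    exact ⟨hx, h1.2⟩
  have hmemS : ∀ t x, γ t = (x, 0) → b < x → x ∈ S := by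
    intro t x ht hx
    have := (hsame t (by rw [ht])).1 (by rw [ht]; exact hx)
    rw [ht] at this
    exact ⟨this, t, ht⟩
  have hmemS' : ∀ t x, reflect γ t = (x, 0) → 0 < x → x ∈ S := fun t x ht hx =>
    ⟨hx, -t, (hz0' t x).1 ht⟩
  -- One period suffices. The condition `0 < x` may be replaced by the closed condition `0 ≤ x`
  -- because the contact point is never crossed.
  have hScomp : IsCompact S := by
    have hK : IsCompact (Icc 0 T ∩ {t | (γ t).2 = 0 ∧ 0 ≤ (γ t).1}) := by
      refine isCompact_Icc.inter_right ?_
      exact (isClosed_eq (continuous_snd.comp h.continuous) continuous_const).inter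
        (isClosed_le continuous_const (continuous_fst.comp h.continuous))
    have himg := hK.image (continuous_fst.comp h.continuous)
    convert himg using 1
    ext x
    constructor
    · rintro ⟨hx, t, ht⟩
      obtain ⟨s, hs, hs'⟩ := hper.exists_mem_Ico₀ hT t
      have hs2 : γ s = (x, 0) := by rw [← hs', ht]
      exact ⟨s, ⟨⟨hs.1, hs.2.le⟩, by rw [hs2], by rw [hs2]; exact hx.le⟩, by
        simp [Function.comp, hs2]⟩
    · rintro ⟨t, ⟨-, ht2, ht1⟩, rfl⟩
      have hne : (γ t).1 ≠ 0 := by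
        intro h0
        have ht' : (reflect γ (-t)).2 = 0 := by rw [hz', neg_neg]; exact ht2
        have k4 : (reflect γ (-t)).1 = (γ t).1 := by simp [reflect, flip]
        have := H₂.zero_classification h' ht' (hzero₂' _ ht')
        rw [k4, h0] at this
        rcases this with h1 | h1
        · exact lt_irrefl _ h1.2
        · exact lt_irrefl _ h1.2
      exact ⟨lt_of_le_of_ne ht1 (Ne.symm hne), t, by
        rw [Function.comp_apply, ← ht2]⟩
  -- Following the upper arc back from `x ∈ S` leads to a left-hand crossing, which is also the left
  -- end of a lower arc with right end `y ∈ S`; this is `ρ₁ x = ρ₂ y`. The converse exchanges the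
  -- sides.
  have hSX : ∀ x ∈ S, x = X := by
    refine eq_of_antitoneOn hScomp (hanti₁.mono hSmem₁) (hanti₂.mono hSmem₂) ?_ ?_
      (fun x hx => hX x ⟨hSmem₁ x hx, hSmem₂ x hx⟩)
    · rintro x hx
      have hx1 := hSmem₁ x hx
      obtain ⟨-, t, ht⟩ := hx
      have h1 := H₁.upper_arc h hT hper ht hx1 (-θ₁ x) ⟨le_rfl, by linarith [H₁.θ_pos x hx1]⟩
      rw [H₁.w_end x hx1] at h1
      have hρ : ρ₁ x < 0 := by
        have h2 := (hsame _ (by rw [h1])).not.1 (by rw [h1]; exact not_lt.2 (H₁.ρ_lt x hx1).le)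
        rw [h1] at h2
        have hne := H₂.zero_classification h' (t := -(t + -θ₁ x)) (by rw [hz', neg_neg, h1])
          (hzero₂' _ (by rw [hz', neg_neg, h1]))
        have k4 : (reflect γ (-(t + -θ₁ x))).1 = ρ₁ x := by
          simp only [reflect, neg_neg, h1, flip]
        rw [k4] at hne
        rcases hne with h3 | h3
        · exact absurd h3.2 h2
        · exact h3.2
      obtain ⟨t', y, hy1, hy2, hy3⟩ := H₂.exists_preimage h' hT hper' hzero₂'
        (t := -(t + -θ₁ x)) (z := ρ₁ x) (by rw [hz0', neg_neg]; exact h1) hρ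
      exact ⟨y, hmemS' t' y hy1 hy2.1, hy3.symm⟩
    · rintro x hx
      have hx2 := hSmem₂ x hx
      obtain ⟨-, t, ht⟩ := hx
      have h1 := H₂.upper_arc h' hT hper' (t := -t) (x := x) (by rw [hz0', neg_neg]; exact ht)
        hx2 (-θ₂ x) ⟨le_rfl, by linarith [H₂.θ_pos x hx2]⟩
      rw [H₂.w_end x hx2, hz0'] at h1
      have hρ : ρ₂ x < b := by
        have h2 := (hsame _ (by rw [h1])).not.2 (by rw [h1]; exact not_lt.2 (H₂.ρ_lt x hx2).le)
        rcases H₁.zero_classification h (by rw [h1]) (hzero₁ _ (by rw [h1])) with h3 | h3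
        · exact absurd h3.2 h2
        · rw [h1] at h3; exact h3.2
      obtain ⟨t', y, hy1, hy2, hy3⟩ := H₁.exists_preimage h hT hper hzero₁ h1 hρ
      exact ⟨y, hmemS t' y hy1 hy2.1, hy3.symm⟩
  apply Subset.antisymm
  · rintro p ⟨t, rfl⟩
    rcases le_total 0 (γ t).2 with h0 | h0
    · obtain ⟨t', x, h1, h2, s, hs, h3⟩ := H₁.exists_arc h hT hper hzero₁ hex h0
      have hxX := hSX x (hmemS t' x h1 h2.1)
      subst hxX
      exact Or.inl ⟨s, hs, h3.symm⟩
    · obtain ⟨t', x, h1, h2, s, hs, h3⟩ := H₂.exists_arc h' hT hper' hzero₂' hex'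
        (t := -t) (by simpa [reflect, flip] using h0)
      have hxX := hSX x (hmemS' t' x h1 h2.1)
      subst hxX
      refine Or.inr ⟨s, hs, ?_⟩
      change flip (w₂ x s) = γ t
      rw [← h3]
      simp [reflect, flip_flip]
  · obtain ⟨t₀, ht₀⟩ := hex
    obtain ⟨t', x, h1, h2, -⟩ := H₁.exists_arc h hT hper hzero₁ ⟨t₀, ht₀⟩ ht₀.ge
    have hxS := hmemS t' x h1 h2.1
    have hxX := hSX x hxS
    subst hxX
    rintro p (⟨s, hs, rfl⟩ | ⟨s, hs, rfl⟩)
    · exact ⟨t' + s, H₁.upper_arc h hT hper h1 h2 s hs⟩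
    · have h3 := H₂.upper_arc h' hT hper' (t := -t') (x := x) (by rw [hz0', neg_neg]; exact h1)
        (hSmem₂ x hxS) s hs
      refine ⟨-(-t' + s), ?_⟩
      simp only
      rw [← h3]
      simp [reflect, flip_flip]

/-! ### Construction of the periodic orbit -/

theorem hasDerivWithinAt_of_shift {γ : ℝ → ℝ × ℝ} {a t : ℝ} {v : ℝ × ℝ} {S : Set ℝ}
    (hper : ∀ s, γ (s - a) = γ s) (h : HasDerivWithinAt γ v S (t - a)) :
    HasDerivWithinAt γ v ((fun s => s - a) ⁻¹' S) t := by
  have h1 : HasDerivWithinAt (fun s : ℝ => s - a) 1 ((fun s => s - a) ⁻¹' S) t :=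
    ((hasDerivAt_id t).sub_const a).hasDerivWithinAt
  have h2 := HasDerivWithinAt.scomp t h h1 (fun s hs => hs)
  rw [one_smul] at h2
  have h3 : γ ∘ (fun s : ℝ => s - a) = γ := funext hper
  rwa [h3] at h2

theorem hasDerivWithinAt_Iic_of_shift {γ : ℝ → ℝ × ℝ} {a t : ℝ} {v : ℝ × ℝ}
    (hper : ∀ s, γ (s - a) = γ s) (h : HasDerivWithinAt γ v (Iic (t - a)) (t - a)) :
    HasDerivWithinAt γ v (Iic t) t := by
  have := hasDerivWithinAt_of_shift hper h
  simpa using this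

theorem hasDerivWithinAt_Ici_of_shift {γ : ℝ → ℝ × ℝ} {a t : ℝ} {v : ℝ × ℝ}
    (hper : ∀ s, γ (s - a) = γ s) (h : HasDerivWithinAt γ v (Ici (t - a)) (t - a)) :
    HasDerivWithinAt γ v (Ici t) t := by
  have := hasDerivWithinAt_of_shift hper h
  simpa using this

theorem hasDerivAt_of_shift {γ : ℝ → ℝ × ℝ} {a t : ℝ} {v : ℝ × ℝ}
    (hper : ∀ s, γ (s - a) = γ s) (h : HasDerivAt γ v (t - a)) : HasDerivAt γ v t := by
  have := hasDerivWithinAt_of_shift hper (S := univ) h.hasDerivWithinAt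
  rwa [preimage_univ, hasDerivWithinAt_univ] at this

/-- The equation `ρ₁ X = ρ₂ X` says that the upper and the lower arc from `(X, 0)` have the same
left end. The lower bounds on `ρ₁ X` and `ρ₂ X` ensure that both fields point upwards there. -/
theorem isCrossingPeriodicOrbit_orbitSet {A B : ℝ × ℝ → ℝ × ℝ} {b r₁ r₂ X : ℝ}
    {ρ₁ θ₁ ρ₂ θ₂ : ℝ → ℝ} {w₁ w₂ : ℝ → ℝ → ℝ × ℝ} (H₁ : HalfReturn A b r₁ ρ₁ θ₁ w₁)
    (H₂ : HalfReturn (dual B) 0 r₂ ρ₂ θ₂ w₂) (hX₁ : X ∈ Ioo b (b + r₁))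
    (hX₂ : X ∈ Ioo 0 (0 + r₂)) (hρ : ρ₁ X = ρ₂ X) (hρ₁ : b - r₁ < ρ₁ X) (hρ₂ : 0 - r₂ < ρ₂ X) :
    IsCrossingPeriodicOrbit A B (orbitSet θ₁ θ₂ w₁ w₂ X) (θ₁ X + θ₂ X) := by
  set p := θ₁ X with hp
  set q := θ₂ X with hq
  have hp0 : 0 < p := H₁.θ_pos X hX₁
  have hq0 : 0 < q := H₂.θ_pos X hX₂
  have hS : 0 < p + q := add_pos hp0 hq0
  -- Time `0` is the passage through `(X, 0)`: the upper arc occupies `[-p, 0]`, the lower one `[0,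
  -- q]`, and the curve is extended with period `p + q`.
  let γ₀ : ℝ → ℝ × ℝ := fun t => if t ≤ 0 then w₁ X t else reflect (w₂ X) t
  let γ : ℝ → ℝ × ℝ := fun t => γ₀ (toIcoMod hS (-p) t)
  have hper : Function.Periodic γ (p + q) := fun t => by
    simp only [γ, toIcoMod_add_right]
  have hself : ∀ t ∈ Ico (-p) q, γ t = γ₀ t := by
    intro t ht
    have : toIcoMod hS (-p) t = t :=
      (toIcoMod_eq_self hS).2 ⟨ht.1, by linarith [ht.2]⟩
    simp only [γ, this]
  have hF1 : ∀ t ∈ Icc (-p) 0, γ t = w₁ X t := by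
    intro t ht
    rw [hself t ⟨ht.1, by linarith [ht.2]⟩]
    simp only [γ₀, if_pos ht.2]
  have hγ0 : γ 0 = (X, 0) := by
    rw [hF1 0 ⟨by linarith, le_rfl⟩, H₁.w_zero X hX₁]
  have hγp : γ (-p) = (ρ₁ X, 0) := by
    rw [hF1 _ ⟨le_rfl, by linarith⟩, hp, H₁.w_end X hX₁]
  have hγq : γ q = (ρ₁ X, 0) := by
    rw [← hγp, ← hper (-p)]; congr 1; ring
  have hF2 : ∀ t ∈ Icc 0 q, γ t = reflect (w₂ X) t := by
    intro t ht
    rcases eq_or_lt_of_le ht.1 with h1 | h1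
    · rw [← h1, hγ0, reflect, neg_zero, H₂.w_zero X hX₂, flip_line]
    · rcases eq_or_lt_of_le ht.2 with h2 | h2
      · rw [h2, hγq, reflect, hq, H₂.w_end X hX₂, flip_line, hρ]
      · rw [hself t ⟨by linarith, h2⟩]
        simp only [γ₀, if_neg (not_le.2 h1)]
  have hpos : ∀ t ∈ Ioo (-p) 0, 0 < (γ t).2 := by
    intro t ht
    rw [hF1 t (Ioo_subset_Icc_self ht)]
    exact H₁.w_pos X hX₁ t ht
  have hneg : ∀ t ∈ Ioo 0 q, (γ t).2 < 0 := by
    intro t ht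
    rw [hF2 t (Ioo_subset_Icc_self ht)]
    have := H₂.w_pos X hX₂ (-t) ⟨by linarith [ht.2], by linarith [ht.1]⟩
    simp only [reflect, flip]
    linarith
  have hD1 : ∀ t ∈ Icc (-p) 0, HasDerivWithinAt γ (A (γ t)) (Icc (-p) 0) t := by
    intro t ht
    rw [hF1 t ht]
    exact (H₁.w_deriv X hX₁ t ht).congr hF1 (hF1 t ht)
  have hD2 : ∀ t ∈ Icc 0 q, HasDerivWithinAt γ (B (γ t)) (Icc 0 q) t := by
    intro t ht
    rw [hF2 t ht]
    have h1 := hasDerivWithinAt_reflect (t := t)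
      (H₂.w_deriv X hX₂ (-t) ⟨by linarith [ht.2], by linarith [ht.1]⟩)
    have h2 : (Neg.neg ⁻¹' Icc (-θ₂ X) 0 : Set ℝ) = Icc 0 q := by
      ext s
      simp only [mem_preimage, mem_Icc]
      constructor <;> rintro ⟨h3, h4⟩ <;> constructor <;> linarith
    rw [dual_dual, h2] at h1
    exact h1.congr hF2 (hF2 t ht)
  have hAX : (A (X, 0)).2 < 0 := H₁.neg X hX₁
  have hBX : (B (X, 0)).2 < 0 := by rw [← dual_line]; exact H₂.neg X hX₂
  have hAρ : 0 < (A (ρ₁ X, 0)).2 := H₁.pos _ ⟨hρ₁, H₁.ρ_lt X hX₁⟩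
  have hBρ : 0 < (B (ρ₁ X, 0)).2 := by
    rw [hρ, ← dual_line]; exact H₂.pos _ ⟨hρ₂, H₂.ρ_lt X hX₂⟩
  have hloc : ∀ t ∈ Ico (-p) q, (0 < (γ t).2 → HasDerivAt γ (A (γ t)) t) ∧
      ((γ t).2 < 0 → HasDerivAt γ (B (γ t)) t) ∧ ((γ t).2 = 0 →
        (0 < (A (γ t)).2 ∧ 0 < (B (γ t)).2 ∧
          HasDerivWithinAt γ (B (γ t)) (Iic t) t ∧ HasDerivWithinAt γ (A (γ t)) (Ici t) t) ∨
        ((A (γ t)).2 < 0 ∧ (B (γ t)).2 < 0 ∧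
          HasDerivWithinAt γ (A (γ t)) (Iic t) t ∧ HasDerivWithinAt γ (B (γ t)) (Ici t) t)) := by
    intro t ht
    rcases lt_trichotomy t 0 with h0 | h0 | h0
    · rcases eq_or_lt_of_le ht.1 with h1 | h1
      · subst h1
        have hy : (γ (-p)).2 = 0 := by rw [hγp]
        refine ⟨fun h => absurd h (by rw [hy]; exact lt_irrefl _),
          fun h => absurd h (by rw [hy]; exact lt_irrefl _), fun _ => Or.inl ⟨?_, ?_, ?_, ?_⟩⟩
        · rw [hγp]; exact hAρ
        · rw [hγp]; exact hBρ
        -- The left derivative at `-p` is that at `q`, one period later, where the lower arc ends.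
        · refine hasDerivWithinAt_Iic_of_shift (a := -(p + q)) (fun s => ?_) ?_
          · rw [sub_neg_eq_add, hper]
          · rw [show -p - -(p + q) = q by ring, hγp, ← hγq]
            exact (hD2 q ⟨hq0.le, le_rfl⟩).mono_of_mem_nhdsWithin (Icc_mem_nhdsLE hq0)
        · exact (hD1 (-p) ⟨le_rfl, h0.le⟩).mono_of_mem_nhdsWithin (Icc_mem_nhdsGE h0)
      · have hy := hpos t ⟨h1, h0⟩
        refine ⟨fun _ => ?_, fun h => absurd h (not_lt.2 hy.le), fun h => absurd h hy.ne'⟩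
        exact (hD1 t ⟨h1.le, h0.le⟩).hasDerivAt (Icc_mem_nhds h1 h0)
    · subst h0
      have hy : (γ 0).2 = 0 := by rw [hγ0]
      refine ⟨fun h => absurd h (by rw [hy]; exact lt_irrefl _),
        fun h => absurd h (by rw [hy]; exact lt_irrefl _), fun _ => Or.inr ⟨?_, ?_, ?_, ?_⟩⟩
      · rw [hγ0]; exact hAX
      · rw [hγ0]; exact hBX
      · exact (hD1 0 ⟨by linarith, le_rfl⟩).mono_of_mem_nhdsWithin (Icc_mem_nhdsLE (by linarith))
      · exact (hD2 0 ⟨le_rfl, hq0.le⟩).mono_of_mem_nhdsWithin (Icc_mem_nhdsGE hq0)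
    · have hy := hneg t ⟨h0, ht.2⟩
      refine ⟨fun h => absurd h (not_lt.2 hy.le), fun _ => ?_, fun h => absurd h hy.ne⟩
      exact (hD2 t ⟨h0.le, ht.2.le⟩).hasDerivAt (Icc_mem_nhds h0 ht.2)
  have hshift : ∀ t, ∃ a, (∀ s, γ (s - a) = γ s) ∧ t - a ∈ Ico (-p) q := by
    intro t
    refine ⟨toIcoDiv hS (-p) t • (p + q), fun s => hper.sub_zsmul_eq _, ?_⟩
    have h1 := sub_toIcoDiv_zsmul_mem_Ico hS (-p) t
    exact ⟨h1.1, by linarith [h1.2]⟩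
  refine ⟨γ, ⟨fun t ht => ?_, fun t ht => ?_, fun t ht => ?_⟩, ?_, ⟨0, by rw [hγ0]⟩, hS, hper, ?_⟩
  · obtain ⟨a, ha, hta⟩ := hshift t
    rw [← ha t] at ht ⊢
    exact hasDerivAt_of_shift ha ((hloc _ hta).1 ht)
  · obtain ⟨a, ha, hta⟩ := hshift t
    rw [← ha t] at ht ⊢
    exact hasDerivAt_of_shift ha ((hloc _ hta).2.1 ht)
  · obtain ⟨a, ha, hta⟩ := hshift t
    rw [← ha t] at ht ⊢
    rcases (hloc _ hta).2.2 ht with ⟨h1, h2, h3, h4⟩ | ⟨h1, h2, h3, h4⟩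
    · exact Or.inl ⟨h1, h2, hasDerivWithinAt_Iic_of_shift ha h3,
        hasDerivWithinAt_Ici_of_shift ha h4⟩
    · exact Or.inr ⟨h1, h2, hasDerivWithinAt_Iic_of_shift ha h3,
        hasDerivWithinAt_Ici_of_shift ha h4⟩
  · apply Subset.antisymm
    · rintro _ ⟨t, rfl⟩
      obtain ⟨a, ha, hta⟩ := hshift t
      rw [← ha t]
      rcases le_total (t - a) 0 with h0 | h0
      · exact Or.inl ⟨t - a, ⟨hta.1, h0⟩, (hF1 _ ⟨hta.1, h0⟩).symm⟩
      · refine Or.inr ⟨-(t - a), ⟨?_, by linarith⟩, (hF2 _ ⟨h0, hta.2.le⟩).symm⟩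
        linarith [hta.2]
    · rintro _ (⟨s, hs, rfl⟩ | ⟨s, hs, rfl⟩)
      · exact ⟨s, hF1 s hs⟩
      · refine ⟨-s, ?_⟩
        rw [hF2 (-s) ⟨by linarith [hs.2], by linarith [hs.1]⟩]
        simp [reflect]
  -- A shorter period would bring the curve back to `(X, 0)` at a time in `(0, p + q)`. There it is
  -- below the line, at the left crossing, or above the line.
  · intro S' hS' hper'
    by_contra hlt
    rw [not_le] at hlt
    have h1 : γ S' = (X, 0) := by
      have := hper' 0
      rwa [zero_add, hγ0] at this
    rcases lt_trichotomy S' q with h2 | h2 | h2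
    · have := hneg S' ⟨hS', h2⟩
      rw [h1] at this
      exact lt_irrefl _ this
    · rw [h2, hγq] at h1
      have h3 := congrArg Prod.fst h1
      simp only at h3
      linarith [H₁.ρ_lt X hX₁, hX₁.1]
    · have := hpos (S' - (p + q)) ⟨by linarith, by linarith⟩
      rw [hper.sub_eq, h1] at this
      exact lt_irrefl _ this

theorem orbitSet_inter {A B : ℝ × ℝ → ℝ × ℝ} {b r₁ r₂ X : ℝ}
    {ρ₁ θ₁ ρ₂ θ₂ : ℝ → ℝ} {w₁ w₂ : ℝ → ℝ → ℝ × ℝ} (H₁ : HalfReturn A b r₁ ρ₁ θ₁ w₁)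
    (H₂ : HalfReturn (dual B) 0 r₂ ρ₂ θ₂ w₂) (hX₁ : X ∈ Ioo b (b + r₁))
    (hX₂ : X ∈ Ioo 0 (0 + r₂)) (hρ : ρ₁ X = ρ₂ X) :
    orbitSet θ₁ θ₂ w₁ w₂ X ∩ {p | p.2 = 0 ∧ 0 < p.1} = {(X, 0)} := by
  have hρ0 : ρ₁ X < 0 := by rw [hρ]; exact H₂.ρ_lt X hX₂
  ext p
  rw [mem_singleton_iff]
  constructor
  · rintro ⟨⟨s, hs, rfl⟩ | ⟨s, hs, rfl⟩, h1, h2⟩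
    · rcases eq_or_lt_of_le hs.1 with h3 | h3
      · rw [← h3, H₁.w_end X hX₁] at h2
        exact absurd h2 (not_lt.2 hρ0.le)
      · rcases eq_or_lt_of_le hs.2 with h4 | h4
        · rw [h4, H₁.w_zero X hX₁]
        · exact absurd h1 (H₁.w_pos X hX₁ s ⟨h3, h4⟩).ne'
    · simp only [flip] at h1 h2
      rcases eq_or_lt_of_le hs.1 with h3 | h3
      · rw [← h3, H₂.w_end X hX₂, ← hρ] at h2
        exact absurd h2 (not_lt.2 hρ0.le)
      · rcases eq_or_lt_of_le hs.2 with h4 | h4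
        · simp only [h4, H₂.w_zero X hX₂, flip_line]
        · exact absurd (neg_eq_zero.1 h1) (H₂.w_pos X hX₂ s ⟨h3, h4⟩).ne'
  · rintro rfl
    exact ⟨Or.inl ⟨0, ⟨by linarith [H₁.θ_pos X hX₁], le_rfl⟩, H₁.w_zero X hX₁⟩, rfl, hX₂.1⟩

theorem HalfReturn.mono {A : ℝ × ℝ → ℝ × ℝ} {c r r' : ℝ} {ρ θ : ℝ → ℝ} {w : ℝ → ℝ → ℝ × ℝ}
    (h : HalfReturn A c r ρ θ w) (hr : r' ≤ r) : HalfReturn A c r' ρ θ w := by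
  have h1 : ∀ x ∈ Ioo c (c + r'), x ∈ Ioo c (c + r) := fun x hx => ⟨hx.1, by linarith [hx.2]⟩
  exact ⟨h.center, fun x hx => h.neg x (h1 x hx), fun x hx => h.pos x ⟨by linarith [hx.1], hx.2⟩,
    fun x hx => h.ρ_lt x (h1 x hx), fun x hx => h.θ_pos x (h1 x hx),
    fun x hx => h.w_zero x (h1 x hx), fun x hx => h.w_end x (h1 x hx),
    fun x hx => h.w_deriv x (h1 x hx), fun x hx => h.w_pos x (h1 x hx),
    fun x hx => h.unique x (h1 x hx)⟩

/-! ### Reversal of time for both fields -/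

section Negation

variable {Z Zp Zm : ℝ × ℝ → ℝ × ℝ}

theorem IsInvisibleFold.neg {s : ℝ} {k : ℕ} (h : IsInvisibleFold s Z k) :
    IsInvisibleFold s (-Z) k := by
  have hd : ∀ i, iteratedDeriv i (fun x : ℝ => ((-Z) (x, 0)).2) 0
      = -iteratedDeriv i (fun x : ℝ => (Z (x, 0)).2) 0 := by
    intro i
    exact iteratedDeriv_fun_neg i (fun x : ℝ => (Z (x, 0)).2) 0
  refine ⟨h.one_le, fun i hi => by rw [hd, h.vanish i hi, neg_zero], ?_⟩
  rw [hd]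
  have := h.invisible
  simp only [Pi.neg_apply, Prod.fst_neg]
  linarith

theorem hasDerivWithinAt_comp_neg {γ : ℝ → ℝ × ℝ} {S : Set ℝ} {t : ℝ} {v : ℝ × ℝ}
    (h : HasDerivWithinAt γ v S (-t)) :
    HasDerivWithinAt (fun t => γ (-t)) (-v) (Neg.neg ⁻¹' S) t := by
  have h1 : HasDerivWithinAt (fun t : ℝ => -t) (-1) (Neg.neg ⁻¹' S) t :=
    (hasDerivAt_neg t).hasDerivWithinAt
  exact (HasDerivWithinAt.scomp t h h1 (fun s hs => hs)).congr_deriv (by simp)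

theorem IsHalfReturn.neg {s x τ y : ℝ} (h : IsHalfReturn s Z x τ y) :
    IsHalfReturn s (-Z) x (-τ) y := by
  obtain ⟨ψ, h1, h2, h3, h4⟩ := h
  have hI : (Neg.neg ⁻¹' uIcc 0 τ : Set ℝ) = uIcc 0 (-τ) := by
    rw [neg_preimage, ← image_neg_eq_neg]
    simp
  refine ⟨fun t => ψ (-t), fun t ht => ?_, by simpa using h2, by simpa using h3,
    fun t ht => h4 (-t) ?_⟩
  · rw [← hI] at ht ⊢
    exact hasDerivWithinAt_comp_neg (h1 (-t) ht)
  · rcases le_total 0 τ with h | h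
    · rw [min_eq_right (by linarith), max_eq_left (by linarith)] at ht
      rw [min_eq_left h, max_eq_right h]
      exact ⟨by linarith [ht.2], by linarith [ht.1]⟩
    · rw [min_eq_left (by linarith), max_eq_right (by linarith)] at ht
      rw [min_eq_right h, max_eq_left h]
      exact ⟨by linarith [ht.2], by linarith [ht.1]⟩

theorem HasHalfReturns.neg {x₀ : ℝ} {τp τm φp φm : ℝ → ℝ}
    (h : HasHalfReturns Zp Zm x₀ τp τm φp φm) :
    HasHalfReturns (-Zp) (-Zm) x₀ (-τp) (-τm) φp φm where
  x₀_pos := h.x₀_pos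
  continuousOn_τp := h.continuousOn_τp.neg
  continuousOn_τm := h.continuousOn_τm.neg
  halfReturn_p x hx := (h.halfReturn_p x hx).neg
  halfReturn_m x hx := (h.halfReturn_m x hx).neg
  τ_opposite x hx := by simpa using h.τ_opposite x hx
  φp_neg := h.φp_neg
  φm_neg := h.φm_neg
  φ_ne := h.φ_ne
  φp_zero := h.φp_zero
  φm_zero := h.φm_zero
  continuousOn_φp := h.continuousOn_φp
  continuousOn_φm := h.continuousOn_φm

theorem IsCrossingSolution.neg {γ : ℝ → ℝ × ℝ} (h : IsCrossingSolution Zp Zm γ) :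
    IsCrossingSolution (-Zp) (-Zm) (fun t => γ (-t)) := by
  have hIic : ∀ t : ℝ, (Neg.neg ⁻¹' Iic (-t) : Set ℝ) = Ici t := by
    intro t; ext s; simp
  have hIci : ∀ t : ℝ, (Neg.neg ⁻¹' Ici (-t) : Set ℝ) = Iic t := by
    intro t; ext s; simp
  have hat : ∀ {t : ℝ} {v : ℝ × ℝ}, HasDerivAt γ v (-t) →
      HasDerivAt (fun t => γ (-t)) (-v) t := by
    intro t v hv
    have := hasDerivWithinAt_comp_neg (S := univ) hv.hasDerivWithinAt
    rwa [preimage_univ, hasDerivWithinAt_univ] at this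
  refine ⟨fun t ht => hat (h.upper (-t) ht), fun t ht => hat (h.lower (-t) ht), fun t ht => ?_⟩
  rcases h.cross (-t) ht with ⟨h1, h2, h3, h4⟩ | ⟨h1, h2, h3, h4⟩
  · refine Or.inr ⟨neg_lt_zero.2 h1, neg_lt_zero.2 h2, ?_, ?_⟩
    · rw [← hIci]; exact hasDerivWithinAt_comp_neg h4
    · rw [← hIic]; exact hasDerivWithinAt_comp_neg h3
  · refine Or.inl ⟨neg_pos.2 h1, neg_pos.2 h2, ?_, ?_⟩
    · rw [← hIci]; exact hasDerivWithinAt_comp_neg h4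
    · rw [← hIic]; exact hasDerivWithinAt_comp_neg h3

theorem IsCrossingPeriodicOrbit.neg {C : Set (ℝ × ℝ)} {T : ℝ}
    (h : IsCrossingPeriodicOrbit Zp Zm C T) : IsCrossingPeriodicOrbit (-Zp) (-Zm) C T := by
  obtain ⟨γ, h1, h2, ⟨t, ht⟩, hT, hper, hmin⟩ := h
  have hP : ∀ {γ : ℝ → ℝ × ℝ} {S : ℝ}, Function.Periodic γ S →
      Function.Periodic (fun t => γ (-t)) S := by
    intro γ S hS t
    change γ (-(t + S)) = γ (-t)
    rw [neg_add, ← sub_eq_add_neg]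
    exact hS.sub_eq (-t)
  refine ⟨fun t => γ (-t), h1.neg, ?_, ⟨-t, by simpa using ht⟩, hT, hP hper, fun S hS hSp => ?_⟩
  · rw [← h2]
    exact neg_surjective.range_comp γ
  · exact hmin S hS (by simpa using hP hSp)

theorem isCrossingPeriodicOrbit_neg_iff {C : Set (ℝ × ℝ)} {T : ℝ} :
    IsCrossingPeriodicOrbit (-Zp) (-Zm) C T ↔ IsCrossingPeriodicOrbit Zp Zm C T :=
  ⟨fun h => by simpa using h.neg, fun h => h.neg⟩

theorem translate_neg (b : ℝ) (Z : ℝ × ℝ → ℝ × ℝ) : translate b (-Z) = -translate b Z := rfl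

/-- Both `δ` and `σ` change sign, so `μ = -σ * δ` does not. -/
theorem mu_neg {x₀ : ℝ} {τp τm φp φm : ℝ → ℝ} (h : HasHalfReturns Zp Zm x₀ τp τm φp φm) :
    mu x₀ (-τp) φp φm = mu x₀ τp φp φm := by
  have hm : x₀ / 2 ∈ Ioo 0 x₀ := ⟨by linarith [h.x₀_pos], by linarith [h.x₀_pos]⟩
  have h0 : τp (x₀ / 2) ≠ 0 := by
    intro h0
    have := h.τ_opposite _ hm
    simp [h0] at this
  have hd : delta x₀ (-τp) = -delta x₀ τp := by
    unfold delta
    rcases lt_or_gt_of_ne h0 with h1 | h1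
    · simp [h1, not_lt.2 h1.le]
    · simp [h1, not_lt.2 h1.le]
  simp only [mu, sigma, displacement, hd, neg_mul, Real.sign_neg]
  ring

end Negation

/-! ### Proof of the bifurcation theorem -/

/-- Conclusion of the bifurcation theorem for the family obtained from `(Zp, Zm)` by translating
`Zp`, for parameters of the sign of `m`. -/
def HasCycleBranch (Zp Zm : ℝ × ℝ → ℝ × ℝ) (m : ℝ) : Prop :=
  ∃ n : ℕ, 1 ≤ n ∧ ∃ x₀ : ℝ, 0 < x₀ ∧ ∃ T₀ : ℝ, 0 < T₀ ∧
    ∃ b₀ : ℝ, 0 < b₀ ∧ ∃ U : Set (ℝ × ℝ), IsOpen U ∧ (0, 0) ∈ U ∧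
    ∃ (C : ℝ → Set (ℝ × ℝ)) (x T : ℝ → ℝ),
      (∀ b : ℝ, 0 < m * b → m * b < b₀ →
        IsCrossingLimitCycle (translate b Zp) Zm (C b) (T b) ∧
        C b ⊆ U ∧
        (∀ C' T', IsCrossingPeriodicOrbit (translate b Zp) Zm C' T' → C' ⊆ U → C' = C b) ∧
        C b ∩ {p | p.2 = 0 ∧ 0 < p.1} = {(x b, 0)}) ∧
      x ~[𝓝[{b : ℝ | 0 < m * b}] 0] (fun b => x₀ * |b| ^ (1 / (2 * (n : ℝ)))) ∧
      T ~[𝓝[{b : ℝ | 0 < m * b}] 0] (fun b => T₀ * |b| ^ (1 / (2 * (n : ℝ))))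

theorem HasCycleBranch.of_neg {Zp Zm : ℝ × ℝ → ℝ × ℝ} {m : ℝ}
    (h : HasCycleBranch (-Zp) (-Zm) m) : HasCycleBranch Zp Zm m := by
  simpa only [HasCycleBranch, IsCrossingLimitCycle, translate_neg,
    isCrossingPeriodicOrbit_neg_iff] using h

theorem exists_pos_of_eventually {s : ℝ} (hs : s = 1 ∨ s = -1) {P : ℝ → Prop}
    (h : ∀ᶠ b in 𝓝[{b : ℝ | 0 < s * b}] 0, P b) :
    ∃ b₀ > 0, ∀ b, 0 < s * b → s * b < b₀ → P b := by
  rw [eventually_nhdsWithin_iff, Metric.eventually_nhds_iff] at h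
  obtain ⟨ε, hε, h⟩ := h
  refine ⟨ε, hε, fun b h1 h2 => h ?_ h1⟩
  rw [Real.dist_eq, sub_zero]
  rcases hs with rfl | rfl
  · rw [abs_of_pos (by linarith)]; linarith
  · rw [abs_of_neg (by linarith)]; linarith

theorem eventually_time_neg {Z : ℝ × ℝ → ℝ × ℝ} {k : ℕ} (hZ : AnalyticOn ℝ Z (halfPlane 1))
    (hfold : IsInvisibleFold 1 Z k) (hP : 0 < (Z (0, 0)).1) :
    ∀ᶠ x in 𝓝[>] (0 : ℝ), ∀ τ y : ℝ, y < 0 → IsHalfReturn 1 Z x τ y → τ < 0 := by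
  obtain ⟨r, ρ, θ, w, hr, H, -⟩ := local_half_return hZ hfold hP
  filter_upwards [Ioo_mem_nhdsGT hr] with x hx τ y hy h
  exact (H.eq_of_isHalfReturn hx hy h).1

/-- If both first components were positive, the flight times from `x > 0` would be negative on both
sides, against the hypothesis that they have opposite signs. -/
theorem HasHalfReturns.lower_neg {Zp Zm : ℝ × ℝ → ℝ × ℝ} {kp km : ℕ} {x₀ : ℝ}
    {τp τm φp φm : ℝ → ℝ} (h : HasHalfReturns Zp Zm x₀ τp τm φp φm)
    (hZp : AnalyticOn ℝ Zp (halfPlane 1)) (hZm : AnalyticOn ℝ Zm (halfPlane (-1)))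
    (hp : IsInvisibleFold 1 Zp kp) (hm : IsInvisibleFold (-1) Zm km) (hP : 0 < (Zp (0, 0)).1) :
    (Zm (0, 0)).1 < 0 := by
  by_contra hn
  have h0 : (Zm (0, 0)).1 ≠ 0 := by
    intro h0
    have := hm.invisible
    rw [h0] at this
    simp at this
  have hpos : 0 < (Zm (0, 0)).1 := lt_of_le_of_ne (not_lt.1 hn) h0.symm
  have h1 := eventually_time_neg hZp hp hP
  have h2 := eventually_time_neg (analyticOn_dual hZm).neg hm.dual.neg
    (by simpa [dual, flip] using hpos)
  have h3 : ∀ᶠ x in 𝓝[>] (0 : ℝ), x ∈ Ioo 0 x₀ := Ioo_mem_nhdsGT h.x₀_pos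
  obtain ⟨x, hx, h3, h4⟩ := (h3.and (h1.and h2)).exists
  have h5 := h3 _ _ (h.φp_neg x hx) (h.halfReturn_p x hx)
  have h6 := h4 _ _ (h.φm_neg x hx) (h.halfReturn_m x hx).dual.neg
  have h7 := h.τ_opposite x hx
  rw [neg_neg] at h6
  nlinarith

/-- In the normalised situation `δ = 1`, so `μ` is the sign opposite to that of `φ⁺ - φ⁻`. -/
theorem HasHalfReturns.mu_eq {Zp Zm : ℝ × ℝ → ℝ × ℝ} {x₀ s x : ℝ} {τp τm φp φm : ℝ → ℝ}
    (h : HasHalfReturns Zp Zm x₀ τp τm φp φm) (hs : s = 1 ∨ s = -1) (hx : x ∈ Ioo 0 x₀)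
    (hτ : τp x < 0) (hφ : 0 < -s * (φp x - φm x)) : mu x₀ τp φp φm = s := by
  have hd : delta x₀ τp = 1 := by rw [delta_eq h hx, if_pos hτ]
  rw [mu, sigma_eq h hx, displacement, hd, one_mul, mul_one]
  rcases hs with rfl | rfl
  · rw [Real.sign_of_neg (by linarith), neg_neg]
  · rw [Real.sign_of_pos (by linarith)]

/-- Each flight time is asymptotic to its derivative times its argument, and `(X b - b) / X b → 1`.
-/
theorem isEquivalent_time {θ₁ θ₂ X : ℝ → ℝ} {d₁ d₂ : ℝ} {l : Filter ℝ}
    (h₁ : HasDerivAt θ₁ d₁ 0) (h₂ : HasDerivAt θ₂ d₂ 0) (hθ₁ : θ₁ 0 = 0) (hθ₂ : θ₂ 0 = 0)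
    (hd₁ : 0 < d₁) (hd₂ : 0 < d₂)
    (hX : Tendsto X l (𝓝 0)) (hbX : Tendsto (fun b => b / X b) l (𝓝 0))
    (hpos : ∀ᶠ b in l, |b| < X b) (hXb : Tendsto (fun b => X b - b) l (𝓝 0)) :
    (fun b => θ₁ (X b - b) + θ₂ (X b)) ~[l] fun b => (d₁ + d₂) * X b := by
  have hs : ∀ {θ Y : ℝ → ℝ} {d : ℝ}, HasDerivAt θ d 0 → θ 0 = 0 → Tendsto Y l (𝓝 0) →
      (∀ᶠ b in l, 0 < Y b) → Tendsto (fun b => θ (Y b) / Y b) l (𝓝 d) := by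
    intro θ Y d hθ h0 hY hYpos
    have h3 : Tendsto Y l (𝓝[≠] 0) :=
      tendsto_nhdsWithin_iff.2 ⟨hY, hYpos.mono fun b hb => hb.ne'⟩
    refine ((hasDerivAt_iff_tendsto_slope.1 hθ).comp h3).congr fun b => ?_
    simp [slope_def_field, h0]
  have h3 : ∀ᶠ b in l, 0 < X b := hpos.mono fun b hb => (abs_nonneg b).trans_lt hb
  have h4 : ∀ᶠ b in l, 0 < X b - b := hpos.mono fun b hb => by linarith [le_abs_self b]
  have h5 := ((hs h₁ hθ₁ hXb h4).mul ((tendsto_const_nhds (x := (1 : ℝ))).sub hbX)).add (hs h₂ hθ₂ hX h3)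
  have h6 := h5.div_const (d₁ + d₂)
  have h7 : (d₁ * (1 - 0) + d₂) / (d₁ + d₂) = 1 := by
    rw [sub_zero, mul_one]; exact div_self (by positivity)
  rw [h7] at h6
  refine (isEquivalent_iff_tendsto_one ?_).2 (h6.congr' ?_)
  · filter_upwards [h3] with b hb
    positivity
  · filter_upwards [h3, h4] with b hb hb'
    simp only [Pi.div_apply]
    have : d₁ + d₂ ≠ 0 := by positivity
    field_simp

/-- The case in which upper orbits run from left to right and lower ones from right to left. -/
theorem HasHalfReturns.hasCycleBranch {A B : ℝ × ℝ → ℝ × ℝ} {kA kB : ℕ} {xr : ℝ}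
    {τp τm φp φm : ℝ → ℝ} (hH : HasHalfReturns A B xr τp τm φp φm)
    (hA : AnalyticOn ℝ A (halfPlane 1)) (hB : AnalyticOn ℝ B (halfPlane (-1)))
    (hfA : IsInvisibleFold 1 A kA) (hfB : IsInvisibleFold (-1) B kB) (hP : 0 < (A (0, 0)).1) :
    HasCycleBranch A B (mu xr τp φp φm) := by
  have hPB := hH.lower_neg hA hB hfA hfB hP
  obtain ⟨r₁, ρ₁, θ₁, w₁, hr₁, H₁, an₁, z₁, d₁, inv₁, tz₁, ⟨e₁, he₁, td₁⟩, sm₁⟩ :=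
    local_half_return hA hfA hP
  obtain ⟨r₂, ρ₂, θ₂, w₂, hr₂, H₂, an₂, z₂, d₂, inv₂, tz₂, ⟨e₂, he₂, td₂⟩, sm₂⟩ :=
    local_half_return (analyticOn_dual hB) hfB.dual
      (by simpa [dual, flip] using hPB)
  have R₁ : IsReversal ρ₁ := ⟨an₁, z₁, d₁, inv₁⟩
  have R₂ : IsReversal ρ₂ := ⟨an₂, z₂, d₂, inv₂⟩
  obtain ⟨ε₁, hε₁, anti₁⟩ := exists_strictAntiOn an₁ (by rw [d₁]; norm_num)
  obtain ⟨ε₂, hε₂, anti₂⟩ := exists_strictAntiOn an₂ (by rw [d₂]; norm_num)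
  have hφ : ∀ᶠ x in 𝓝[>] (0 : ℝ),
      x ∈ Ioo 0 xr ∧ τp x < 0 ∧ φp x = ρ₁ x ∧ φm x = ρ₂ x := by
    filter_upwards [Ioo_mem_nhdsGT hr₁, Ioo_mem_nhdsGT hr₂, Ioo_mem_nhdsGT hH.x₀_pos]
      with x h1 h2 h3
    have h4 := H₁.eq_of_isHalfReturn h1 (hH.φp_neg x h3) (hH.halfReturn_p x h3)
    have h5 := H₂.eq_of_isHalfReturn h2 (hH.φm_neg x h3) (hH.halfReturn_m x h3).dual
    exact ⟨h3, h4.1, h4.2, h5.2⟩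
  have hne : ∀ᶠ x in 𝓝[>] (0 : ℝ), ρ₁ x ≠ ρ₂ x := by
    filter_upwards [hφ] with x hx
    rw [← hx.2.2.1, ← hx.2.2.2]
    exact hH.φ_ne x hx.1
  obtain ⟨n, x₀, s, hn, hx₀, hs, hsign, η, β, X, hη, hηR, hβ, hX, hX0, hbX, hXe⟩ :=
    exists_bifurcation R₁ R₂ hne (R := min (min r₁ r₂) (min ε₁ ε₂)) (by positivity)
  have hmu : mu xr τp φp φm = s := by
    obtain ⟨x, hx, h1⟩ := (hφ.and hsign).exists
    exact hH.mu_eq hs hx.1 hx.2.1 (by rw [hx.2.2.1, hx.2.2.2]; exact h1)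
  rw [hmu]
  have hηr₁ : η ≤ r₁ := hηR.trans ((min_le_left _ _).trans (min_le_left _ _))
  have hηr₂ : η ≤ r₂ := hηR.trans ((min_le_left _ _).trans (min_le_right _ _))
  have hηε₁ : η ≤ ε₁ := hηR.trans ((min_le_right _ _).trans (min_le_left _ _))
  have hηε₂ : η ≤ ε₂ := hηR.trans ((min_le_right _ _).trans (min_le_right _ _))
  have G₁ := H₁.mono hηr₁
  have G₂ := H₂.mono hηr₂
  set l : Filter ℝ := 𝓝[{b : ℝ | 0 < s * b}] 0
  have hb0 : Tendsto (fun b : ℝ => b) l (𝓝 0) := nhdsWithin_le_nhds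
  have hβl : ∀ᶠ b in l, 0 < s * b ∧ s * b < β := by
    have h1 : Tendsto (fun b : ℝ => s * b) l (𝓝 (s * 0)) := hb0.const_mul s
    rw [mul_zero] at h1
    exact Filter.Eventually.and self_mem_nhdsWithin (h1.eventually_lt_const hβ)
  have hXl : ∀ᶠ b in l, |b| < X b := hβl.mono fun b hb => (hX b hb.1 hb.2).2.1
  have hXb : Tendsto (fun b => X b - b) l (𝓝 0) := by simpa using hX0.sub hb0
  have hbox : ∀ κ > 0, {p : ℝ × ℝ | |p.1| < κ ∧ |p.2| < κ} ∈ 𝓝 (0 : ℝ × ℝ) :=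
    fun κ hκ => eventually_box hκ
  -- The neighbourhood has half-width `η / 2`. Arcs in the box of half-width `η / 4`, shifted by
  -- `|b| < η / 4`, stay inside it, and `η / 2 + η / 4 < η` keeps every crossing in it within
  -- distance `η` of both contact points.
  have hη4 : 0 < η / 4 := by positivity
  have hρ₁l : ∀ᶠ b in l, b - η < ρ₁ (X b - b) + b := by
    filter_upwards [(R₁.tendsto.comp hXb).eventually_const_lt (neg_lt_zero.2 hη)] with b hb
    simp only [Function.comp_apply] at hb
    linarith
  have hρ₂l : ∀ᶠ b in l, 0 - η < ρ₂ (X b) :=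
    (R₂.tendsto.comp hX0).eventually_const_lt (by linarith)
  have hgood := hβl.and ((hXb.eventually_lt_const hη).and (hρ₁l.and (hρ₂l.and
    ((hb0.abs.eventually_lt_const (u := η / 4) (by rwa [abs_zero])).and
      ((hXb.eventually (sm₁ _ (hbox _ hη4))).and (hX0.eventually (sm₂ _ (hbox _ hη4))))))))
  obtain ⟨b₀, hb₀, hgood⟩ := exists_pos_of_eventually hs hgood
  have hT := isEquivalent_time td₁ td₂ tz₁ tz₂ he₁ he₂ hX0 hbX hXl hXb
  refine ⟨n, hn, x₀, hx₀, (e₁ + e₂) * x₀, by positivity, b₀, hb₀,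
    {p : ℝ × ℝ | |p.1| < η / 2 ∧ |p.2| < η / 2}, ?_, by simpa using hη,
    fun b => orbitSet (fun x => θ₁ (x - b)) θ₂ (fun x t => w₁ (x - b) t + (b, 0)) w₂ (X b),
    X, fun b => θ₁ (X b - b) + θ₂ (X b), fun b hb1 hb2 => ?_, hXe, ?_⟩
  · exact (isOpen_lt continuous_fst.abs continuous_const).inter
      (isOpen_lt continuous_snd.abs continuous_const)
  · obtain ⟨⟨g1, g2⟩, g3, g4, g5, g6, g7, g8⟩ := hgood b hb1 hb2
    obtain ⟨⟨k1, k2⟩, k3, k4, k5⟩ := hX b g1 g2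
    have K₁ := G₁.translate b
    have m₁ : X b ∈ Ioo b (b + η) := ⟨(le_abs_self b).trans_lt k3, by linarith⟩
    have m₂ : X b ∈ Ioo 0 (0 + η) := ⟨k1, by linarith⟩
    have hper := isCrossingPeriodicOrbit_orbitSet K₁ G₂ m₁ m₂ k4 g4 g5
    have huniq : ∀ C' T', IsCrossingPeriodicOrbit (PseudoHopf.translate b A) B C' T' →
        C' ⊆ {p : ℝ × ℝ | |p.1| < η / 2 ∧ |p.2| < η / 2} → C' =
        orbitSet (fun x => θ₁ (x - b)) θ₂ (fun x t => w₁ (x - b) t + (b, 0)) w₂ (X b) := by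
      rintro C' T' ⟨γ, hγ, rfl, hex, hT', hperT, -⟩ hsub
      have hbd : ∀ t, -(η / 2) < (γ t).1 ∧ (γ t).1 < η / 2 := fun t =>
        abs_lt.1 (hsub (mem_range_self t)).1
      have hbb := abs_lt.1 g6
      refine range_eq_orbitSet K₁ G₂ hγ hT' hperT hex (fun t _ => ?_) (fun t _ => ?_) ?_ ?_ ?_
      · have := hbd t
        exact ⟨by linarith, by linarith⟩
      · have := hbd t
        exact ⟨by linarith, by linarith⟩
      · intro x hx y hy hxy
        have := anti₁.antitoneOn (a := x - b) (b := y - b)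
          ⟨by linarith [hx.1], by linarith [hx.2]⟩ ⟨by linarith [hy.1], by linarith [hy.2]⟩
          (by linarith)
        simpa using this
      · exact anti₂.antitoneOn.mono fun x hx => ⟨by linarith [hx.1], by linarith [hx.2]⟩
      · exact fun x hx h => k5 x ⟨hx.2.1, by linarith [hx.2.2]⟩ h
    have hsub : orbitSet (fun x => θ₁ (x - b)) θ₂ (fun x t => w₁ (x - b) t + (b, 0)) w₂ (X b) ⊆
        {p : ℝ × ℝ | |p.1| < η / 2 ∧ |p.2| < η / 2} := by
      rintro p (⟨t, ht, rfl⟩ | ⟨t, ht, rfl⟩)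
      · have h1 := g7 t ht
        have h2 : |(w₁ (X b - b) t).1 + b| ≤ |(w₁ (X b - b) t).1| + |b| := abs_add_le _ _
        simp only [mem_ofPred_eq, Prod.fst_add, Prod.snd_add, add_zero] at h1 ⊢
        exact ⟨by linarith, by linarith [h1.2]⟩
      · have h1 := g8 t ht
        simp only [mem_ofPred_eq, flip, abs_neg] at h1 ⊢
        exact ⟨by linarith, by linarith⟩
    refine ⟨⟨hper, {p : ℝ × ℝ | |p.1| < η / 2 ∧ |p.2| < η / 2}, ?_, hsub, huniq⟩, hsub, huniq,
      orbitSet_inter K₁ G₂ m₁ m₂ k4⟩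
    exact (isOpen_lt continuous_fst.abs continuous_const).inter
      (isOpen_lt continuous_snd.abs continuous_const)
  · refine hT.trans ?_
    have := (IsEquivalent.refl (u := fun _ : ℝ => e₁ + e₂) (l := l)).mul hXe
    refine this.congr_right (Eventually.of_forall fun b => ?_)
    simp only [Pi.mul_apply]
    ring

end PseudoHopf

theorem mainTheorem6
    (Zp Zm : ℝ × ℝ → ℝ × ℝ)
    (hZp : AnalyticOn ℝ Zp (PseudoHopf.halfPlane 1))
    (hZm : AnalyticOn ℝ Zm (PseudoHopf.halfPlane (-1)))
    (kp km : ℕ)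
    (hp : PseudoHopf.IsInvisibleFold 1 Zp kp)
    (hm : PseudoHopf.IsInvisibleFold (-1) Zm km)
    (xr : ℝ) (τp τm φp φm : ℝ → ℝ)
    (hH : PseudoHopf.HasHalfReturns Zp Zm xr τp τm φp φm) :
    ∃ n : ℕ, 1 ≤ n ∧ ∃ x₀ : ℝ, 0 < x₀ ∧ ∃ T₀ : ℝ, 0 < T₀ ∧
    ∃ b₀ : ℝ, 0 < b₀ ∧ ∃ U : Set (ℝ × ℝ), IsOpen U ∧ (0, 0) ∈ U ∧
    ∃ (C : ℝ → Set (ℝ × ℝ)) (x T : ℝ → ℝ),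
      (∀ b : ℝ, 0 < PseudoHopf.mu xr τp φp φm * b → PseudoHopf.mu xr τp φp φm * b < b₀ →
        PseudoHopf.IsCrossingLimitCycle (PseudoHopf.translate b Zp) Zm (C b) (T b) ∧
        C b ⊆ U ∧
        (∀ C' T', PseudoHopf.IsCrossingPeriodicOrbit (PseudoHopf.translate b Zp) Zm C' T' →
          C' ⊆ U → C' = C b) ∧
        C b ∩ {p | p.2 = 0 ∧ 0 < p.1} = {(x b, 0)}) ∧
      x ~[𝓝[{b : ℝ | 0 < PseudoHopf.mu xr τp φp φm * b}] 0]
        (fun b => x₀ * |b| ^ (1 / (2 * (n : ℝ)))) ∧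
      T ~[𝓝[{b : ℝ | 0 < PseudoHopf.mu xr τp φp φm * b}] 0]
        (fun b => T₀ * |b| ^ (1 / (2 * (n : ℝ)))) := by
  change PseudoHopf.HasCycleBranch Zp Zm (PseudoHopf.mu xr τp φp φm)
  have h0 : (Zp (0, 0)).1 ≠ 0 := by
    intro h0
    have := hp.invisible
    rw [h0] at this
    simp at this
  -- Negating both fields preserves the crossing periodic orbits, their periods and `μ`, so `P⁺ (0,
  -- 0) > 0` may be assumed.
  rcases lt_or_gt_of_ne h0 with h | h
  · refine PseudoHopf.HasCycleBranch.of_neg ?_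
    rw [← PseudoHopf.mu_neg hH]
    exact hH.neg.hasCycleBranch hZp.neg hZm.neg hp.neg hm.neg (by simpa using h)
  · exact hH.hasCycleBranch hZp hZm hp hm h
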